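/- **Definitions.** Alphabets are finite. An automaton $\mathcal A=(Q,\Delta,I,F)$ has a finite state set $Q$, and its transition congruence on $\Sigma^*$ is: $u\approx_{\mathcal A}v$ iff for all $p,q\in Q$ there is a run from $p$ to $q$ over $u$ exactly when there is one over $v$. A congruence class $\mathbf V$ associates to every alphabet $\Sigma$ a set $\mathbf V(\Sigma)$ of congruences of finite index on $\Sigma^*$ that is closed under intersection and under taking coarser congruences. It is decidable if one can decide, given a morphism from $\Sigma^*$ to a finite monoid (by the multiplication table and the images of the letters), whether its kernel congruence is in $\mathbf V(\Sigma)$. A transducer is an automaton that reads one letter per transition, with an output word in $\Sigma^*$ on every transition, initial state and final state; it realizes the pairs $(u,w)$ such that $w$ is the output (initial output, outputs of the transitions, final output) of some accepting run over $u$. It is functional if these pairs form a partial function (a transduction). A transduction is a $\mathbf V$-transduction if it is realized by a functional transducer whose underlying automaton has its transition congruence in $\mathbf V$. A bimachine consists of a complete deterministic left automaton $\mathcal L$ (reading from left to right, initial state $l_0$) and a complete deterministic right automaton $\mathcal R$ (reading from right to left, initial state $r_0$), which recognize the same language $D$, and of output functions $\omega:Q_{\mathcal L}\times\Sigma\times Q_{\mathcal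 R}\to\Sigma^*$, $\lambda:F_{\mathcal R}\to\Sigma^*$, $\rho:F_{\mathcal L}\to\Sigma^*$. It realizes the transduction with domain $D$ that maps $u$ to $\lambda(r)\,\omega(l_0,u,r_0)\,\rho(l)$, where $l,r$ are the states reached by $\mathcal L,\mathcal R$ on $u$, and $\omega(l_0,u,r_0)$ is the concatenation, over all factorizations $u=x\sigma y$ with $\sigma\in\Sigma$, ordered by $|x|$, of $\omega(l_x,\sigma,r_y)$ with $l_x$ the state of $\mathcal L$ after reading $x$ and $r_y$ the state of $\mathcal R$ after reading $y$. A bimachine $\mathcal B_1$ is finer than $\mathcal B_2$ (and $\mathcal B_2$ coarser than $\mathcal B_1$) if any two words leading $\mathcal L_1$ to the same state lead $\mathcal L_2$ to the same state, and likewise for $\mathcal R_1,\mathcal R_2$. A bimachine realizing $f$ is minimal if no bimachine realizing $f$ is strictly coarser; two bimachines realizing $f$ are equivalent if each is finer than the other. A $\mathbf V$-bimachine is one with ${\approx_{\mathcal L}}\cap{\approx_{\mathcal R}}$ in $\mathbf V$. **Theorem.** (1) Let $\mathbf V$ be a decidable congruence class. Then, given a transducer (over any alphabet), one can decide whether it realizes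 a $\mathbf V$-transduction (the answer being no if the transducer is not functional). (2) Moreover, there is an algorithm, independent of $\mathbf V$, that computes from any functional transducer, realizing $f$ say, a finite list of minimal bimachines realizing $f$ such that every minimal bimachine realizing $f$ is equivalent to one in the list, and such that for every congruence class $\mathbf V$, the function $f$ is a $\mathbf V$-transduction if and only if some bimachine in the list is a $\mathbf V$-bimachine. -/

import Mathlib

/-! ### Words, automata, congruences

An alphabet is a finite type `A`; words are lists of letters, i.e. elements of `FreeMonoid A`.
A finite automaton is a Mathlib `NFA A Q` with a finite state type `Q`. -/

/-- The transition congruence of an automaton: `u ≈ v` iff for all states `p`, `q`, there is a run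
from `p` to `q` over `u` exactly when there is one over `v`. -/
def NFA.transitionCon {A Q : Type} (M : NFA A Q) : Con (FreeMonoid A) where
  r u v := ∀ p q : Q, q ∈ M.evalFrom {p} u.toList ↔ q ∈ M.evalFrom {p} v.toList
  iseqv :=
    { refl := fun _ _ _ => Iff.rfl
      symm := fun h p q => (h p q).symm
      trans := fun h h' p q => (h p q).trans (h' p q) }
  mul' := by
    intro u u' v v' h h' p q
    simp only [FreeMonoid.toList_mul, NFA.evalFrom_append]
    rw [NFA.mem_evalFrom_iff_exists, NFA.mem_evalFrom_iff_exists]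
    exact exists_congr fun t => and_congr (h p t) (h' t q)

/-- A congruence class associates to every finite alphabet a set of congruences of finite index,
closed under intersection and under taking coarser congruences (`c ≤ d` in `Con` means that `c` is
finer than `d`). -/
structure CongruenceClass where
  mem : ∀ (A : Type) [Finite A], Set (Con (FreeMonoid A))
  finite_index : ∀ (A : Type) [Finite A] (c : Con (FreeMonoid A)), c ∈ mem A → Finite c.Quotient
  inf_mem : ∀ (A : Type) [Finite A] (c d : Con (FreeMonoid A)),
    c ∈ mem A → d ∈ mem A → c ⊓ d ∈ mem A
  mem_of_le : ∀ (A : Type) [Finite A] (c d : Con (FreeMonoid A)),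
    c ∈ mem A → c ≤ d → d ∈ mem A

/-! ### Decidable classes

Algorithms work on finite tables of natural numbers, for alphabets, monoids and state sets that are
listed as `0, 1, …, n - 1`. -/

/-- The word `w` as a list of numbers. -/
def wordCode {k : ℕ} (w : List (Fin k)) : List ℕ := w.map fun a => (a : ℕ)

/-- Number of letters, number of monoid elements, identity, multiplication table, images of the
letters. -/
abbrev MorphismCode : Type := ℕ × ℕ × ℕ × List (List ℕ) × List ℕ

/-- The description of the morphism from the free monoid over `Fin k` to the finite monoid `M` that
extends `m`, where the elements of `M` are listed by `e`. -/
def morphismCode {k n : ℕ} {M : Type} [Monoid M] (e : M ≃ Fin n) (m : Fin k → M) : MorphismCode :=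
  (k, n, (e 1 : ℕ),
    List.ofFn (fun i : Fin n => List.ofFn fun j : Fin n => (e (e.symm i * e.symm j) : ℕ)),
    List.ofFn fun a : Fin k => (e (m a) : ℕ))

/-- A class `V` is decidable if its membership problem is: given a morphism from a free monoid to a
finite monoid, does its kernel congruence belong to `V`? -/
def CongruenceClass.IsDecidable (V : CongruenceClass) : Prop :=
  ∃ d : MorphismCode → Bool, Computable d ∧
    ∀ (k n : ℕ) (M : Type) [Monoid M] (e : M ≃ Fin n) (m : Fin k → M),
      d (morphismCode e m) = true ↔ Con.ker (FreeMonoid.lift m) ∈ V.mem (Fin k)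

/-! ### Transducers -/

/-- A (real-time) transducer. `trans p a q = some x` means that `(p, a, q)` is a transition, with
output `x`, and `none` that it is not one; `init q = some x` means that `q` is an initial state with
initial output `x`; `final q = some x` means that `q` is a final state with final output `x`. -/
structure Transducer (A Q : Type) where
  trans : Q → A → Q → Option (List A)
  init : Q → Option (List A)
  final : Q → Option (List A)

namespace Transducer

variable {A Q : Type}

/-- The underlying automaton. -/
def automaton (T : Transducer A Q) : NFA A Q where
  step p a := {q | (T.trans p a q).isSome}
  start := {q | (T.init q).isSome}
  accept := {q | (T.final q).isSome}

/-- `T.Run p u q v`: there is a run from `p` to `q` over `u` with output `v`. -/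
inductive Run (T : Transducer A Q) : Q → List A → Q → List A → Prop
  | nil (q : Q) : Run T q [] q []
  | cons {p q r : Q} {a : A} {x u v : List A} (h : T.trans p a q = some x) (hr : Run T q u r v) :
      Run T p (a :: u) r (x ++ v)

/-- The pair `(u, w)` is realized by `T`. -/
def Realizes (T : Transducer A Q) (u w : List A) : Prop :=
  ∃ p q x v y, T.init p = some x ∧ T.Run p u q v ∧ T.final q = some y ∧ w = x ++ v ++ y

/-- `T` realizes the transduction (partial function) `f`. -/
def RealizesFun (T : Transducer A Q) (f : List A →. List A) : Prop :=
  ∀ u w, T.Realizes u w ↔ w ∈ f u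

/-- `T` is functional: it realizes some transduction. -/
def IsFunctional (T : Transducer A Q) : Prop := ∃ f : List A →. List A, T.RealizesFun f

end Transducer

/-- `f` is a `V`-transduction: it is realized by a (hence functional) transducer with finitely many
states whose transition congruence is in `V`. -/
def CongruenceClass.IsTransduction (V : CongruenceClass) {A : Type} [Finite A]
    (f : List A →. List A) : Prop :=
  ∃ (Q : Type) (_ : Finite Q) (T : Transducer A Q),
    T.RealizesFun f ∧ T.automaton.transitionCon ∈ V.mem A

/-- Number of letters, number of states, transition table, initial table, final table. -/
abbrev TransducerCode : Type :=
  ℕ × ℕ × List (List (List (Option (List ℕ)))) × List (Option (List ℕ)) × List (Option (List ℕ))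

/-- The description of a transducer. -/
def Transducer.code {k n : ℕ} (T : Transducer (Fin k) (Fin n)) : TransducerCode :=
  (k, n,
    List.ofFn (fun p => List.ofFn fun a => List.ofFn fun q => (T.trans p a q).map wordCode),
    List.ofFn (fun q => (T.init q).map wordCode),
    List.ofFn fun q => (T.final q).map wordCode)

/-! ### Bimachines -/

/-- A bimachine whose left automaton has states `L` and whose right automaton has states `R`, both
deterministic and complete, the right one reading words from right to left. `lfinal r = some x`
means that `r` is a final state of the right automaton and the left final function maps it to `x`;
`rfinal l = some y` means that `l` is a final state of the left automaton and the right final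
function maps it to `y`. The two automata recognize the same language. -/
structure Bimachine (A L R : Type) where
  lstep : L → A → L
  lstart : L
  rstep : R → A → R
  rstart : R
  out : L → A → R → List A
  lfinal : R → Option (List A)
  rfinal : L → Option (List A)
  same_language : ∀ u : List A,
    (rfinal (u.foldl lstep lstart)).isSome ↔ (lfinal (u.reverse.foldl rstep rstart)).isSome

namespace Bimachine

variable {A L R L' R' : Type}

/-- The left automaton. -/
def left (B : Bimachine A L R) : DFA A L where
  step := B.lstep
  start := B.lstart
  accept := {l | (B.rfinal l).isSome}

/-- The right automaton, as a deterministic automaton that is fed with the mirror image of the input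
word. -/
def right (B : Bimachine A L R) : DFA A R where
  step := B.rstep
  start := B.rstart
  accept := {r | (B.lfinal r).isSome}

/-- The state of the left automaton after reading `u` from left to right. -/
def leftEval (B : Bimachine A L R) (u : List A) : L := B.left.eval u

/-- The state of the right automaton after reading `u` from right to left. -/
def rightEval (B : Bimachine A L R) (u : List A) : R := B.right.eval u.reverse

/-- The extension of the output function to words: `out l u r` where the left automaton starts in
state `l` at the left end of `u`, and the right automaton starts in state `r` at its right end. -/
def outWord (B : Bimachine A L R) : L → List A → R → List A
  | _, [], _ => []
  | l, a :: u, r => B.out l a (B.right.evalFrom r u.reverse) ++ B.outWord (B.lstep l a) u r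

/-- The pair `(u, w)` is in the graph of the transduction realized by `B`. -/
def Realizes (B : Bimachine A L R) (u w : List A) : Prop :=
  ∃ x y, B.lfinal (B.rightEval u) = some x ∧ B.rfinal (B.leftEval u) = some y ∧
    w = x ++ B.outWord B.lstart u B.rstart ++ y

/-- `B` realizes the transduction `f`. -/
def RealizesFun (B : Bimachine A L R) (f : List A →. List A) : Prop :=
  ∀ u w, B.Realizes u w ↔ w ∈ f u

/-- `B` is finer than `B'`: the right transition congruence of the left automaton and the left
transition congruence of the right automaton are finer than those of `B'`. -/
def Finer (B : Bimachine A L R) (B' : Bimachine A L' R') : Prop :=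
  (∀ u v, B.leftEval u = B.leftEval v → B'.leftEval u = B'.leftEval v) ∧
  (∀ u v, B.rightEval u = B.rightEval v → B'.rightEval u = B'.rightEval v)

/-- `B` is a minimal bimachine realizing `f`: no bimachine realizing `f` is strictly coarser. -/
def IsMinimalFor (B : Bimachine A L R) (f : List A →. List A) : Prop :=
  B.RealizesFun f ∧
    ∀ (L' R' : Type) [Finite L'] [Finite R'] (B' : Bimachine A L' R'),
      B'.RealizesFun f → B.Finer B' → B'.Finer B

/-- The transition congruence of a bimachine: the intersection of those of its left automaton and of
its right automaton (whose transitions, read from left to right, are the reversed ones). -/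
def transitionCon (B : Bimachine A L R) : Con (FreeMonoid A) :=
  B.left.toNFA.transitionCon ⊓ B.right.toNFA.reverse.transitionCon

end Bimachine

/-- Number of letters, numbers of states of the left and right automaton; transition table and
initial state of the left automaton; the same for the right automaton; output table; tables of the
left and of the right final function. -/
abbrev BimachineCode : Type :=
  (ℕ × ℕ × ℕ) × (List (List ℕ) × ℕ) × (List (List ℕ) × ℕ) × List (List (List (List ℕ))) ×
    List (Option (List ℕ)) × List (Option (List ℕ))

/-- The description of a bimachine. -/
def Bimachine.code {k l r : ℕ} (B : Bimachine (Fin k) (Fin l) (Fin r)) : BimachineCode :=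
  ((k, l, r),
    (List.ofFn fun p => List.ofFn fun a => (B.lstep p a : ℕ), (B.lstart : ℕ)),
    (List.ofFn fun q => List.ofFn fun a => (B.rstep q a : ℕ), (B.rstart : ℕ)),
    List.ofFn (fun p => List.ofFn fun a => List.ofFn fun q => wordCode (B.out p a q)),
    List.ofFn (fun q => (B.lfinal q).map wordCode),
    List.ofFn fun p => (B.rfinal p).map wordCode)

/-- A bimachine over the alphabet `Fin k` with state sets of the form `Fin l`, `Fin r`. -/
structure FinBimachine (k : ℕ) where
  l : ℕ
  r : ℕ
  toBimachine : Bimachine (Fin k) (Fin l) (Fin r)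

/-!
Write `delay s t = s⁻¹ t`, computed in the free group over the alphabet. The proof rests on a
description of the pairs of automata that underlie a bimachine for a given transduction `f`
(`Separates`): the domain of `f` is saturated for both automata, and if `y`, `y'` lead the right
automaton to the same state, then the delay of `f (x ++ y)` and `f (x ++ y')` depends on `x` only
through the state of the left automaton. This is clearly necessary. Conversely, let the potential at
a position of the input be the longest common prefix of all images of the words that have the same
left part and a right part leading to the same right state. The separation property makes the
increments of the potential a function of the two states and the letter, so that they can serve as
outputs (`Separates.exists_bimachine`).

The subset automata of a transducer, forward and backward, are separating, and their congruences are
coarser than the transition congruence of the transducer. So every `V`-transduction has a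
`V`-bimachine, and hence a minimal one, as passing to a coarser accessible bimachine makes the
transition congruence coarser (`Transducer.RealizesFun.exists_bimachine`). In the other direction, a
bimachine is simulated by an unambiguous transducer that guesses the right states
(`Bimachine.toTransducer`). It remains to enumerate the minimal bimachines.

A separating pair of automata can be coarsened on either side, keeping the other side, to the
coarsest relation that still separates (`LeftRel`, `RightRel`). Both automata of a minimal bimachine
are therefore the coarsest ones that go with each other. To bound the number of their states, compare
two runs of a transducer for `f` over the same prefix. Suffixes with the same right state admit
finitely many delays only, one for each left state. If the two runs have a common loop, pumping it
must not produce infinitely many delays, and since roots are unique in free groups this forces the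
loop to preserve the delay (`Transducer.delay_eq_of_loop`). So all relevant delays are delays of short
runs, and the pairs of states reached over a prefix together with their short delays determine its
class (`Transducer.leftRel_of_profile_eq`). This bounds the number of left states independently of the
right automaton; the right states are treated by mirroring.

All remaining questions are decided on words of bounded length. Two transducers that never disagree on
short words never disagree (`Transducer.realizes_eq_of_short`), for the delay of two runs is
determined by any common continuation. This decides functionality and whether a candidate table
realizes `f`; the relations between states are decided by the usual pumping argument. The output words
of a reduced bimachine are bounded as factors of images of short words. So the minimal bimachines are
found by a bounded search, which is primitive recursive. Finally, the transition congruence of a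
bimachine is the kernel of the morphism to the monoid of pairs of transformations of its states
(`Bimachine.ker_lift_letterTransformation`), and a decidable class can be tested on it.
-/


/-! ### Words in the free group and longest common prefixes -/

namespace FreeGroup

variable {A : Type*}

/-- A word over `A`, seen as a positive element of the free group; this is the embedding of the free
monoid. -/
def ofWord (w : List A) : FreeGroup A := FreeGroup.mk (w.map fun a => (a, true))

theorem ofWord_append (u v : List A) : ofWord (u ++ v) = ofWord u * ofWord v := by
  simp [ofWord, ← FreeGroup.mul_mk]

theorem ofWord_append_inv_mul (p s t : List A) :
    (ofWord (p ++ s))⁻¹ * ofWord (p ++ t) = (ofWord s)⁻¹ * ofWord t := by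
  simp only [ofWord_append, mul_inv_rev]; group

theorem isReduced_map_const (w : List A) (b : Bool) :
    IsReduced (w.map fun a => (a, b)) := by
  rw [IsReduced, List.isChain_map]
  exact (List.pairwise_of_forall fun _ _ _ => rfl).isChain

theorem ofWord_injective : Function.Injective (ofWord (A := A)) := by
  classical
  intro u v h
  have := congrArg FreeGroup.toWord h
  rw [ofWord, ofWord, toWord_mk, toWord_mk, (isReduced_map_const u true).reduce_eq,
    (isReduced_map_const v true).reduce_eq] at this
  exact List.map_injective_iff.mpr (fun a b h => by simpa using h) this

end FreeGroup

open FreeGroup (ofWord)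

namespace List

open FreeGroup

variable {A : Type*}

/-- The words `a` and `b` do not both start with the same letter. -/
def Unrelated (a b : List A) : Prop := ∀ c ∈ a.head?, ∀ d ∈ b.head?, c ≠ d

theorem Unrelated.nil_left (b : List A) : Unrelated [] b := by simp [Unrelated]

theorem exists_eq_append_unrelated (s t : List A) :
    ∃ p a b, s = p ++ a ∧ t = p ++ b ∧ Unrelated a b := by
  induction s generalizing t with
  | nil => exact ⟨[], [], t, rfl, rfl, Unrelated.nil_left t⟩
  | cons c s ih =>
    cases t with
    | nil => exact ⟨[], c :: s, [], rfl, rfl, by simp [Unrelated]⟩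
    | cons d t =>
      by_cases h : c = d
      · obtain ⟨p, a, b, rfl, rfl, hab⟩ := ih t
        exact ⟨c :: p, a, b, rfl, by simp [h], hab⟩
      · exact ⟨[], c :: s, d :: t, rfl, rfl, by simp [Unrelated, h]⟩

theorem Unrelated.isReduced {a b : List A} (h : Unrelated a b) :
    FreeGroup.IsReduced ((a.map fun c => (c, false)).reverse ++ b.map fun c => (c, true)) := by
  rw [FreeGroup.IsReduced, isChain_append]
  refine ⟨?_, isReduced_map_const b true, ?_⟩
  · rw [← map_reverse]; exact isReduced_map_const _ _
  · intro x hx y hy hxy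
    rw [getLast?_reverse, head?_map] at hx
    rw [head?_map] at hy
    simp only [Option.mem_def, Option.map_eq_some_iff] at hx hy
    obtain ⟨c, hc, rfl⟩ := hx
    obtain ⟨d, hd, rfl⟩ := hy
    exact absurd hxy (h c hc d hd)

/-- The positive and the negative part of a reduced quotient of two words are determined by its
value in the free group. -/
theorem Unrelated.eq_of_inv_mul_eq {a b a' b' : List A} (h : Unrelated a b) (h' : Unrelated a' b')
    (e : (ofWord a)⁻¹ * ofWord b = (ofWord a')⁻¹ * ofWord b') : a = a' ∧ b = b' := by
  classical
  have key : ∀ a b : List A, Unrelated a b → ((ofWord a)⁻¹ * ofWord b).toWord =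
      (a.map fun c => (c, false)).reverse ++ b.map fun c => (c, true) := by
    intro a b h
    rw [ofWord, ofWord, inv_mk, mul_mk, toWord_mk, ← h.isReduced.reduce_eq]
    simp [invRev, Function.comp_def]
  have e' := congrArg FreeGroup.toWord e
  rw [key a b h, key a' b' h'] at e'
  have h1 := congrArg (fun l => (l.filter fun x => x.2).map Prod.fst) e'
  have h2 := congrArg (fun l => (l.filter fun x => !x.2).map Prod.fst) e'
  simp [filter_append, filter_map, filter_reverse, Function.comp_def] at h1 h2
  exact ⟨h2, h1⟩

/-- `m` is the longest common prefix of the words in `S`. -/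
def IsLcp (S : Set (List A)) (m : List A) : Prop :=
  (∀ s ∈ S, m <+: s) ∧ ∀ p : List A, (∀ s ∈ S, p <+: s) → p <+: m

theorem exists_isLcp {S : Set (List A)} (hS : S.Nonempty) : ∃ m, IsLcp S m := by
  obtain ⟨s, hs⟩ := hS
  let P : ℕ → Prop := fun k => ∃ p : List A, p.length = k ∧ ∀ s ∈ S, p <+: s
  classical
  have h0 : P 0 := ⟨[], rfl, fun s _ => nil_prefix⟩
  obtain ⟨m, hm, hmS⟩ : P (Nat.findGreatest P s.length) :=
    Nat.findGreatest_spec (Nat.zero_le _) h0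
  refine ⟨m, hmS, fun p hp => ?_⟩
  refine prefix_of_prefix_length_le (hp s hs) (hmS s hs) ?_
  rw [hm]
  exact Nat.le_findGreatest (hp s hs).length_le ⟨p, rfl, hp⟩

/-- If two families of words have the same quotients in the free group, then their members have the
same remainders after the longest common prefixes. -/
theorem IsLcp.remainder_suffix {ι : Type*} {ρ ρ' : ι → List A} {m m' : List A}
    (hm : IsLcp (Set.range fun i => m ++ ρ i) m)
    (h : ∀ i j, (ofWord (m ++ ρ i))⁻¹ * ofWord (m ++ ρ j) =
      (ofWord (m' ++ ρ' i))⁻¹ * ofWord (m' ++ ρ' j)) (i : ι) : ρ i <:+ ρ' i := by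
  obtain ⟨j, hj⟩ : ∃ j, Unrelated (ρ i) (ρ j) := by
    cases hi : ρ i with
    | nil => exact ⟨i, Unrelated.nil_left _⟩
    | cons c w =>
      -- otherwise the common prefix could be prolonged by the letter `c`
      by_contra! hcon
      have hc : ∀ s ∈ Set.range fun i => m ++ ρ i, m ++ [c] <+: s := by
        rintro _ ⟨j, rfl⟩
        have := hcon j
        simp only [Unrelated, head?_cons, Option.mem_def, Option.some.injEq, ne_eq, forall_eq',
          not_forall, not_not] at this
        obtain ⟨d, hd, rfl⟩ := this
        obtain ⟨v, hv⟩ := head?_eq_some_iff.mp hd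
        simp [hv]
      have := (hm.2 _ hc).length_le
      simp at this
  have e := h i j
  rw [ofWord_append_inv_mul, ofWord_append_inv_mul] at e
  obtain ⟨p, a, b, ha, hb, hab⟩ := exists_eq_append_unrelated (ρ' i) (ρ' j)
  rw [ha, hb, ofWord_append_inv_mul] at e
  exact ⟨p, by rw [ha, (hj.eq_of_inv_mul_eq hab e).1]⟩

theorem IsLcp.remainder_eq {ι : Type*} {ρ ρ' : ι → List A} {m m' : List A}
    (hm : IsLcp (Set.range fun i => m ++ ρ i) m) (hm' : IsLcp (Set.range fun i => m' ++ ρ' i) m')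
    (h : ∀ i j, (ofWord (m ++ ρ i))⁻¹ * ofWord (m ++ ρ j) =
      (ofWord (m' ++ ρ' i))⁻¹ * ofWord (m' ++ ρ' j)) (i : ι) : ρ i = ρ' i :=
  have h1 := hm.remainder_suffix h i
  h1.eq_of_length_le (hm'.remainder_suffix (fun i j => (h i j).symm) i).length_le

end List

/-! ### Separation by a pair of automata -/

namespace FreeGroup

variable {A : Type*}

/-- The delay between the words `s` and `t`, as an element of the free group: what is left of them
after their longest common prefix, the rest of `s` being inverted. -/
def delay (s t : List A) : FreeGroup A := (ofWord s)⁻¹ * ofWord t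

theorem delay_append (p s t : List A) : delay (p ++ s) (p ++ t) = delay s t :=
  ofWord_append_inv_mul p s t

theorem delay_mul_delay (s t u : List A) : delay s t * delay t u = delay s u := by
  simp [delay, mul_assoc]

theorem delay_inv (s t : List A) : (delay s t)⁻¹ = delay t s := by
  simp [delay]

theorem delay_append_append (s t a b : List A) :
    delay (s ++ a) (t ++ b) = (ofWord a)⁻¹ * delay s t * ofWord b := by
  simp [delay, ofWord_append, mul_assoc]

end FreeGroup

open FreeGroup (delay)

variable {A : Type}

/-- The pair of maps `l`, `r` on words (to be thought of as the states reached by a left and a right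
automaton) separates the words well enough to realize `f` by a bimachine: the domain is saturated
on both sides, and the delay between `f (x ++ y)` and `f (x ++ y')`, for right equivalent
`y` and `y'`, depends on `x` through its left class only. -/
structure Separates {α β : Type*} (f : List A →. List A) (l : List A → α) (r : List A → β) :
    Prop where
  dom_left : ∀ {x x' : List A}, l x = l x' → ∀ y, (f (x ++ y)).Dom → (f (x' ++ y)).Dom
  dom_right : ∀ {y y' : List A}, r y = r y' → ∀ x, (f (x ++ y)).Dom → (f (x ++ y')).Dom
  delay_eq : ∀ {x x' y y' s t s' t' : List A}, l x = l x' → r y = r y' →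
    s ∈ f (x ++ y) → t ∈ f (x ++ y') → s' ∈ f (x' ++ y) → t' ∈ f (x' ++ y') →
    delay s t = delay s' t'

theorem Separates.mono {α β α' β' : Type*} {f : List A →. List A} {l : List A → α}
    {r : List A → β} {l' : List A → α'} {r' : List A → β'} (h : Separates f l r)
    (hl : ∀ x x', l' x = l' x' → l x = l x') (hr : ∀ y y', r' y = r' y' → r y = r y') :
    Separates f l' r' :=
  ⟨fun e => h.dom_left (hl _ _ e), fun e => h.dom_right (hr _ _ e),
    fun e e' => h.delay_eq (hl _ _ e) (hr _ _ e')⟩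

namespace Bimachine

variable {L R : Type}

theorem leftEval_eq_foldl (B : Bimachine A L R) (u : List A) :
    B.leftEval u = u.foldl B.lstep B.lstart := rfl

theorem rightEval_eq_foldr (B : Bimachine A L R) (u : List A) :
    B.rightEval u = u.foldr (fun a s => B.rstep s a) B.rstart := by
  rw [← List.foldl_reverse]; rfl

theorem rightEval_cons (B : Bimachine A L R) (a : A) (u : List A) :
    B.rightEval (a :: u) = B.rstep (B.rightEval u) a := by
  simp [rightEval_eq_foldr]

theorem leftEval_append_singleton (B : Bimachine A L R) (u : List A) (a : A) :
    B.leftEval (u ++ [a]) = B.lstep (B.leftEval u) a := by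
  simp [leftEval_eq_foldl]

theorem rfinal_isSome_iff (B : Bimachine A L R) (u : List A) :
    (B.rfinal (B.leftEval u)).isSome ↔ (B.lfinal (B.rightEval u)).isSome :=
  B.same_language u

theorem outWord_append (B : Bimachine A L R) (l : L) (x y : List A) (r : R) :
    B.outWord l (x ++ y) r =
      B.outWord l x (B.right.evalFrom r y.reverse) ++ B.outWord (B.left.evalFrom l x) y r := by
  induction x generalizing l with
  | nil => simp [outWord]
  | cons a x ih =>
    simp only [List.cons_append, outWord, ih, List.reverse_append, DFA.evalFrom_of_append,
      List.append_assoc]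
    rfl

theorem outWord_rstart_append (B : Bimachine A L R) (x y : List A) :
    B.outWord B.lstart (x ++ y) B.rstart =
      B.outWord B.lstart x (B.rightEval y) ++ B.outWord (B.leftEval x) y B.rstart :=
  B.outWord_append _ _ _ _

/-- What `B` outputs on the suffix `y`, when the left automaton starts from `l`. -/
def rest (B : Bimachine A L R) (l : L) (y : List A) : List A :=
  B.outWord l y B.rstart ++ (B.rfinal (B.left.evalFrom l y)).getD []

variable {B : Bimachine A L R} {f : List A →. List A}

theorem RealizesFun.dom_iff_left (h : B.RealizesFun f) (u : List A) :
    (f u).Dom ↔ (B.rfinal (B.leftEval u)).isSome := by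
  rw [Part.dom_iff_mem]
  constructor
  · rintro ⟨w, hw⟩
    obtain ⟨x, y, -, hy, -⟩ := (h u w).2 hw
    simp [hy]
  · intro hs
    obtain ⟨y, hy⟩ := Option.isSome_iff_exists.1 hs
    obtain ⟨x, hx⟩ := Option.isSome_iff_exists.1 ((B.rfinal_isSome_iff u).1 hs)
    exact ⟨_, (h u _).1 ⟨x, y, hx, hy, rfl⟩⟩

theorem RealizesFun.dom_iff_right (h : B.RealizesFun f) (u : List A) :
    (f u).Dom ↔ (B.lfinal (B.rightEval u)).isSome := by
  rw [h.dom_iff_left, rfinal_isSome_iff]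

theorem leftEval_append_congr (B : Bimachine A L R) {x x' : List A}
    (h : B.leftEval x = B.leftEval x') (y : List A) :
    B.leftEval (x ++ y) = B.leftEval (x' ++ y) := by
  simp only [leftEval_eq_foldl, List.foldl_append] at h ⊢
  rw [h]

theorem rightEval_append_congr (B : Bimachine A L R) {y y' : List A}
    (h : B.rightEval y = B.rightEval y') (x : List A) :
    B.rightEval (x ++ y) = B.rightEval (x ++ y') := by
  simp only [rightEval_eq_foldr, List.foldr_append] at h ⊢
  rw [h]

theorem RealizesFun.eq_append_rest (h : B.RealizesFun f) {x y w : List A} (hw : w ∈ f (x ++ y)) :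
    w = (B.lfinal (B.rightEval (x ++ y))).getD [] ++ B.outWord B.lstart x (B.rightEval y) ++
      B.rest (B.leftEval x) y := by
  obtain ⟨a, b, ha, hb, rfl⟩ := (h _ _).2 hw
  have : B.left.evalFrom (B.leftEval x) y = B.leftEval (x ++ y) :=
    (B.left.evalFrom_of_append _ x y).symm
  simp [ha, hb, rest, outWord_rstart_append, this]

theorem RealizesFun.delay_eq_delay_rest (h : B.RealizesFun f) {x y y' s t : List A}
    (e : B.rightEval y = B.rightEval y') (hs : s ∈ f (x ++ y)) (ht : t ∈ f (x ++ y')) :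
    delay s t = delay (B.rest (B.leftEval x) y) (B.rest (B.leftEval x) y') := by
  rw [h.eq_append_rest hs, h.eq_append_rest ht, e, B.rightEval_append_congr e x,
    FreeGroup.delay_append]

/-- For right equivalent `y`, `y'` the outputs of a bimachine on `x ++ y` and `x ++ y'` agree until
`x` has been read, and afterwards they depend on the left state. -/
theorem RealizesFun.separates (h : B.RealizesFun f) : Separates f B.leftEval B.rightEval where
  dom_left e y hd := by
    rw [h.dom_iff_left] at hd ⊢
    rwa [← B.leftEval_append_congr e y]
  dom_right e x hd := by
    rw [h.dom_iff_right] at hd ⊢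
    rwa [← B.rightEval_append_congr e x]
  delay_eq e e' hs ht hs' ht' := by
    rw [h.delay_eq_delay_rest e' hs ht, h.delay_eq_delay_rest e' hs' ht', e]

end Bimachine

/-! ### The bimachine given by two separating automata -/

section Potential

variable {α β : Type*} {f : List A →. List A} {l : List A → α} {r : List A → β}

/-- The possible images of the words that start with `x` and go on with a word of class `q`. -/
def images (f : List A →. List A) (r : List A → β) (x : List A) (q : β) : Set (List A) :=
  {w | ∃ y, r y = q ∧ w ∈ f (x ++ y)}

open Classical in
/-- The longest output that is known for sure after the prefix `x`, when the suffix is known to be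
in the class `q`; the empty word if there is no such image. -/
noncomputable def potential (f : List A →. List A) (r : List A → β) (x : List A) (q : β) :
    List A :=
  if h : (images f r x q).Nonempty then (List.exists_isLcp h).choose else []

theorem potential_isLcp {x y w : List A} (hw : w ∈ f (x ++ y)) :
    List.IsLcp (images f r x (r y)) (potential f r x (r y)) := by
  have h : (images f r x (r y)).Nonempty := ⟨w, y, rfl, hw⟩
  rw [potential, dif_pos h]
  exact (List.exists_isLcp h).choose_spec

theorem potential_prefix {x y w : List A} (hw : w ∈ f (x ++ y)) :
    potential f r x (r y) <+: w :=
  (potential_isLcp hw).1 w ⟨y, rfl, hw⟩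

/-- What remains of an image after the potential depends on the prefix through its left class. -/
theorem Separates.remainder_eq (h : Separates f l r) {x x' y s s' : List A} (e : l x = l x')
    {v v' : List A} (hs : potential f r x (r y) ++ v = s)
    (hs' : potential f r x' (r y) ++ v' = s') (hf : s ∈ f (x ++ y)) (hf' : s' ∈ f (x' ++ y)) :
    v = v' := by
  let ι := {z : List A // r z = r y}
  have hd : ∀ z : ι, (f (x ++ z.1)).Dom := fun z =>
    h.dom_right z.2.symm x (Part.dom_iff_mem.2 ⟨s, hf⟩)
  have hd' : ∀ z : ι, (f (x' ++ z.1)).Dom := fun z => h.dom_left e _ (hd z)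
  have hr : ∀ z : ι, ∃ v, potential f r x (r y) ++ v = (f (x ++ z.1)).get (hd z) := fun z =>
    (potential_isLcp hf).1 _ ⟨z.1, z.2, Part.get_mem _⟩
  have hr' : ∀ z : ι, ∃ v, potential f r x' (r y) ++ v = (f (x' ++ z.1)).get (hd' z) := fun z =>
    (potential_isLcp hf').1 _ ⟨z.1, z.2, Part.get_mem _⟩
  choose ρ hρ using hr
  choose ρ' hρ' using hr'
  have hi : (Set.range fun i => potential f r x (r y) ++ ρ i) = images f r x (r y) := by
    ext w
    simp only [Set.mem_range, hρ, images, Set.mem_ofPred_eq]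
    exact ⟨fun ⟨z, hz⟩ => ⟨z.1, z.2, hz ▸ Part.get_mem _⟩,
      fun ⟨z, hz, hw⟩ => ⟨⟨z, hz⟩, Part.get_eq_of_mem hw _⟩⟩
  have hi' : (Set.range fun i => potential f r x' (r y) ++ ρ' i) = images f r x' (r y) := by
    ext w
    simp only [Set.mem_range, hρ', images, Set.mem_ofPred_eq]
    exact ⟨fun ⟨z, hz⟩ => ⟨z.1, z.2, hz ▸ Part.get_mem _⟩,
      fun ⟨z, hz, hw⟩ => ⟨⟨z, hz⟩, Part.get_eq_of_mem hw _⟩⟩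
  have key := List.IsLcp.remainder_eq (hi ▸ potential_isLcp hf) (hi' ▸ potential_isLcp hf')
    (fun i j => by
      rw [hρ, hρ, hρ', hρ']
      exact h.delay_eq e (i.2.trans j.2.symm) (Part.get_mem _) (Part.get_mem _) (Part.get_mem _)
        (Part.get_mem _)) ⟨y, rfl⟩
  have e1 := hρ ⟨y, rfl⟩
  have e2 := hρ' ⟨y, rfl⟩
  rw [Part.get_eq_of_mem hf, ← hs] at e1
  rw [Part.get_eq_of_mem hf', ← hs'] at e2
  rw [← List.append_cancel_left e1, ← List.append_cancel_left e2, key]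

end Potential

section Construction

variable {L R : Type} {f : List A →. List A} {lstep : L → A → L} {lstart : L}
  {rstep : R → A → R} {rstart : R}

/-- Two automata that separate `f` are the automata of a bimachine that realizes `f`, by outputting
the potential. Moreover an output is nonempty only if it is used. -/
theorem Separates.exists_bimachine
    (h : Separates f (fun x => x.foldl lstep lstart)
      (fun y => y.foldr (fun a s => rstep s a) rstart)) :
    ∃ B : Bimachine A L R, (∀ u, B.leftEval u = u.foldl lstep lstart) ∧
      (∀ u, B.rightEval u = u.foldr (fun a s => rstep s a) rstart) ∧ B.RealizesFun f ∧
      ∀ l a q, B.out l a q ≠ [] →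
        ∃ x y, B.leftEval x = l ∧ B.rightEval y = q ∧ (f (x ++ a :: y)).Dom := by
  classical
  set l : List A → L := fun x => x.foldl lstep lstart with hl
  set r : List A → R := fun y => y.foldr (fun a s => rstep s a) rstart with hr
  have hl1 : ∀ x a, l (x ++ [a]) = lstep (l x) a := fun x a => by simp [hl]
  have hr1 : ∀ a y, r (a :: y) = rstep (r y) a := fun a y => by simp [hr]
  -- the potential grows along the word
  have hmono : ∀ x a y, (f (x ++ a :: y)).Dom →
      potential f r x (r (a :: y)) <+: potential f r (x ++ [a]) (r y) := by
    intro x a y hd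
    have hw : (f (x ++ a :: y)).get hd ∈ f (x ++ a :: y) := Part.get_mem _
    have hw' : (f (x ++ a :: y)).get hd ∈ f ((x ++ [a]) ++ y) := by simpa using hw
    refine (potential_isLcp hw').2 _ ?_
    rintro s ⟨z, hz, hs⟩
    refine (potential_isLcp hw).1 s ⟨a :: z, ?_, by simpa using hs⟩
    rw [hr1, hr1, hz]
  -- the increment of the potential depends on the two states only, as both remainders do
  have hout : ∀ (p : L) (a : A) (q : R), ∃ o : List A,
      (∀ x y, l x = p → r y = q → (f (x ++ a :: y)).Dom →
        potential f r x (r (a :: y)) ++ o = potential f r (x ++ [a]) (r y)) ∧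
      (o ≠ [] → ∃ x y, l x = p ∧ r y = q ∧ (f (x ++ a :: y)).Dom) := by
    intro p a q
    by_cases hex : ∃ x y, l x = p ∧ r y = q ∧ (f (x ++ a :: y)).Dom
    · obtain ⟨x, y, hx, hy, hd⟩ := hex
      obtain ⟨o, ho⟩ := hmono x a y hd
      refine ⟨o, fun x' y' hx' hy' hd' => ?_, fun _ => ⟨x, y, hx, hy, hd⟩⟩
      have hyy : r (a :: y') = r (a :: y) := by rw [hr1, hr1, hy, hy']
      have hd'' : (f (x' ++ a :: y)).Dom := h.dom_right hyy x' hd'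
      obtain ⟨o', ho'⟩ := hmono x' a y hd''
      rw [hyy, hy', ← hy, ← ho']
      congr 1
      have hxx : l x' = l x := hx'.trans hx.symm
      have hxx' : l (x' ++ [a]) = l (x ++ [a]) := by rw [hl1, hl1, hxx]
      have m : (f (x ++ a :: y)).get hd ∈ f (x ++ a :: y) := Part.get_mem _
      have m' : (f (x' ++ a :: y)).get hd'' ∈ f (x' ++ a :: y) := Part.get_mem _
      have n : (f (x ++ a :: y)).get hd ∈ f ((x ++ [a]) ++ y) := by simpa using m
      have n' : (f (x' ++ a :: y)).get hd'' ∈ f ((x' ++ [a]) ++ y) := by simpa using m'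
      obtain ⟨v, hv⟩ := potential_prefix (r := r) n
      obtain ⟨v', hv'⟩ := potential_prefix (r := r) n'
      have e2 := h.remainder_eq hxx'.symm hv hv' n n'
      rw [← ho, List.append_assoc] at hv
      rw [← ho', List.append_assoc] at hv'
      have e1 := h.remainder_eq hxx.symm hv hv' m m'
      rw [e2] at e1
      exact List.append_cancel_right e1
    · exact ⟨[], fun x y hx hy hd => absurd ⟨x, y, hx, hy, hd⟩ hex, fun h => absurd rfl h⟩
  choose out hout1 hout2 using hout
  -- the right final output is the remainder after the last potential
  have hrf : ∀ p : L, ∃ o : Option (List A), ∀ u, l u = p →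
      (∀ w ∈ f u, ∃ v, o = some v ∧ potential f r u (r []) ++ v = w) ∧ (¬ (f u).Dom → o = none) := by
    intro p
    by_cases hex : ∃ u, l u = p ∧ (f u).Dom
    · obtain ⟨u, hu, hd⟩ := hex
      have m : (f u).get hd ∈ f (u ++ []) := by simpa using Part.get_mem _
      obtain ⟨v, hv⟩ := potential_prefix (r := r) m
      refine ⟨some v, fun u' hu' => ⟨fun w hw => ⟨v, rfl, ?_⟩, fun hn => ?_⟩⟩
      · have m' : w ∈ f (u' ++ []) := by simpa using hw
        obtain ⟨v', hv'⟩ := potential_prefix (r := r) m'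
        rw [h.remainder_eq (hu.trans hu'.symm) hv hv' m m', hv']
      · have := h.dom_left (hu.trans hu'.symm) [] (by simpa using hd)
        exact absurd (by simpa using this) hn
    · refine ⟨none, fun u hu => ⟨fun w hw => ?_, fun _ => rfl⟩⟩
      exact absurd ⟨u, hu, Part.dom_iff_mem.2 ⟨w, hw⟩⟩ hex
  choose rf hrf using hrf
  -- the left final output is the first potential
  have hlf : ∀ q : R, ∃ o : Option (List A), ∀ u, r u = q →
      ((f u).Dom → o = some (potential f r [] (r u))) ∧ (¬ (f u).Dom → o = none) := by
    intro q
    by_cases hex : ∃ u, r u = q ∧ (f u).Dom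
    · obtain ⟨u, hu, hd⟩ := hex
      refine ⟨some (potential f r [] q), fun u' hu' => ⟨fun _ => by rw [hu'], fun hn => ?_⟩⟩
      exact absurd (h.dom_right (hu.trans hu'.symm) [] hd) hn
    · exact ⟨none, fun u hu => ⟨fun hd => absurd ⟨u, hu, hd⟩ hex, fun _ => rfl⟩⟩
  choose lf hlf using hlf
  have hrsome : ∀ u, (rf (l u)).isSome ↔ (f u).Dom := by
    intro u
    by_cases hd : (f u).Dom
    · obtain ⟨v, hv, -⟩ := (hrf _ u rfl).1 _ (Part.get_mem hd)
      simp [hv, hd]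
    · simp [(hrf _ u rfl).2 hd, hd]
  have hlsome : ∀ u, (lf (r u)).isSome ↔ (f u).Dom := by
    intro u
    by_cases hd : (f u).Dom
    · simp [(hlf _ u rfl).1 hd, hd]
    · simp [(hlf _ u rfl).2 hd, hd]
  let B : Bimachine A L R :=
    { lstep, lstart, rstep, rstart, out, lfinal := lf, rfinal := rf
      same_language := fun u => by
        rw [List.foldl_reverse]
        exact (hrsome u).trans (hlsome u).symm }
  have hBl : ∀ u, B.leftEval u = l u := fun u => rfl
  have hBr : ∀ u, B.rightEval u = r u := fun u => B.rightEval_eq_foldr u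
  -- the output between two positions is the quotient of the potentials there
  have hword : ∀ v x, (f (x ++ v)).Dom →
      potential f r x (r v) ++ B.outWord (l x) v rstart = potential f r (x ++ v) (r []) := by
    intro v
    induction v with
    | nil => intro x _; simp [Bimachine.outWord]
    | cons a v ih =>
      intro x hd
      have e : B.right.evalFrom rstart v.reverse = r v := hBr v
      have e' : B.lstep (l x) a = l (x ++ [a]) := (hl1 x a).symm
      rw [Bimachine.outWord, e, e', ← List.append_assoc,
        show B.out (l x) a (r v) = out (l x) a (r v) from rfl, hout1 _ a _ x v rfl rfl hd,
        ih _ (by simpa using hd)]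
      simp
  refine ⟨B, hBl, hBr, fun u w => ?_, fun p a q ho => ?_⟩
  swap
  · obtain ⟨x, y, hx, hy, hd⟩ := hout2 p a q ho
    exact ⟨x, y, hx, (hBr y).trans hy, hd⟩
  constructor
  · rintro ⟨a, b, ha, hb, rfl⟩
    rw [hBr] at ha
    rw [hBl] at hb
    have hd : (f u).Dom := (hlsome u).1 (by rw [show lf (r u) = some a from ha]; rfl)
    have hm : (f u).get hd ∈ f u := Part.get_mem _
    obtain ⟨v, hv, hv'⟩ := (hrf _ u rfl).1 _ hm
    have ha' := (hlf _ u rfl).1 hd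
    obtain rfl : a = _ := Option.some.inj (ha.symm.trans ha')
    obtain rfl : b = v := Option.some.inj (hb.symm.trans hv)
    have := hword u [] hd
    rw [List.nil_append] at this
    rw [show B.outWord B.lstart u B.rstart = B.outWord (l []) u rstart from rfl, this, hv']
    exact hm
  · intro hw
    have hd : (f u).Dom := Part.dom_iff_mem.2 ⟨w, hw⟩
    obtain ⟨v, hv, hv'⟩ := (hrf _ u rfl).1 _ hw
    refine ⟨_, v, (by rw [hBr]; exact (hlf _ u rfl).1 hd), (by rw [hBl]; exact hv), ?_⟩
    have := hword u [] hd
    rw [List.nil_append] at this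
    rw [show B.outWord B.lstart u B.rstart = B.outWord (l []) u rstart from rfl, this, hv']

end Construction

/-! ### Runs of transducers -/

namespace Transducer

variable {Q Q₁ Q₂ : Type} {T : Transducer A Q} {T₁ : Transducer A Q₁} {T₂ : Transducer A Q₂}

theorem Run.append {p q s : Q} {u u' v v' : List A} (h : T.Run p u q v) (h' : T.Run q u' s v') :
    T.Run p (u ++ u') s (v ++ v') := by
  induction h with
  | nil => exact h'
  | cons ht _ ih => rw [List.append_assoc]; exact .cons ht (ih h')

theorem Run.exists_of_append {p s : Q} {u u' w : List A} (h : T.Run p (u ++ u') s w) :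
    ∃ q v v', T.Run p u q v ∧ T.Run q u' s v' ∧ w = v ++ v' := by
  induction u generalizing p w with
  | nil => exact ⟨p, [], w, .nil p, h, rfl⟩
  | cons a u ih =>
    rw [List.cons_append] at h
    cases h with
    | @cons _ r _ _ x _ v ht hr =>
      obtain ⟨q, v₁, v₂, h1, h2, rfl⟩ := ih hr
      exact ⟨q, x ++ v₁, v₂, .cons ht h1, h2, (List.append_assoc ..).symm⟩

theorem run_singleton {p q : Q} {a : A} {x : List A} (h : T.trans p a q = some x) :
    T.Run p [a] q x := by
  simpa using Run.cons h (.nil q)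

theorem run_singleton_iff {p q : Q} {a : A} {x : List A} :
    T.Run p [a] q x ↔ T.trans p a q = some x := by
  refine ⟨fun h => ?_, run_singleton⟩
  cases h with
  | cons ht hr => cases hr; simpa using ht

theorem run_nil_iff {p q : Q} {v : List A} : T.Run p [] q v ↔ p = q ∧ v = [] := by
  constructor
  · intro h; cases h; exact ⟨rfl, rfl⟩
  · rintro ⟨rfl, rfl⟩; exact .nil p

theorem Run.flatten_replicate {q : Q} {u v : List A} (h : T.Run q u q v) (k : ℕ) :
    T.Run q (List.replicate k u).flatten q (List.replicate k v).flatten := by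
  induction k with
  | zero => exact .nil q
  | succ k ih => simpa [List.replicate_succ] using h.append ih

theorem mem_evalFrom_singleton {p q : Q} {u : List A} :
    q ∈ T.automaton.evalFrom {p} u ↔ ∃ v, T.Run p u q v := by
  induction u generalizing p with
  | nil => simp [run_nil_iff, eq_comm]
  | cons a u ih =>
    rw [NFA.evalFrom_cons, NFA.stepSet_singleton, NFA.mem_evalFrom_iff_exists]
    constructor
    · rintro ⟨t, ht, hq⟩
      obtain ⟨v, hv⟩ := ih.1 hq
      obtain ⟨x, hx⟩ := Option.isSome_iff_exists.1 ht
      exact ⟨_, .cons hx hv⟩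
    · rintro ⟨v, hv⟩
      cases hv with
      | cons ht hr => exact ⟨_, by simp [automaton, ht], ih.2 ⟨_, hr⟩⟩

/-- There is a run over `u` from an initial state to `q` with output `w`, initial output
included. -/
def Reach (T : Transducer A Q) (u : List A) (q : Q) (w : List A) : Prop :=
  ∃ p x v, T.init p = some x ∧ T.Run p u q v ∧ w = x ++ v

/-- There is a run over `u` from `q` to a final state with output `w`, final output included. -/
def Coreach (T : Transducer A Q) (q : Q) (u w : List A) : Prop :=
  ∃ s v y, T.Run q u s v ∧ T.final s = some y ∧ w = v ++ y

theorem Reach.append {u u' w v : List A} {p q : Q} (h : T.Reach u p w) (h' : T.Run p u' q v) :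
    T.Reach (u ++ u') q (w ++ v) := by
  obtain ⟨i, x, v', hi, hr, rfl⟩ := h
  exact ⟨i, x, _, hi, hr.append h', List.append_assoc ..⟩

theorem Coreach.append {u u' w v : List A} {p q : Q} (h : T.Run p u q v) (h' : T.Coreach q u' w) :
    T.Coreach p (u ++ u') (v ++ w) := by
  obtain ⟨s, v', y, hr, hs, rfl⟩ := h'
  exact ⟨s, _, y, h.append hr, hs, (List.append_assoc ..).symm⟩

theorem Reach.exists_of_append {u u' w : List A} {q : Q} (h : T.Reach (u ++ u') q w) :
    ∃ p w' v, T.Reach u p w' ∧ T.Run p u' q v ∧ w = w' ++ v := by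
  obtain ⟨i, x, v, hi, hr, rfl⟩ := h
  obtain ⟨p, v₁, v₂, h1, h2, rfl⟩ := hr.exists_of_append
  exact ⟨p, _, v₂, ⟨i, x, v₁, hi, h1, rfl⟩, h2, (List.append_assoc ..).symm⟩

theorem Coreach.exists_of_append {u u' w : List A} {p : Q} (h : T.Coreach p (u ++ u') w) :
    ∃ q v w', T.Run p u q v ∧ T.Coreach q u' w' ∧ w = v ++ w' := by
  obtain ⟨s, v, y, hr, hs, rfl⟩ := h
  obtain ⟨q, v₁, v₂, h1, h2, rfl⟩ := hr.exists_of_append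
  exact ⟨q, v₁, _, h1, ⟨s, v₂, y, h2, hs, rfl⟩, List.append_assoc ..⟩

theorem Reach.realizes {x y a b : List A} {q : Q} (h : T.Reach x q a) (h' : T.Coreach q y b) :
    T.Realizes (x ++ y) (a ++ b) := by
  obtain ⟨i, c, v, hi, hr, rfl⟩ := h
  obtain ⟨s, v', d, hr', hs, rfl⟩ := h'
  exact ⟨i, s, c, _, d, hi, hr.append hr', hs, by simp⟩

theorem Realizes.exists_reach {x y w : List A} (h : T.Realizes (x ++ y) w) :
    ∃ q a b, T.Reach x q a ∧ T.Coreach q y b ∧ w = a ++ b := by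
  obtain ⟨i, s, c, v, d, hi, hr, hs, rfl⟩ := h
  obtain ⟨q, v₁, v₂, h1, h2, rfl⟩ := hr.exists_of_append
  exact ⟨q, c ++ v₁, v₂ ++ d, ⟨i, c, v₁, hi, h1, rfl⟩, ⟨s, v₂, d, h2, hs, rfl⟩, by simp⟩

/-! ### Loops in pairs of runs -/

/-- The states visited by two runs over the same word either are distinct as pairs, or the two runs
have a common loop. -/
theorem Run.exists_visited {p p' : Q₁} {q q' : Q₂} {x a b : List A} (h₁ : T₁.Run p x p' a)
    (h₂ : T₂.Run q x q' b) :
    ∃ vs : List (Q₁ × Q₂), vs.length = x.length ∧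
      (∀ v ∈ vs, ∃ y z a₁ a₂ b₁ b₂, x = y ++ z ∧ a = a₁ ++ a₂ ∧ b = b₁ ++ b₂ ∧
        T₁.Run p y v.1 a₁ ∧ T₁.Run v.1 z p' a₂ ∧ T₂.Run q y v.2 b₁ ∧ T₂.Run v.2 z q' b₂) ∧
      (vs.Nodup ∨ ∃ s t x₁ x₂ x₃ a₁ a₂ a₃ b₁ b₂ b₃, x₂ ≠ [] ∧ x = x₁ ++ (x₂ ++ x₃) ∧
        a = a₁ ++ (a₂ ++ a₃) ∧ b = b₁ ++ (b₂ ++ b₃) ∧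
        T₁.Run p x₁ s a₁ ∧ T₁.Run s x₂ s a₂ ∧ T₁.Run s x₃ p' a₃ ∧
        T₂.Run q x₁ t b₁ ∧ T₂.Run t x₂ t b₂ ∧ T₂.Run t x₃ q' b₃) := by
  induction h₁ generalizing q b with
  | nil p =>
    obtain ⟨rfl, rfl⟩ := run_nil_iff.1 h₂
    exact ⟨[], rfl, by simp, Or.inl List.nodup_nil⟩
  | @cons p r p' c o x a ht hr ih =>
    cases h₂ with
    | @cons _ r' _ _ o' _ b ht' hr' =>
      obtain ⟨vs, hlen, hvs, hor⟩ := ih hr'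
      refine ⟨(p, q) :: vs, by simp [hlen], ?_, ?_⟩
      · intro v hv
        rcases List.mem_cons.1 hv with rfl | hv
        · exact ⟨[], _, [], _, [], _, rfl, rfl, rfl, .nil _, .cons ht hr, .nil _, .cons ht' hr'⟩
        · obtain ⟨y, z, a₁, a₂, b₁, b₂, rfl, rfl, rfl, h1, h2, h3, h4⟩ := hvs v hv
          exact ⟨c :: y, z, o ++ a₁, a₂, o' ++ b₁, b₂, rfl, by simp, by simp, .cons ht h1, h2,
            .cons ht' h3, h4⟩
      · by_cases hmem : (p, q) ∈ vs
        · obtain ⟨y, z, a₁, a₂, b₁, b₂, rfl, rfl, rfl, h1, h2, h3, h4⟩ := hvs _ hmem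
          exact Or.inr ⟨p, q, [], c :: y, z, [], o ++ a₁, a₂, [], o' ++ b₁, b₂, by simp, rfl,
            by simp, by simp, .nil _, .cons ht h1, h2, .nil _, .cons ht' h3, h4⟩
        · rcases hor with hnd | ⟨s, t, x₁, x₂, x₃, a₁, a₂, a₃, b₁, b₂, b₃, hne, rfl, rfl, rfl,
            h1, h2, h3, h4, h5, h6⟩
          · exact Or.inl (List.nodup_cons.2 ⟨hmem, hnd⟩)
          · exact Or.inr ⟨s, t, c :: x₁, x₂, x₃, o ++ a₁, a₂, a₃, o' ++ b₁, b₂, b₃, hne, rfl,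
              by simp, by simp, .cons ht h1, h2, h3, .cons ht' h4, h5, h6⟩

theorem Run.exists_loop [Finite Q₁] [Finite Q₂] {p p' : Q₁} {q q' : Q₂} {x a b : List A}
    (h₁ : T₁.Run p x p' a) (h₂ : T₂.Run q x q' b) (hx : Nat.card Q₁ * Nat.card Q₂ < x.length) :
    ∃ s t x₁ x₂ x₃ a₁ a₂ a₃ b₁ b₂ b₃, x₂ ≠ [] ∧ x = x₁ ++ (x₂ ++ x₃) ∧
      a = a₁ ++ (a₂ ++ a₃) ∧ b = b₁ ++ (b₂ ++ b₃) ∧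
      T₁.Run p x₁ s a₁ ∧ T₁.Run s x₂ s a₂ ∧ T₁.Run s x₃ p' a₃ ∧
      T₂.Run q x₁ t b₁ ∧ T₂.Run t x₂ t b₂ ∧ T₂.Run t x₃ q' b₃ := by
  obtain ⟨vs, hlen, -, hnd | h⟩ := h₁.exists_visited h₂
  · have := Fintype.ofFinite Q₁
    have := Fintype.ofFinite Q₂
    have := hnd.length_le_card
    rw [Fintype.card_prod, ← Nat.card_eq_fintype_card, ← Nat.card_eq_fintype_card] at this
    omega
  · exact h

/-- Two runs over the same word can be replaced by runs over the same short word. -/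
theorem Run.exists_short [Finite Q₁] [Finite Q₂] {p p' : Q₁} {q q' : Q₂} {x a b : List A}
    (h₁ : T₁.Run p x p' a) (h₂ : T₂.Run q x q' b) :
    ∃ x' a' b', x'.length ≤ Nat.card Q₁ * Nat.card Q₂ ∧ T₁.Run p x' p' a' ∧
      T₂.Run q x' q' b' := by
  induction hn : x.length using Nat.strong_induction_on generalizing x a b with
  | _ n ih =>
    by_cases hx : Nat.card Q₁ * Nat.card Q₂ < x.length
    · obtain ⟨s, t, x₁, x₂, x₃, a₁, a₂, a₃, b₁, b₂, b₃, hne, rfl, rfl, rfl, h1, -, h3, h4, -, h6⟩ :=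
        h₁.exists_loop h₂ hx
      refine ih _ ?_ (h1.append h3) (h4.append h6) rfl
      have := List.length_pos_of_ne_nil hne
      simp at hn ⊢; omega
    · exact ⟨x, a, b, not_lt.1 hx, h₁, h₂⟩

theorem Reach.exists_short [Finite Q₁] [Finite Q₂] {p : Q₁} {q : Q₂} {x a b : List A}
    (h₁ : T₁.Reach x p a) (h₂ : T₂.Reach x q b) :
    ∃ x' a' b', x'.length ≤ Nat.card Q₁ * Nat.card Q₂ ∧ T₁.Reach x' p a' ∧
      T₂.Reach x' q b' := by
  obtain ⟨i, c, v, hi, hr, rfl⟩ := h₁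
  obtain ⟨j, d, w, hj, hr', rfl⟩ := h₂
  obtain ⟨x', a', b', hx, h1, h2⟩ := hr.exists_short hr'
  exact ⟨x', _, _, hx, ⟨i, c, a', hi, h1, rfl⟩, ⟨j, d, b', hj, h2, rfl⟩⟩

theorem Coreach.exists_short [Finite Q₁] [Finite Q₂] {p : Q₁} {q : Q₂} {x a b : List A}
    (h₁ : T₁.Coreach p x a) (h₂ : T₂.Coreach q x b) :
    ∃ x' a' b', x'.length ≤ Nat.card Q₁ * Nat.card Q₂ ∧ T₁.Coreach p x' a' ∧
      T₂.Coreach q x' b' := by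
  obtain ⟨i, v, c, hr, hi, rfl⟩ := h₁
  obtain ⟨j, w, d, hr', hj, rfl⟩ := h₂
  obtain ⟨x', a', b', hx, h1, h2⟩ := hr.exists_short hr'
  exact ⟨x', _, _, hx, ⟨i, a', c, h1, hi, rfl⟩, ⟨j, b', d, h2, hj, rfl⟩⟩

/-! ### Comparing two transducers on short words -/

open FreeGroup in
/-- Two transducers that never have different outputs on a short word never do: the delay of two
runs that reach a given pair of states is determined by any common way of completing the runs, and
is therefore the delay of two short runs. -/
theorem realizes_eq_of_short [Finite Q₁] [Finite Q₂]
    (h : ∀ u, u.length ≤ 2 * (Nat.card Q₁ * Nat.card Q₂) + 1 → ∀ w w', T₁.Realizes u w →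
      T₂.Realizes u w' → w = w') {u w w' : List A} (hw : T₁.Realizes u w)
    (hw' : T₂.Realizes u w') : w = w' := by
  have key : ∀ (u : List A) (p : Q₁) (q : Q₂) (y a b c d : List A),
      y.length ≤ Nat.card Q₁ * Nat.card Q₂ → T₁.Reach u p a → T₂.Reach u q b →
      T₁.Coreach p y c → T₂.Coreach q y d → a ++ c = b ++ d := by
    intro u
    induction u using List.reverseRecOn with
    | nil =>
      intro p q y a b c d hy ha hb hc hd
      exact h ([] ++ y) (by simp; omega) _ _ (ha.realizes hc) (hb.realizes hd)
    | append_singleton u σ ih =>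
      intro p q y a b c d hy ha hb hc hd
      obtain ⟨p₀, a₀, s, ha₀, hs, rfl⟩ := ha.exists_of_append
      obtain ⟨q₀, b₀, t, hb₀, ht, rfl⟩ := hb.exists_of_append
      -- replace `u` by a short `v`, and the rest by a short `z`; the delay of `a₀`, `b₀` is that of
      -- `a₁`, `b₁`, because both are determined by `c₀`, `d₀`
      have hc' := Coreach.append hs hc
      have hd' := Coreach.append ht hd
      obtain ⟨z, c₀, d₀, hz, hc₀, hd₀⟩ := hc'.exists_short hd'
      obtain ⟨v, a₁, b₁, hv, ha₁, hb₁⟩ := ha₀.exists_short hb₀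
      have e₁ := congrArg ofWord (ih p₀ q₀ z a₀ b₀ c₀ d₀ hz ha₀ hb₀ hc₀ hd₀)
      have e₂ := congrArg ofWord
        (h (v ++ z) (by simp; omega) _ _ (ha₁.realizes hc₀) (hb₁.realizes hd₀))
      have e₃ := congrArg ofWord
        (h (v ++ ([σ] ++ y)) (by simp; omega) _ _ (ha₁.realizes hc') (hb₁.realizes hd'))
      apply ofWord_injective
      simp only [ofWord_append] at e₁ e₂ e₃ ⊢
      have e₄ : (ofWord b₀)⁻¹ * ofWord a₀ = (ofWord b₁)⁻¹ * ofWord a₁ := by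
        rw [← eq_mul_inv_iff_mul_eq] at e₁ e₂
        rw [e₁, e₂]; group
      rw [mul_assoc, mul_assoc, ← inv_mul_eq_iff_eq_mul, ← mul_assoc, e₄, mul_assoc, e₃]
      group
  have hu : u = u ++ [] := (List.append_nil u).symm
  rw [hu] at hw hw'
  obtain ⟨p, a, c, ha, hc, rfl⟩ := hw.exists_reach
  obtain ⟨q, b, d, hb, hd, rfl⟩ := hw'.exists_reach
  exact key u p q [] a b c d (Nat.zero_le _) ha hb hc hd

theorem isFunctional_iff_of_short [Finite Q] :
    T.IsFunctional ↔ ∀ u, u.length ≤ 2 * (Nat.card Q * Nat.card Q) + 1 → ∀ w w',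
      T.Realizes u w → T.Realizes u w' → w = w' := by
  constructor
  · rintro ⟨f, hf⟩ u - w w' hw hw'
    exact Part.mem_unique ((hf u w).1 hw) ((hf u w').1 hw')
  · intro h
    classical
    refine ⟨fun u => ⟨∃ w, T.Realizes u w, fun h => h.choose⟩, fun u w => ?_⟩
    constructor
    · intro hw
      exact ⟨⟨w, hw⟩, realizes_eq_of_short h (Exists.choose_spec (⟨w, hw⟩ : ∃ w, _)) hw⟩
    · rintro ⟨hd, rfl⟩
      exact hd.choose_spec

end Transducer

/-! ### Loops and delays -/

/-- If roots are unique in the group, then the sequence `(u ^ k)⁻¹ * g * v ^ k` is constant once it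
takes finitely many values: a repetition says that a power of `u` is conjugate by `g` to the same
power of `v`. -/
theorem inv_mul_mul_eq_of_finite_range_pow {G : Type*} [Group G] [IsMulTorsionFree G] {u v g : G}
    (h : (Set.range fun k : ℕ => (u ^ k)⁻¹ * g * v ^ k).Finite) : u⁻¹ * g * v = g := by
  have hni : ¬ Function.Injective fun k : ℕ => (u ^ k)⁻¹ * g * v ^ k := fun hi =>
    Set.infinite_range_of_injective hi h
  obtain ⟨i, j, hij, hne⟩ : ∃ i j, (u ^ i)⁻¹ * g * v ^ i = (u ^ j)⁻¹ * g * v ^ j ∧ i ≠ j := by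
    simpa [Function.Injective] using hni
  wlog hlt : i < j generalizing i j
  · exact this j i hij.symm hne.symm (by omega)
  obtain ⟨m, rfl⟩ := Nat.exists_eq_add_of_lt hlt
  have e : (g * v * g⁻¹) ^ (m + 1) = u ^ (m + 1) := by
    rw [conj_pow]
    rw [add_assoc, add_comm i, pow_add u, pow_add v] at hij
    have e' : g = (u ^ (m + 1))⁻¹ * g * v ^ (m + 1) := by
      have := congrArg (fun x => u ^ i * x * (v ^ i)⁻¹) hij
      simpa [mul_assoc] using this
    rw [mul_assoc, eq_inv_mul_iff_mul_eq] at e'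
    rw [mul_inv_eq_iff_eq_mul, e']
  have := pow_left_injective (Nat.succ_ne_zero m) e
  rw [← this]; group

namespace Transducer

variable {Q : Type} {T : Transducer A Q} {f : List A →. List A}

theorem _root_.FreeGroup.ofWord_flatten_replicate (w : List A) (k : ℕ) :
    ofWord (List.replicate k w).flatten = ofWord w ^ k := by
  induction k with
  | zero => rfl
  | succ k ih => rw [List.replicate_succ, List.flatten_cons, FreeGroup.ofWord_append, ih, pow_succ']

/-- The delays between the images of the words that end with `y`, resp. `y'`. -/
def suffixDelays (f : List A →. List A) (y y' : List A) : Set (FreeGroup A) :=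
  {g | ∃ z s t, s ∈ f (z ++ y) ∧ t ∈ f (z ++ y') ∧ g = delay s t}

/-- If there are finitely many delays between the images of `z ++ y` and `z ++ y'`, then a loop in
two runs that lead to states accepting `y` and `y'` preserves the delay: otherwise pumping the loop
gives infinitely many delays, as a free group has unique roots. -/
theorem delay_eq_of_loop (hT : T.RealizesFun f) {y y' : List A}
    (hfin : (suffixDelays f y y').Finite) {p q s t : Q} {x₁ x₂ x₃ a₁ a₂ a₃ b₁ b₂ b₃ c d : List A}
    (h1 : T.Reach x₁ s a₁) (h2 : T.Run s x₂ s a₂) (h3 : T.Run s x₃ p a₃)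
    (h4 : T.Reach x₁ t b₁) (h5 : T.Run t x₂ t b₂) (h6 : T.Run t x₃ q b₃)
    (hc : T.Coreach p y c) (hd : T.Coreach q y' d) :
    delay (a₁ ++ (a₂ ++ a₃)) (b₁ ++ (b₂ ++ b₃)) = delay (a₁ ++ a₃) (b₁ ++ b₃) := by
  have key : (ofWord a₂)⁻¹ * delay a₁ b₁ * ofWord b₂ = delay a₁ b₁ := by
    apply inv_mul_mul_eq_of_finite_range_pow
    refine (hfin.image fun g => ofWord (a₃ ++ c) * g * (ofWord (b₃ ++ d))⁻¹).subset ?_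
    rintro _ ⟨k, rfl⟩
    refine ⟨_, ⟨x₁ ++ (List.replicate k x₂).flatten ++ x₃, _, _,
      (hT _ _).1 (((h1.append (h2.flatten_replicate k)).append h3).realizes hc),
      (hT _ _).1 (((h4.append (h5.flatten_replicate k)).append h6).realizes hd), rfl⟩, ?_⟩
    simp [delay, FreeGroup.ofWord_append, FreeGroup.ofWord_flatten_replicate, mul_assoc]
  rw [← List.append_assoc, ← List.append_assoc, FreeGroup.delay_append_append,
    FreeGroup.delay_append_append, FreeGroup.delay_append_append, key]

/-- Every delay of two runs that matters is that of two short runs, as loops can be cut out. -/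
theorem Reach.exists_short_delay_eq [Finite Q] (hT : T.RealizesFun f) {y y' : List A}
    (hfin : (suffixDelays f y y').Finite) {p q : Q} {x a b c d : List A}
    (ha : T.Reach x p a) (hb : T.Reach x q b) (hc : T.Coreach p y c) (hd : T.Coreach q y' d) :
    ∃ x' a' b', x'.length ≤ Nat.card Q * Nat.card Q ∧ T.Reach x' p a' ∧ T.Reach x' q b' ∧
      delay a b = delay a' b' := by
  induction hn : x.length using Nat.strong_induction_on generalizing x a b with
  | _ n ih =>
    by_cases hx : Nat.card Q * Nat.card Q < x.length
    · obtain ⟨i, e, v, hi, hr, rfl⟩ := ha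
      obtain ⟨j, e', v', hj, hr', rfl⟩ := hb
      obtain ⟨s, t, x₁, x₂, x₃, a₁, a₂, a₃, b₁, b₂, b₃, hne, rfl, rfl, rfl, h1, h2, h3, h4, h5, h6⟩ :=
        hr.exists_loop hr' hx
      have hs : T.Reach x₁ s (e ++ a₁) := ⟨i, e, a₁, hi, h1, rfl⟩
      have ht : T.Reach x₁ t (e' ++ b₁) := ⟨j, e', b₁, hj, h4, rfl⟩
      obtain ⟨x', a', b', hx', ha', hb', he⟩ := ih (x₁ ++ x₃).length (by
        have := List.length_pos_of_ne_nil hne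
        simp at hn ⊢; omega) (hs.append h3) (ht.append h6) rfl
      refine ⟨x', a', b', hx', ha', hb', ?_⟩
      rw [← he, ← List.append_assoc e, ← List.append_assoc e']
      exact delay_eq_of_loop hT hfin hs h2 h3 ht h5 h6 hc hd
    · exact ⟨x, a, b, not_lt.1 hx, ha, hb, rfl⟩

end Transducer

/-! ### Coarsest automata that separate together with a given one -/

section Rel

variable {α β : Type*} {f : List A →. List A} {l : List A → α} {r : List A → β}

/-- The coarsest equivalence of prefixes that separates `f` together with `r`. -/
def LeftRel (f : List A →. List A) (r : List A → β) (x x' : List A) : Prop :=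
  (∀ y, (f (x ++ y)).Dom ↔ (f (x' ++ y)).Dom) ∧
  ∀ y y' s t s' t', r y = r y' → s ∈ f (x ++ y) → t ∈ f (x ++ y') → s' ∈ f (x' ++ y) →
    t' ∈ f (x' ++ y') → delay s t = delay s' t'

/-- The coarsest equivalence of suffixes that separates `f` together with `l`. -/
def RightRel (f : List A →. List A) (l : List A → α) (y y' : List A) : Prop :=
  (∀ x, (f (x ++ y)).Dom ↔ (f (x ++ y')).Dom) ∧
  ∀ x x' s t s' t', l x = l x' → s ∈ f (x ++ y) → t ∈ f (x ++ y') → s' ∈ f (x' ++ y) →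
    t' ∈ f (x' ++ y') → delay s t = delay s' t'

theorem Separates.leftRel (h : Separates f l r) {x x' : List A} (e : l x = l x') :
    LeftRel f r x x' :=
  ⟨fun y => ⟨h.dom_left e y, h.dom_left e.symm y⟩, fun _ _ _ _ _ _ => h.delay_eq e⟩

theorem Separates.rightRel (h : Separates f l r) {y y' : List A} (e : r y = r y') :
    RightRel f l y y' :=
  ⟨fun x => ⟨h.dom_right e x, h.dom_right e.symm x⟩, fun _ _ _ _ _ _ e' => h.delay_eq e' e⟩

/-- `LeftRel` as a setoid. -/
def leftSetoid (f : List A →. List A) (r : List A → β) : Setoid (List A) where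
  r := LeftRel f r
  iseqv :=
    { refl := fun x => ⟨fun _ => Iff.rfl, fun _ _ _ _ _ _ _ hs ht hs' ht' => by
        rw [Part.mem_unique hs hs', Part.mem_unique ht ht']⟩
      symm := fun h => ⟨fun y => (h.1 y).symm, fun y y' s t s' t' e hs ht hs' ht' =>
        (h.2 y y' s' t' s t e hs' ht' hs ht).symm⟩
      trans := fun h h' => ⟨fun y => (h.1 y).trans (h'.1 y), fun y y' s t s' t' e hs ht hs' ht' => by
        have hd := (h.1 y).1 (Part.dom_iff_mem.2 ⟨s, hs⟩)
        have hd' := (h.1 y').1 (Part.dom_iff_mem.2 ⟨t, ht⟩)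
        exact (h.2 y y' _ _ _ _ e hs ht (Part.get_mem hd) (Part.get_mem hd')).trans
          (h'.2 y y' _ _ _ _ e (Part.get_mem hd) (Part.get_mem hd') hs' ht')⟩ }

/-- `RightRel` as a setoid. -/
def rightSetoid (f : List A →. List A) (l : List A → α) : Setoid (List A) where
  r := RightRel f l
  iseqv :=
    { refl := fun y => ⟨fun _ => Iff.rfl, fun _ _ _ _ _ _ _ hs ht hs' ht' => by
        rw [Part.mem_unique hs ht, Part.mem_unique hs' ht']; simp [delay]⟩
      symm := fun h => ⟨fun x => (h.1 x).symm, fun x x' s t s' t' e hs ht hs' ht' => by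
        rw [← inv_inj, FreeGroup.delay_inv, FreeGroup.delay_inv]
        exact h.2 x x' t s t' s' e ht hs ht' hs'⟩
      trans := fun h h' => ⟨fun x => (h.1 x).trans (h'.1 x), fun x x' s t s' t' e hs ht hs' ht' => by
        have hd := (h.1 x).1 (Part.dom_iff_mem.2 ⟨s, hs⟩)
        have hd' := (h.1 x').1 (Part.dom_iff_mem.2 ⟨s', hs'⟩)
        rw [← FreeGroup.delay_mul_delay s ((f _).get hd) t,
          ← FreeGroup.delay_mul_delay s' ((f _).get hd') t',
          h.2 x x' _ _ _ _ e hs (Part.get_mem hd) hs' (Part.get_mem hd'),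
          h'.2 x x' _ _ _ _ e (Part.get_mem hd) ht (Part.get_mem hd') ht']⟩ }

theorem LeftRel.append {x x' : List A} (lr : LeftRel f r x x') (hr : ∀ a y y', r y = r y' →
    r (a :: y) = r (a :: y')) (a : A) : LeftRel f r (x ++ [a]) (x' ++ [a]) :=
  ⟨fun y => by simpa using lr.1 (a :: y), fun y y' s t s' t' e hs ht hs' ht' =>
    lr.2 (a :: y) (a :: y') s t s' t' (hr a _ _ e) (by simpa using hs) (by simpa using ht)
      (by simpa using hs') (by simpa using ht')⟩

theorem RightRel.cons {y y' : List A} (rr : RightRel f l y y') (hl : ∀ a x x', l x = l x' →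
    l (x ++ [a]) = l (x' ++ [a])) (a : A) : RightRel f l (a :: y) (a :: y') :=
  ⟨fun x => by simpa using rr.1 (x ++ [a]), fun x x' s t s' t' e hs ht hs' ht' =>
    rr.2 (x ++ [a]) (x' ++ [a]) s t s' t' (hl a _ _ e) (by simpa using hs) (by simpa using ht)
      (by simpa using hs') (by simpa using ht')⟩

end Rel

theorem Setoid.finite_quotient_of_ker_le {X Y : Type} [Finite Y] (s : Setoid X) (g : X → Y)
    (h : ∀ x x', g x = g x' → s x x') : Finite (Quotient s) := by
  have : Finite (Quotient (Setoid.ker g)) :=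
    Finite.of_injective _ (Setoid.kerLift_injective g)
  exact Finite.of_surjective (Quotient.map' (s₁ := Setoid.ker g) (s₂ := s) id fun x x' e => h x x' e)
    (fun q => by
      induction q using Quotient.inductionOn with
      | _ x => exact ⟨Quotient.mk'' x, rfl⟩)

namespace Bimachine

variable {L R : Type} [Finite L] [Finite R] {B : Bimachine A L R} {f : List A →. List A}

/-- The left automaton of a minimal bimachine is the coarsest that goes with the right one. -/
theorem IsMinimalFor.leftEval_eq (h : B.IsMinimalFor f) {x x' : List A}
    (e : LeftRel f B.rightEval x x') : B.leftEval x = B.leftEval x' := by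
  have hsep := h.1.separates
  let s := leftSetoid f B.rightEval
  have hle : ∀ x x', B.leftEval x = B.leftEval x' → s x x' := fun x x' e => hsep.leftRel e
  have := Setoid.finite_quotient_of_ker_le s B.leftEval hle
  let step : Quotient s → A → Quotient s := fun q a => Quotient.map (· ++ [a])
    (fun x x' e => LeftRel.append e
      (fun a y y' e => by rw [rightEval_cons, rightEval_cons, e]) a) q
  have hfold : ∀ u : List A, u.foldl step (Quotient.mk s []) = Quotient.mk s u := by
    intro u
    induction u using List.reverseRecOn with
    | nil => rfl
    | append_singleton u a ih => rw [List.foldl_append, ih]; rfl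
  have hsep' : Separates f (fun u => u.foldl step (Quotient.mk s []))
      (fun u => u.foldr (fun a s => B.rstep s a) B.rstart) := by
    simp only [hfold, ← rightEval_eq_foldr]
    exact ⟨fun e y => ((Quotient.exact e).1 y).1, hsep.dom_right,
      fun e e' => (Quotient.exact e).2 _ _ _ _ _ _ e'⟩
  obtain ⟨B', hl, hr, hB', -⟩ := hsep'.exists_bimachine
  have hfin : B.Finer B' := by
    refine ⟨fun u v e => ?_, fun u v e => ?_⟩
    · rw [hl, hl, hfold, hfold]; exact Quotient.sound (hle _ _ e)
    · rw [hr, hr, ← rightEval_eq_foldr, ← rightEval_eq_foldr, e]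
  refine (h.2 _ _ B' hB' hfin).1 _ _ ?_
  rw [hl, hl, hfold, hfold]
  exact Quotient.sound e

/-- The right automaton of a minimal bimachine is the coarsest that goes with the left one. -/
theorem IsMinimalFor.rightEval_eq (h : B.IsMinimalFor f) {y y' : List A}
    (e : RightRel f B.leftEval y y') : B.rightEval y = B.rightEval y' := by
  have hsep := h.1.separates
  let s := rightSetoid f B.leftEval
  have hle : ∀ x x', B.rightEval x = B.rightEval x' → s x x' := fun x x' e => hsep.rightRel e
  have := Setoid.finite_quotient_of_ker_le s B.rightEval hle
  let step : Quotient s → A → Quotient s := fun q a => Quotient.map (a :: ·)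
    (fun x x' e => RightRel.cons e
      (fun a y y' e => by rw [leftEval_append_singleton, leftEval_append_singleton, e]) a) q
  have hfold : ∀ u : List A, u.foldr (fun a s => step s a) (Quotient.mk s []) = Quotient.mk s u := by
    intro u
    induction u with
    | nil => rfl
    | cons a u ih => rw [List.foldr_cons, ih]; rfl
  have hsep' : Separates f (fun u => u.foldl B.lstep B.lstart)
      (fun u => u.foldr (fun a s => step s a) (Quotient.mk s [])) := by
    simp only [hfold, ← leftEval_eq_foldl]
    exact ⟨hsep.dom_left, fun e x => ((Quotient.exact e).1 x).1,
      fun e e' => (Quotient.exact e').2 _ _ _ _ _ _ e⟩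
  obtain ⟨B', hl, hr, hB', -⟩ := hsep'.exists_bimachine
  have hfin : B.Finer B' := by
    refine ⟨fun u v e => ?_, fun u v e => ?_⟩
    · rw [hl, hl, ← leftEval_eq_foldl, ← leftEval_eq_foldl, e]
    · rw [hr, hr, hfold, hfold]; exact Quotient.sound (hle _ _ e)
  refine (h.2 _ _ B' hB' hfin).2 _ _ ?_
  rw [hr, hr, hfold, hfold]
  exact Quotient.sound e

end Bimachine

/-! ### Mirror images -/

/-- The transduction `f`, read and written from right to left. -/
def mirrorFun (f : List A →. List A) : List A →. List A :=
  fun u => (f u.reverse).map List.reverse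

theorem mem_mirrorFun {f : List A →. List A} {u w : List A} :
    w ∈ mirrorFun f u ↔ w.reverse ∈ f u.reverse := by
  simp only [mirrorFun, Part.mem_map_iff]
  constructor
  · rintro ⟨v, hv, rfl⟩; simpa using hv
  · intro h; exact ⟨_, h, List.reverse_reverse w⟩

theorem mirrorFun_dom {f : List A →. List A} {u : List A} :
    (mirrorFun f u).Dom ↔ (f u.reverse).Dom := Iff.rfl

/-- Mirroring does not preserve delays, but it preserves the relation between four words on which the
symmetry of `Separates` rests. -/
theorem FreeGroup.delay_reverse_eq {s s' t t' : List A} (h : delay s s' = delay t t') :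
    delay s.reverse t.reverse = delay s'.reverse t'.reverse := by
  -- mirroring extends to an antiautomorphism of the free group
  let θ : FreeGroup A →* (FreeGroup A)ᵐᵒᵖ := FreeGroup.lift fun a => MulOpposite.op (.of a)
  have hθ : ∀ w : List A, θ (ofWord w) = MulOpposite.op (ofWord w.reverse) := by
    intro w
    induction w with
    | nil => rfl
    | cons a w ih =>
      rw [← List.singleton_append, FreeGroup.ofWord_append, _root_.map_mul, ih,
        List.reverse_append, FreeGroup.ofWord_append, MulOpposite.op_mul]
      congr 1
  have e := congrArg (fun g => (θ g).unop) h
  simp only [FreeGroup.delay, _root_.map_mul, _root_.map_inv, hθ, MulOpposite.unop_mul,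
    MulOpposite.unop_inv, MulOpposite.unop_op] at e ⊢
  have e' := eq_mul_of_mul_inv_eq e
  rw [e']; group

theorem Separates.mirror {α β : Type*} {f : List A →. List A} {l : List A → α} {r : List A → β}
    (h : Separates f l r) :
    Separates (mirrorFun f) (fun u => r u.reverse) (fun u => l u.reverse) where
  dom_left e y := by
    simp only [mirrorFun_dom, List.reverse_append]
    exact h.dom_right e _
  dom_right e x := by
    simp only [mirrorFun_dom, List.reverse_append]
    exact h.dom_left e _
  delay_eq {x x' y y' s t s' t'} e e' hs ht hs' ht' := by
    simp only [mem_mirrorFun, List.reverse_append] at hs ht hs' ht'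
    simpa using FreeGroup.delay_reverse_eq (h.delay_eq e' e hs hs' ht ht')

theorem LeftRel.rightRel_of_mirror {α : Type*} {f : List A →. List A} {l : List A → α}
    {y y' : List A} (h : LeftRel (mirrorFun f) (fun u => l u.reverse) y.reverse y'.reverse) :
    RightRel f l y y' := by
  refine ⟨fun x => by simpa [mirrorFun_dom] using h.1 x.reverse,
    fun x x' s t s' t' e hs ht hs' ht' => ?_⟩
  have := h.2 x.reverse x'.reverse s.reverse s'.reverse t.reverse t'.reverse (by simpa using e)
    (by simpa [mem_mirrorFun] using hs) (by simpa [mem_mirrorFun] using hs')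
    (by simpa [mem_mirrorFun] using ht) (by simpa [mem_mirrorFun] using ht')
  simpa using FreeGroup.delay_reverse_eq this

namespace Transducer

variable {Q : Type} {T : Transducer A Q} {f : List A →. List A}

/-- The transducer that reads and writes from right to left. -/
def mirror (T : Transducer A Q) : Transducer A Q where
  trans p a q := (T.trans q a p).map List.reverse
  init q := (T.final q).map List.reverse
  final q := (T.init q).map List.reverse

theorem mirror_mirror (T : Transducer A Q) : T.mirror.mirror = T := by
  simp [mirror]

theorem Run.mirror {p q : Q} {u v : List A} (h : T.Run p u q v) :
    T.mirror.Run q u.reverse p v.reverse := by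
  induction h with
  | nil q => exact .nil q
  | cons ht _ ih =>
    rw [List.reverse_cons, List.reverse_append]
    exact ih.append (run_singleton (by simp [Transducer.mirror, ht]))

theorem Realizes.mirror {u w : List A} (h : T.Realizes u w) :
    T.mirror.Realizes u.reverse w.reverse := by
  obtain ⟨p, q, x, v, y, hp, hr, hq, rfl⟩ := h
  exact ⟨q, p, y.reverse, v.reverse, x.reverse, by simp [Transducer.mirror, hq], hr.mirror,
    by simp [Transducer.mirror, hp], by simp⟩

theorem RealizesFun.mirror (h : T.RealizesFun f) : T.mirror.RealizesFun (mirrorFun f) := by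
  intro u w
  rw [mem_mirrorFun, ← h]
  refine ⟨fun hr => ?_, fun hr => by simpa using hr.mirror⟩
  simpa [mirror_mirror] using hr.mirror

/-! ### Few classes of prefixes -/

/-- All words that occur in the transducer have length at most `M`. -/
structure OutputsLE (T : Transducer A Q) (M : ℕ) : Prop where
  trans : ∀ p a q x, T.trans p a q = some x → x.length ≤ M
  init : ∀ q x, T.init q = some x → x.length ≤ M
  final : ∀ q x, T.final q = some x → x.length ≤ M

variable {M : ℕ}

theorem OutputsLE.mirror (h : T.OutputsLE M) : T.mirror.OutputsLE M where
  trans p a q x hx := by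
    obtain ⟨y, hy, rfl⟩ := Option.map_eq_some_iff.1 hx
    simpa using h.trans _ _ _ y hy
  init q x hx := by
    obtain ⟨y, hy, rfl⟩ := Option.map_eq_some_iff.1 hx
    simpa using h.final _ y hy
  final q x hx := by
    obtain ⟨y, hy, rfl⟩ := Option.map_eq_some_iff.1 hx
    simpa using h.init _ y hy

theorem OutputsLE.length_run (h : T.OutputsLE M) {p q : Q} {u v : List A} (hr : T.Run p u q v) :
    v.length ≤ u.length * M := by
  induction hr with
  | nil => simp
  | cons ht _ ih =>
    have := h.trans _ _ _ _ ht
    simp only [List.length_append, List.length_cons, Nat.add_mul]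
    omega

theorem OutputsLE.length_reach (h : T.OutputsLE M) {q : Q} {u v : List A} (hr : T.Reach u q v) :
    v.length ≤ (u.length + 1) * M := by
  obtain ⟨i, x, w, hi, hr, rfl⟩ := hr
  have h1 := h.init _ _ hi
  have h2 := h.length_run hr
  simp only [List.length_append, Nat.add_mul]
  omega

theorem OutputsLE.length_realizes (h : T.OutputsLE M) {u v : List A} (hr : T.Realizes u v) :
    v.length ≤ (u.length + 2) * M := by
  obtain ⟨p, q, x, w, y, hp, hr, hq, rfl⟩ := hr
  have h1 := h.init _ _ hp
  have h2 := h.length_run hr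
  have h3 := h.final _ _ hq
  simp only [List.length_append, Nat.add_mul]
  omega

/-- The pairs of states that are reached over `x`, with the delays of the runs, where the delays are
described by short words. -/
def profile (T : Transducer A Q) (K : ℕ) (x : List A) :
    Set (Q × Q × {w : List A // w.length ≤ K} × {w : List A // w.length ≤ K}) :=
  {c | ∃ a b, T.Reach x c.1 a ∧ T.Reach x c.2.1 b ∧ delay a b = delay c.2.2.1.1 c.2.2.2.1}

/-- There is at most one delay for each left class. -/
theorem _root_.Separates.finite_suffixDelays {α β : Type*} [Finite α] {l : List A → α}
    {r : List A → β} (h : Separates f l r) {y y' : List A} (e : r y = r y') :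
    (suffixDelays f y y').Finite := by
  have : suffixDelays f y y' =
      ⋃ i : α, {g | ∃ z s t, l z = i ∧ s ∈ f (z ++ y) ∧ t ∈ f (z ++ y') ∧ g = delay s t} := by
    ext g
    simp only [suffixDelays, Set.mem_ofPred_eq, Set.mem_iUnion]
    exact ⟨fun ⟨z, s, t, h⟩ => ⟨l z, z, s, t, rfl, h⟩, fun ⟨_, z, s, t, _, h⟩ => ⟨z, s, t, h⟩⟩
  rw [this]
  refine Set.finite_iUnion fun i => Set.Subsingleton.finite ?_
  rintro _ ⟨z, s, t, hz, hs, ht, rfl⟩ _ ⟨z', s', t', hz', hs', ht', rfl⟩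
  exact h.delay_eq (hz.trans hz'.symm) e hs ht hs' ht'

/-- Prefixes with the same profile are equivalent, whatever the right automaton is. The bound on the
number of left states of a minimal bimachine that results is independent of its right automaton. -/
theorem leftRel_of_profile_eq [Finite Q] {α β : Type*} [Finite α] {l : List A → α}
    {r : List A → β} (hT : T.RealizesFun f) (hM : T.OutputsLE M) (h : Separates f l r) {K : ℕ}
    (hK : (Nat.card Q * Nat.card Q + 1) * M ≤ K) {x x' : List A}
    (e : T.profile K x = T.profile K x') : LeftRel f r x x' := by
  have key : ∀ {x x'}, T.profile K x = T.profile K x' → ∀ {y y' : List A} {p q : Q}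
      {a b c d : List A}, r y = r y' →
      T.Reach x p a → T.Reach x q b → T.Coreach p y c → T.Coreach q y' d →
      ∃ a' b', T.Reach x' p a' ∧ T.Reach x' q b' ∧ delay a b = delay a' b' := by
    intro x x' e y y' p q a b c d hy ha hb hc hd
    obtain ⟨x₀, a₀, b₀, hx₀, ha₀, hb₀, he⟩ :=
      ha.exists_short_delay_eq hT (h.finite_suffixDelays hy) hb hc hd
    have hle : (x₀.length + 1) * M ≤ K := le_trans (Nat.mul_le_mul_right M (by omega)) hK
    have hmem : (p, q, ⟨a₀, (hM.length_reach ha₀).trans hle⟩,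
        ⟨b₀, (hM.length_reach hb₀).trans hle⟩) ∈ T.profile K x := ⟨a, b, ha, hb, he⟩
    rw [e] at hmem
    obtain ⟨a', b', ha', hb', he'⟩ := hmem
    exact ⟨a', b', ha', hb', he.trans he'.symm⟩
  have hdom : ∀ {x x'}, T.profile K x = T.profile K x' → ∀ y, (f (x ++ y)).Dom →
      (f (x' ++ y)).Dom := by
    intro x x' e y hd
    obtain ⟨p, a, c, ha, hc, -⟩ := ((hT _ _).2 (Part.get_mem hd)).exists_reach
    obtain ⟨a', -, ha', -, -⟩ := key e rfl ha ha hc hc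
    exact Part.dom_iff_mem.2 ⟨_, (hT _ _).1 (ha'.realizes hc)⟩
  refine ⟨fun y => ⟨hdom e y, hdom e.symm y⟩, fun y y' s t s' t' hy hs ht hs' ht' => ?_⟩
  obtain ⟨p, a, c, ha, hc, rfl⟩ := ((hT _ _).2 hs).exists_reach
  obtain ⟨q, b, d, hb, hd, rfl⟩ := ((hT _ _).2 ht).exists_reach
  obtain ⟨a', b', ha', hb', he⟩ := key e hy ha hb hc hd
  rw [Part.mem_unique hs' ((hT _ _).1 (ha'.realizes hc)),
    Part.mem_unique ht' ((hT _ _).1 (hb'.realizes hd)), FreeGroup.delay_append_append,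
    FreeGroup.delay_append_append, he]

theorem card_range_le_of_profile [Finite A] [Finite Q] {K : ℕ} {L : Type} (g : List A → L)
    (h : ∀ x x', T.profile K x = T.profile K x' → g x = g x') :
    Nat.card (Set.range g) ≤ 2 ^ (Nat.card Q * (Nat.card Q *
      (Nat.card {w : List A // w.length ≤ K} * Nat.card {w : List A // w.length ≤ K}))) := by
  have : Finite {w : List A // w.length ≤ K} := List.finite_length_le A K
  let φ : Set.range g →
      Set (Q × Q × {w : List A // w.length ≤ K} × {w : List A // w.length ≤ K}) :=
    fun i => T.profile K i.2.choose
  have hφ : Function.Injective φ := fun i j hij => by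
    have := h _ _ hij
    rw [i.2.choose_spec, j.2.choose_spec] at this
    exact Subtype.ext this
  classical
  have hle := Nat.card_le_card_of_injective φ hφ
  let _ := Fintype.ofFinite
    (Q × Q × {w : List A // w.length ≤ K} × {w : List A // w.length ≤ K})
  rw [Nat.card_eq_fintype_card (α := Set _), Fintype.card_set, ← Nat.card_eq_fintype_card] at hle
  rwa [Nat.card_prod, Nat.card_prod, Nat.card_prod] at hle

end Transducer

namespace Bimachine

variable {L R Q : Type} [Finite L] [Finite R] {B : Bimachine A L R} {f : List A →. List A}
  {T : Transducer A Q} {M K : ℕ}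

/-- The left automaton of a minimal bimachine has a bounded number of accessible states. -/
theorem IsMinimalFor.card_left_le [Finite A] [Finite Q] (h : B.IsMinimalFor f)
    (hT : T.RealizesFun f) (hM : T.OutputsLE M) (hK : (Nat.card Q * Nat.card Q + 1) * M ≤ K) :
    Nat.card (Set.range B.leftEval) ≤ 2 ^ (Nat.card Q * (Nat.card Q *
      (Nat.card {w : List A // w.length ≤ K} * Nat.card {w : List A // w.length ≤ K}))) :=
  Transducer.card_range_le_of_profile (T := T) _ fun _ _ e =>
    h.leftEval_eq (Transducer.leftRel_of_profile_eq hT hM h.1.separates hK e)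

/-- The right automaton of a minimal bimachine has a bounded number of accessible states. -/
theorem IsMinimalFor.card_right_le [Finite A] [Finite Q] (h : B.IsMinimalFor f)
    (hT : T.RealizesFun f) (hM : T.OutputsLE M) (hK : (Nat.card Q * Nat.card Q + 1) * M ≤ K) :
    Nat.card (Set.range B.rightEval) ≤ 2 ^ (Nat.card Q * (Nat.card Q *
      (Nat.card {w : List A // w.length ≤ K} * Nat.card {w : List A // w.length ≤ K}))) := by
  have := Transducer.card_range_le_of_profile (T := T.mirror) (K := K)
    (fun u => B.rightEval u.reverse) fun x x' e =>
      h.rightEval_eq (LeftRel.rightRel_of_mirror (by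
        simpa using Transducer.leftRel_of_profile_eq hT.mirror hM.mirror h.1.separates.mirror hK e))
  rwa [show Set.range (fun u : List A => B.rightEval u.reverse) = Set.range B.rightEval from
    List.reverse_surjective.range_comp B.rightEval] at this

end Bimachine

/-! ### From bimachines to transducers and back -/

namespace Bimachine

variable {L R : Type} (B : Bimachine A L R) {f : List A →. List A}

open Classical in
/-- The unambiguous transducer that guesses the states of the right automaton. -/
noncomputable def toTransducer : Transducer A (L × R) where
  trans p a q := if q.1 = B.lstep p.1 a ∧ p.2 = B.rstep q.2 a then some (B.out p.1 a q.2) else none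
  init p := if p.1 = B.lstart then B.lfinal p.2 else none
  final p := if p.2 = B.rstart then B.rfinal p.1 else none

theorem toTransducer_run_iff {p q : L × R} {u v : List A} :
    B.toTransducer.Run p u q v ↔ q.1 = B.left.evalFrom p.1 u ∧
      p.2 = B.right.evalFrom q.2 u.reverse ∧ v = B.outWord p.1 u q.2 := by
  induction u generalizing p v with
  | nil => simp [Transducer.run_nil_iff, outWord, Prod.ext_iff, eq_comm, and_assoc]
  | cons a u ih =>
    have e : B.right.evalFrom q.2 (a :: u).reverse =
        B.rstep (B.right.evalFrom q.2 u.reverse) a := by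
      rw [List.reverse_cons, DFA.evalFrom_append_singleton]; rfl
    rw [e]
    constructor
    · intro h
      cases h with
      | @cons _ t _ _ x _ v ht hr =>
        obtain ⟨h1, h2, rfl⟩ := ih.1 hr
        simp only [toTransducer, Option.ite_none_right_eq_some, Option.some.injEq] at ht
        obtain ⟨⟨h3, h4⟩, rfl⟩ := ht
        rw [h4, h1, h2, h3]
        exact ⟨rfl, rfl, rfl⟩
    · rintro ⟨h1, h2, rfl⟩
      refine .cons (q := (B.lstep p.1 a, B.right.evalFrom q.2 u.reverse)) ?_
        (ih.2 ⟨h1, rfl, rfl⟩)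
      simp [toTransducer, h2]

theorem toTransducer_realizes_iff {u w : List A} :
    B.toTransducer.Realizes u w ↔ B.Realizes u w := by
  constructor
  · rintro ⟨p, q, x, v, y, hx, hr, hy, rfl⟩
    obtain ⟨h1, h2, rfl⟩ := B.toTransducer_run_iff.1 hr
    simp only [toTransducer, Option.ite_none_right_eq_some] at hx hy
    obtain ⟨h3, hx⟩ := hx
    obtain ⟨h4, hy⟩ := hy
    rw [h3] at h1 ⊢
    rw [h4] at h2 ⊢
    rw [h2] at hx
    rw [h1] at hy
    exact ⟨x, y, hx, hy, rfl⟩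
  · rintro ⟨x, y, hx, hy, rfl⟩
    refine ⟨(B.lstart, B.rightEval u), (B.leftEval u, B.rstart), x, _, y, ?_,
      B.toTransducer_run_iff.2 ⟨rfl, rfl, rfl⟩, ?_, rfl⟩
    · simp [toTransducer, hx]
    · simp [toTransducer, hy]

theorem _root_.DFA.mem_reverse_evalFrom {S : Type} (M : DFA A S) {p q : S} {u : List A} :
    q ∈ M.toNFA.reverse.evalFrom {p} u ↔ M.evalFrom q u.reverse = p := by
  induction u generalizing p with
  | nil => simp
  | cons a u ih =>
    rw [NFA.evalFrom_cons, NFA.stepSet_singleton, NFA.mem_evalFrom_iff_exists, List.reverse_cons,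
      DFA.evalFrom_append_singleton]
    simp only [ih]
    simp [NFA.reverse, eq_comm]

theorem transitionCon_iff {u v : FreeMonoid A} : B.transitionCon u v ↔
    (∀ l, B.left.evalFrom l u.toList = B.left.evalFrom l v.toList) ∧
    ∀ r, B.right.evalFrom r u.toList.reverse = B.right.evalFrom r v.toList.reverse := by
  rw [transitionCon, Con.inf_iff_and]
  refine and_congr ?_ ?_
  · change (∀ p q, _ ↔ _) ↔ _
    simp only [DFA.toNFA_evalFrom_match, Set.mem_singleton_iff]
    exact ⟨fun h l => (h l _).1 rfl, fun h p q => by rw [h p]⟩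
  · change (∀ p q, _ ↔ _) ↔ _
    simp only [DFA.mem_reverse_evalFrom]
    exact ⟨fun h l => ((h _ l).1 rfl).symm, fun h p q => by rw [h q]⟩

theorem transitionCon_le_toTransducer :
    B.transitionCon ≤ B.toTransducer.automaton.transitionCon := by
  intro u v h
  rw [transitionCon_iff] at h
  intro p q
  simp only [Transducer.mem_evalFrom_singleton, toTransducer_run_iff, h.1, h.2]
  exact ⟨fun ⟨_, h1, h2, _⟩ => ⟨_, h1, h2, rfl⟩, fun ⟨_, h1, h2, _⟩ => ⟨_, h1, h2, rfl⟩⟩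

/-- A transduction with a `V`-bimachine is a `V`-transduction. -/
theorem RealizesFun.isTransduction {B : Bimachine A L R} [Finite A] [Finite L] [Finite R]
    {V : CongruenceClass}     (h : B.RealizesFun f) (hV : B.transitionCon ∈ V.mem A) : V.IsTransduction f :=
  ⟨L × R, inferInstance, B.toTransducer,
    fun u w => B.toTransducer_realizes_iff.trans (h u w),
    V.mem_of_le _ _ _ hV B.transitionCon_le_toTransducer⟩

/-- Every state of the left and of the right automaton is reached by some word. -/
structure Accessible (B : Bimachine A L R) : Prop where
  left : Function.Surjective B.leftEval
  right : Function.Surjective B.rightEval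

/-- Transition congruences are compared by way of the states reached from the initial states, which
requires the coarser bimachine to be accessible. -/
theorem Accessible.transitionCon_of_finer {L' R' : Type} {B : Bimachine A L R}
    {B' : Bimachine A L' R'} (h : B'.Accessible) (hf : B.Finer B') {u v : FreeMonoid A}
    (hl : ∀ w, B.leftEval (w ++ u.toList) = B.leftEval (w ++ v.toList))
    (hr : ∀ w, B.rightEval (u.toList ++ w) = B.rightEval (v.toList ++ w)) :
    B'.transitionCon u v := by
  rw [transitionCon_iff]
  constructor
  · intro l
    obtain ⟨w, rfl⟩ := h.left l
    have := hf.1 _ _ (hl w)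
    simpa only [leftEval, DFA.eval, DFA.evalFrom_of_append] using this
  · intro r
    obtain ⟨w, rfl⟩ := h.right r
    have := hf.2 _ _ (hr w)
    simpa only [rightEval, DFA.eval, List.reverse_append, DFA.evalFrom_of_append] using this

end Bimachine

namespace Transducer

variable {Q : Type} {T : Transducer A Q} {f : List A →. List A}

theorem mem_automaton_eval {u : List A} {q : Q} :
    q ∈ T.automaton.eval u ↔ ∃ w, T.Reach u q w := by
  rw [NFA.eval, NFA.mem_evalFrom_iff_exists]
  simp only [mem_evalFrom_singleton]
  constructor
  · rintro ⟨p, hp, v, hv⟩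
    obtain ⟨x, hx⟩ := Option.isSome_iff_exists.1 hp
    exact ⟨_, p, x, v, hx, hv, rfl⟩
  · rintro ⟨_, p, x, v, hp, hv, -⟩
    exact ⟨p, by simp [automaton, hp], v, hv⟩

/-- The states from which the automaton can read the letter `a` and get into `S`. -/
def preStep (T : Transducer A Q) (S : Set Q) (a : A) : Set Q :=
  {p | ∃ q ∈ S, (T.trans p a q).isSome}

/-- The states that accept `u`. -/
def coreachSet (T : Transducer A Q) (u : List A) : Set Q :=
  u.foldr (fun a S => T.preStep S a) T.automaton.accept

theorem mem_coreachSet {u : List A} {p : Q} : p ∈ T.coreachSet u ↔ ∃ w, T.Coreach p u w := by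
  induction u generalizing p with
  | nil =>
    change (T.final p).isSome ↔ _
    rw [Option.isSome_iff_exists]
    constructor
    · rintro ⟨y, hy⟩; exact ⟨_, p, [], y, .nil p, hy, rfl⟩
    · rintro ⟨_, s, v, y, hr, hs, -⟩
      obtain ⟨rfl, -⟩ := run_nil_iff.1 hr
      exact ⟨y, hs⟩
  | cons a u ih =>
    change (∃ q ∈ T.coreachSet u, (T.trans p a q).isSome) ↔ _
    simp only [ih, Option.isSome_iff_exists]
    constructor
    · rintro ⟨q, ⟨w, hw⟩, x, hx⟩
      exact ⟨x ++ w, Coreach.append (run_singleton hx) hw⟩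
    · rintro ⟨w, hw⟩
      obtain ⟨q, v, w', hr, hc, rfl⟩ := Coreach.exists_of_append (u := [a]) hw
      exact ⟨q, ⟨w', hc⟩, v, run_singleton_iff.1 hr⟩

/-- The subset automaton and the backward subset automaton of a transducer separate the transduction
that it realizes: the delay of the images of `x ++ y` and `x ++ y'` is the delay of the outputs on
`y` and `y'` from any common useful state. -/
theorem RealizesFun.separates (h : T.RealizesFun f) :
    Separates f T.automaton.eval T.coreachSet where
  dom_left {x x'} e y hd := by
    obtain ⟨q, a, b, ha, hb, -⟩ := ((h _ _).2 (Part.get_mem hd)).exists_reach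
    have : q ∈ T.automaton.eval x' := e ▸ mem_automaton_eval.2 ⟨a, ha⟩
    obtain ⟨a', ha'⟩ := mem_automaton_eval.1 this
    exact Part.dom_iff_mem.2 ⟨_, (h _ _).1 (ha'.realizes hb)⟩
  dom_right {y y'} e x hd := by
    obtain ⟨q, a, b, ha, hb, -⟩ := ((h _ _).2 (Part.get_mem hd)).exists_reach
    have : q ∈ T.coreachSet y' := e ▸ mem_coreachSet.2 ⟨b, hb⟩
    obtain ⟨b', hb'⟩ := mem_coreachSet.1 this
    exact Part.dom_iff_mem.2 ⟨_, (h _ _).1 (ha.realizes hb')⟩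
  delay_eq {x x' y y' s t s' t'} e e' hs ht hs' ht' := by
    obtain ⟨q, a, b, ha, hb, -⟩ := ((h _ _).2 hs).exists_reach
    have h1 : q ∈ T.automaton.eval x' := e ▸ mem_automaton_eval.2 ⟨a, ha⟩
    have h2 : q ∈ T.coreachSet y' := e' ▸ mem_coreachSet.2 ⟨b, hb⟩
    obtain ⟨a', ha'⟩ := mem_automaton_eval.1 h1
    obtain ⟨b', hb'⟩ := mem_coreachSet.1 h2
    rw [Part.mem_unique hs ((h _ _).1 (ha.realizes hb)),
      Part.mem_unique ht ((h _ _).1 (ha.realizes hb')),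
      Part.mem_unique hs' ((h _ _).1 (ha'.realizes hb)),
      Part.mem_unique ht' ((h _ _).1 (ha'.realizes hb')),
      FreeGroup.delay_append, FreeGroup.delay_append]

/-- A transducer yields a bimachine such that the accessible coarser bimachines have coarser
transition congruences. -/
theorem RealizesFun.exists_bimachine [Finite Q] (h : T.RealizesFun f) :
    ∃ B : Bimachine A (Set Q) (Set Q), B.RealizesFun f ∧
      ∀ (L R : Type) (B' : Bimachine A L R), B'.Accessible → B.Finer B' →
        T.automaton.transitionCon ≤ B'.transitionCon := by
  obtain ⟨B, hl, hr, hB, -⟩ := Separates.exists_bimachine (lstep := T.automaton.stepSet)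
    (lstart := T.automaton.start) (rstep := T.preStep) (rstart := T.automaton.accept) h.separates
  replace hl : ∀ u, B.leftEval u = T.automaton.eval u := hl
  replace hr : ∀ u, B.rightEval u = T.coreachSet u := hr
  refine ⟨B, hB, fun L R B' hacc hfin u v huv => hacc.transitionCon_of_finer hfin ?_ ?_⟩
  · intro w
    rw [hl, hl, NFA.eval, NFA.evalFrom_append, NFA.evalFrom_append]
    ext q
    rw [NFA.mem_evalFrom_iff_exists, NFA.mem_evalFrom_iff_exists]
    exact exists_congr fun p => and_congr_right fun _ => huv p q
  · intro w
    have key : ∀ {u v : FreeMonoid A}, T.automaton.transitionCon u v →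
        T.coreachSet (u.toList ++ w) ⊆ T.coreachSet (v.toList ++ w) := by
      intro u v huv p hp
      obtain ⟨c, hc⟩ := mem_coreachSet.1 hp
      obtain ⟨q, x, y, hx, hy, -⟩ := hc.exists_of_append
      obtain ⟨x', hx'⟩ := mem_evalFrom_singleton.1 ((huv p q).1 (mem_evalFrom_singleton.2 ⟨x, hx⟩))
      exact mem_coreachSet.2 ⟨_, Coreach.append hx' hy⟩
    rw [hr, hr]
    exact (key huv).antisymm (key (T.automaton.transitionCon.symm huv))

end Transducer

/-! ### Minimal bimachines and normal forms -/

theorem Nat.card_range_le_of_ker_le {X Y Y' : Type*} [Finite Y] {g : X → Y} {g' : X → Y'}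
    (h : ∀ x x', g x = g x' → g' x = g' x') :
    Nat.card (Set.range g') ≤ Nat.card (Set.range g) ∧
      (Nat.card (Set.range g) ≤ Nat.card (Set.range g') → ∀ x x', g' x = g' x' → g x = g x') := by
  let φ : Set.range g → Set.range g' := fun i => ⟨g' i.2.choose, _, rfl⟩
  have hφ : ∀ x, φ ⟨g x, x, rfl⟩ = ⟨g' x, x, rfl⟩ := fun x =>
    Subtype.ext (h _ _ (Exists.choose_spec (⟨x, rfl⟩ : ∃ y, g y = g x)))
  have hs : Function.Surjective φ := by
    rintro ⟨_, x, rfl⟩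
    exact ⟨_, hφ x⟩
  refine ⟨Nat.card_le_card_of_surjective φ hs, fun hle x x' e => ?_⟩
  have hb := hs.bijective_of_nat_card_le hle
  exact congrArg Subtype.val (hb.1 ((hφ x).trans ((Subtype.ext e).trans (hφ x').symm)))

namespace Bimachine

variable {L R L' R' L'' R'' : Type} {f : List A →. List A}

theorem Finer.refl (B : Bimachine A L R) : B.Finer B := ⟨fun _ _ => id, fun _ _ => id⟩

theorem Finer.trans {B : Bimachine A L R} {B' : Bimachine A L' R'} {B'' : Bimachine A L'' R''}
    (h : B.Finer B') (h' : B'.Finer B'') : B.Finer B'' :=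
  ⟨fun u v e => h'.1 u v (h.1 u v e), fun u v e => h'.2 u v (h.2 u v e)⟩

theorem RealizesFun.exists_minimal [Finite L] [Finite R] {B : Bimachine A L R}
    (h : B.RealizesFun f) : ∃ (L' R' : Type) (_ : Finite L') (_ : Finite R')
      (B' : Bimachine A L' R'), B'.IsMinimalFor f ∧ B.Finer B' := by
  induction hn : Nat.card (Set.range B.leftEval) + Nat.card (Set.range B.rightEval)
    using Nat.strong_induction_on generalizing L R with
  | _ n ih =>
    -- a strictly coarser bimachine has fewer accessible states
    by_cases hmin : B.IsMinimalFor f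
    · exact ⟨L, R, ‹_›, ‹_›, B, hmin, .refl B⟩
    · simp only [IsMinimalFor, h, true_and, not_forall] at hmin
      obtain ⟨L', R', _, _, B', hB', hf, hnf⟩ := hmin
      have h1 := Nat.card_range_le_of_ker_le hf.1
      have h2 := Nat.card_range_le_of_ker_le hf.2
      have hlt : Nat.card (Set.range B'.leftEval) + Nat.card (Set.range B'.rightEval) < n := by
        by_contra! hle
        exact hnf ⟨h1.2 (by omega), h2.2 (by omega)⟩
      obtain ⟨L'', R'', i, j, B'', hm, hf'⟩ := ih _ hlt hB' rfl
      exact ⟨L'', R'', i, j, B'', hm, hf.trans hf'⟩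

end Bimachine

/-- The accessible part of a deterministic automaton, with its states numbered. -/
theorem exists_accessible_fin {S : Type} [Finite S] (step : S → A → S) (start : S) {n : ℕ}
    (hn : Nat.card (Set.range fun u : List A => u.foldl step start) = n) :
    ∃ (step' : Fin n → A → Fin n) (start' : Fin n),
      (∀ u v : List A, u.foldl step' start' = v.foldl step' start' ↔
        u.foldl step start = v.foldl step start) ∧
      Function.Surjective fun u : List A => u.foldl step' start' := by
  let e := Finite.equivFinOfCardEq hn
  let ev : List A → Set.range fun u : List A => u.foldl step start := fun u => ⟨_, u, rfl⟩
  let step' := fun i a => e ⟨step (e.symm i).1 a, by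
    obtain ⟨u, hu⟩ := (e.symm i).2
    exact ⟨u ++ [a], by simp only [List.foldl_append, List.foldl_cons, List.foldl_nil]; rw [← hu]⟩⟩
  have hev : ∀ u : List A, u.foldl step' (e (ev [])) = e (ev u) := by
    intro u
    induction u using List.reverseRecOn with
    | nil => rfl
    | append_singleton u a ih =>
      rw [List.foldl_append, ih]
      refine congrArg e (Subtype.ext ?_)
      change step (e.symm (e (ev u))).1 a = (u ++ [a]).foldl step start
      rw [e.symm_apply_apply, List.foldl_append]
      rfl
  refine ⟨step', e (ev []), fun u v => ?_, fun i => ?_⟩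
  · rw [hev, hev, e.apply_eq_iff_eq, Subtype.ext_iff]
  · obtain ⟨u, hu⟩ := (e.symm i).2
    refine ⟨u, (hev u).trans ?_⟩
    rw [← e.eq_symm_apply]
    exact Subtype.ext hu

theorem exists_short_foldl_eq {S : Type} [Finite S] (step : S → A → S) (start : S) (u : List A) :
    ∃ v : List A, v.length ≤ Nat.card S ∧ v.foldl step start = u.foldl step start := by
  induction hn : u.length using Nat.strong_induction_on generalizing u with
  | _ n ih =>
    by_cases hle : u.length ≤ Nat.card S
    · exact ⟨u, hle, rfl⟩
    · let M : DFA A S := ⟨step, start, ∅⟩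
      let _ := Fintype.ofFinite S
      obtain ⟨q, a, b, c, rfl, -, hb, h1, h2, h3⟩ := M.evalFrom_split (x := u) (s := start)
        (by rw [← Nat.card_eq_fintype_card]; omega) rfl
      obtain ⟨v, hv, he⟩ := ih (a ++ c).length (by
        have := List.length_pos_of_ne_nil hb
        simp at hn ⊢; omega) (a ++ c) rfl
      refine ⟨v, hv, he.trans ?_⟩
      change M.evalFrom start (a ++ c) = M.evalFrom start (a ++ b ++ c)
      rw [M.evalFrom_of_append, M.evalFrom_of_append, M.evalFrom_of_append, h1, h2]

namespace Bimachine

variable {L R Q : Type} {f : List A →. List A} {T : Transducer A Q} {M : ℕ}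

/-- All words that occur in the bimachine have length at most `M`. -/
structure OutputsLE (B : Bimachine A L R) (M : ℕ) : Prop where
  out : ∀ p a q, (B.out p a q).length ≤ M
  lfinal : ∀ q x, B.lfinal q = some x → x.length ≤ M
  rfinal : ∀ p x, B.rfinal p = some x → x.length ≤ M

theorem exists_short_leftEval [Finite L] (B : Bimachine A L R) (u : List A) :
    ∃ v : List A, v.length ≤ Nat.card L ∧ B.leftEval v = B.leftEval u :=
  exists_short_foldl_eq B.lstep B.lstart u

theorem exists_short_rightEval [Finite R] (B : Bimachine A L R) (u : List A) :
    ∃ v : List A, v.length ≤ Nat.card R ∧ B.rightEval v = B.rightEval u := by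
  obtain ⟨v, hv, he⟩ := exists_short_foldl_eq B.rstep B.rstart u.reverse
  exact ⟨v.reverse, by simpa using hv, by
    rw [rightEval, List.reverse_reverse]; exact he⟩

/-- The words that occur in an accessible bimachine without useless outputs are factors of images of
short words. -/
theorem Accessible.outputsLE [Finite L] [Finite R] {B : Bimachine A L R} (h : B.Accessible)
    (hB : B.RealizesFun f) (hout : ∀ l a q, B.out l a q ≠ [] →
      ∃ x y, B.leftEval x = l ∧ B.rightEval y = q ∧ (f (x ++ a :: y)).Dom)
    (hT : T.RealizesFun f) (hM : T.OutputsLE M) :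
    B.OutputsLE ((Nat.card L + Nat.card R + 3) * M) where
  out p a q := by
    by_cases hne : B.out p a q = []
    · simp [hne]
    · obtain ⟨x, y, rfl, rfl, hd⟩ := hout p a q hne
      obtain ⟨x', hx', ex⟩ := B.exists_short_leftEval x
      obtain ⟨y', hy', ey⟩ := B.exists_short_rightEval y
      have hd' := hB.separates.dom_right (y := a :: y) (y' := a :: y')
        (by rw [rightEval_cons, rightEval_cons, ey]) x' (hB.separates.dom_left ex.symm _ hd)
      have hw := Part.get_mem hd'
      have hle := hM.length_realizes ((hT _ _).2 hw)
      have he := congrArg List.length (hB.eq_append_rest hw)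
      rw [rest, outWord, show B.right.evalFrom B.rstart y'.reverse = B.rightEval y' from rfl] at he
      rw [← ex, ← ey]
      simp only [List.length_append, List.length_cons] at he hle
      refine le_trans ?_ (hle.trans (Nat.mul_le_mul_right M (by omega)))
      omega
  lfinal q x hx := by
    obtain ⟨u, rfl⟩ := h.right q
    obtain ⟨v, hv, e⟩ := B.exists_short_rightEval u
    rw [← e] at hx
    obtain ⟨y, hy⟩ := Option.isSome_iff_exists.1 ((B.rfinal_isSome_iff v).2 (by rw [hx]; rfl))
    have hle := hM.length_realizes ((hT _ _).2 ((hB v _).1 ⟨x, y, hx, hy, rfl⟩))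
    simp only [List.length_append] at hle
    refine le_trans ?_ (hle.trans (Nat.mul_le_mul_right M (by omega)))
    omega
  rfinal p y hy := by
    obtain ⟨u, rfl⟩ := h.left p
    obtain ⟨v, hv, e⟩ := B.exists_short_leftEval u
    rw [← e] at hy
    obtain ⟨x, hx⟩ := Option.isSome_iff_exists.1 ((B.rfinal_isSome_iff v).1 (by rw [hy]; rfl))
    have hle := hM.length_realizes ((hT _ _).2 ((hB v _).1 ⟨x, y, hx, hy, rfl⟩))
    simp only [List.length_append] at hle
    refine le_trans ?_ (hle.trans (Nat.mul_le_mul_right M (by omega)))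
    omega

/-- Every bimachine is equivalent to an accessible one with numbered states and short outputs. -/
theorem RealizesFun.exists_normal [Finite L] [Finite R] {B : Bimachine A L R}
    (hB : B.RealizesFun f) (hT : T.RealizesFun f) (hM : T.OutputsLE M) :
    ∃ B' : Bimachine A (Fin (Nat.card (Set.range B.leftEval)))
        (Fin (Nat.card (Set.range B.rightEval))),
      B'.RealizesFun f ∧ B'.Accessible ∧ B.Finer B' ∧ B'.Finer B ∧
        B'.OutputsLE
          ((Nat.card (Set.range B.leftEval) + Nat.card (Set.range B.rightEval) + 3) * M) := by
  obtain ⟨lstep, lstart, hl, hl'⟩ := exists_accessible_fin B.lstep B.lstart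
    (n := Nat.card (Set.range B.leftEval)) rfl
  obtain ⟨rstep, rstart, hr, hr'⟩ := exists_accessible_fin B.rstep B.rstart
    (n := Nat.card (Set.range B.rightEval)) (by
      rw [show Set.range B.rightEval = Set.range fun u : List A => u.foldl B.rstep B.rstart from
        List.reverse_surjective.range_comp (fun u : List A => u.foldl B.rstep B.rstart)])
  have hsep : Separates f (fun u => u.foldl lstep lstart)
      (fun u => u.foldr (fun a s => rstep s a) rstart) :=
    hB.separates.mono (fun u v e => (hl u v).1 e) (fun u v e => by
      rw [← List.foldl_reverse, ← List.foldl_reverse] at e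
      exact (hr _ _).1 e)
  obtain ⟨B', hl₁, hr₁, hB', hout⟩ := hsep.exists_bimachine
  replace hr₁ : ∀ u, B'.rightEval u = u.reverse.foldl rstep rstart := fun u => by
    rw [hr₁, List.foldl_reverse]
  have hacc : B'.Accessible := by
    refine ⟨fun i => ?_, fun i => ?_⟩
    · obtain ⟨u, hu⟩ := hl' i
      exact ⟨u, (hl₁ u).trans hu⟩
    · obtain ⟨u, hu⟩ := hr' i
      exact ⟨u.reverse, by rw [hr₁, List.reverse_reverse]; exact hu⟩
  refine ⟨B', hB', hacc, ⟨fun u v e => ?_, fun u v e => ?_⟩, ⟨fun u v e => ?_, fun u v e => ?_⟩, ?_⟩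
  · rw [hl₁, hl₁]; exact (hl u v).2 e
  · rw [hr₁, hr₁]; exact (hr _ _).2 e
  · rw [hl₁, hl₁] at e; exact (hl u v).1 e
  · rw [hr₁, hr₁] at e; exact (hr _ _).1 e
  · simpa using hacc.outputsLE hB' hout hT hM

end Bimachine

/-! ### Conditions on bimachines that can be tested on short words -/

theorem List.foldl_prodMk {S S' : Type} (step : S → A → S) (step' : S' → A → S') (s : S) (s' : S')
    (u : List A) : u.foldl (fun (p : S × S') a => (step p.1 a, step' p.2 a)) (s, s') =
      (u.foldl step s, u.foldl step' s') := by
  induction u generalizing s s' with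
  | nil => rfl
  | cons a u ih => exact ih _ _

theorem exists_short_foldl_eq₂ {S S' : Type} [Finite S] [Finite S'] (step : S → A → S)
    (step' : S' → A → S') (s : S) (s' : S') (u : List A) :
    ∃ v : List A, v.length ≤ Nat.card S * Nat.card S' ∧ v.foldl step s = u.foldl step s ∧
      v.foldl step' s' = u.foldl step' s' := by
  obtain ⟨v, hv, he⟩ := exists_short_foldl_eq
    (fun (p : S × S') a => (step p.1 a, step' p.2 a)) (s, s') u
  rw [List.foldl_prodMk, List.foldl_prodMk, Prod.mk.injEq] at he
  exact ⟨v, by rwa [Nat.card_prod] at hv, he⟩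

theorem Nat.card_set_eq (Q : Type) [Finite Q] : Nat.card (Set Q) = 2 ^ Nat.card Q := by
  classical
  let _ := Fintype.ofFinite Q
  rw [Nat.card_eq_fintype_card, Fintype.card_set, Nat.card_eq_fintype_card]

namespace Transducer

variable {Q S : Type} {T : Transducer A Q} {f : List A →. List A}

/-- Whether a deterministic automaton recognizes the domain can be tested on short words. -/
theorem RealizesFun.dom_iff_foldl_of_short [Finite Q] [Finite S] (hT : T.RealizesFun f)
    (step : S → A → S) (s : S) (p : S → Prop)
    (h : ∀ u : List A, u.length ≤ 2 ^ Nat.card Q * Nat.card S → ((f u).Dom ↔ p (u.foldl step s)))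
    (u : List A) : (f u).Dom ↔ p (u.foldl step s) := by
  obtain ⟨v, hv, e, e'⟩ := exists_short_foldl_eq₂ T.automaton.stepSet step T.automaton.start s u
  rw [Nat.card_set_eq] at hv
  rw [← e', ← h v hv]
  have hs := hT.separates
  exact ⟨fun hd => by simpa using hs.dom_left (x := u) (x' := v) e.symm [] (by simpa using hd),
    fun hd => by simpa using hs.dom_left (x := v) (x' := u) e [] (by simpa using hd)⟩

/-- The dual of `RealizesFun.dom_iff_foldl_of_short` for right automata. -/
theorem RealizesFun.dom_iff_foldl_reverse_of_short [Finite Q] [Finite S] (hT : T.RealizesFun f)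
    (step : S → A → S) (s : S) (p : S → Prop)
    (h : ∀ u : List A, u.length ≤ 2 ^ Nat.card Q * Nat.card S →
      ((f u).Dom ↔ p (u.reverse.foldl step s)))
    (u : List A) : (f u).Dom ↔ p (u.reverse.foldl step s) := by
  have := hT.mirror.dom_iff_foldl_of_short step s p (fun v hv => by
    simpa [mirrorFun_dom] using h v.reverse (by simpa using hv)) u.reverse
  simpa [mirrorFun_dom] using this

end Transducer

namespace Bimachine

variable {L R L' R' Q : Type} {f : List A →. List A} {T : Transducer A Q} {B : Bimachine A L R}

/-- Two transducers are compared on short words, namely `T` and the transducer of the bimachine. -/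
theorem realizesFun_of_short [Finite Q] [Finite L] [Finite R] (hT : T.RealizesFun f)
    (hd : ∀ u, (f u).Dom ↔ (B.rfinal (B.leftEval u)).isSome)
    (h : ∀ u, u.length ≤ 2 * (Nat.card Q * (Nat.card L * Nat.card R)) + 1 → ∀ w w',
      T.Realizes u w → B.Realizes u w' → w = w') : B.RealizesFun f := by
  have key : ∀ {u w w'}, T.Realizes u w → B.Realizes u w' → w = w' := fun {u w w'} h1 h2 =>
    Transducer.realizes_eq_of_short (T₁ := T) (T₂ := B.toTransducer)
      (fun u hu w w' h1 h2 => h u (by rwa [Nat.card_prod] at hu) w w' h1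
        (B.toTransducer_realizes_iff.1 h2)) h1 (B.toTransducer_realizes_iff.2 h2)
  intro u w
  constructor
  · intro hw
    obtain ⟨x, y, hx, hy, -⟩ := id hw
    have hdu : (f u).Dom := (hd u).2 (by rw [hy]; rfl)
    rw [← key ((hT _ _).2 (Part.get_mem hdu)) hw]
    exact Part.get_mem hdu
  · intro hw
    have hs := (hd u).1 (Part.dom_iff_mem.2 ⟨w, hw⟩)
    obtain ⟨y, hy⟩ := Option.isSome_iff_exists.1 hs
    obtain ⟨x, hx⟩ := Option.isSome_iff_exists.1 ((B.rfinal_isSome_iff u).1 hs)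
    have hr : B.Realizes u _ := ⟨x, y, hx, hy, rfl⟩
    rwa [key ((hT _ _).2 hw) hr]

theorem finer_of_short [Finite L] [Finite R] [Finite L'] [Finite R'] {B' : Bimachine A L' R'}
    (hl : ∀ u v, u.length ≤ Nat.card L * Nat.card L' → v.length ≤ Nat.card L * Nat.card L' →
      B.leftEval u = B.leftEval v → B'.leftEval u = B'.leftEval v)
    (hr : ∀ u v, u.length ≤ Nat.card R * Nat.card R' → v.length ≤ Nat.card R * Nat.card R' →
      B.rightEval u = B.rightEval v → B'.rightEval u = B'.rightEval v) : B.Finer B' := by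
  refine ⟨fun u v e => ?_, fun u v e => ?_⟩
  · obtain ⟨u', hu, e1, e2⟩ := exists_short_foldl_eq₂ B.lstep B'.lstep B.lstart B'.lstart u
    obtain ⟨v', hv, e3, e4⟩ := exists_short_foldl_eq₂ B.lstep B'.lstep B.lstart B'.lstart v
    exact e2.symm.trans ((hl u' v' hu hv (e1.trans (e.trans e3.symm))).trans e4)
  · obtain ⟨u', hu, e1, e2⟩ :=
      exists_short_foldl_eq₂ B.rstep B'.rstep B.rstart B'.rstart u.reverse
    obtain ⟨v', hv, e3, e4⟩ :=
      exists_short_foldl_eq₂ B.rstep B'.rstep B.rstart B'.rstart v.reverse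
    have := hr u'.reverse v'.reverse (by simpa using hu) (by simpa using hv)
    simp only [rightEval, List.reverse_reverse] at this e ⊢
    exact e2.symm.trans ((this (e1.trans (e.trans e3.symm))).trans e4)

end Bimachine

/-! ### Computing with codes -/

section Lists

/-- All lists of length `n` with entries in `xs`. -/
def listsOf {α : Type} (xs : List α) (n : ℕ) : List (List α) :=
  Nat.rec [[]] (fun _ W => W.flatMap fun w => xs.map fun a => a :: w) n

theorem mem_listsOf {α : Type} {xs : List α} {n : ℕ} {w : List α} :
    w ∈ listsOf xs n ↔ w.length = n ∧ ∀ a ∈ w, a ∈ xs := by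
  induction n generalizing w with
  | zero =>
    change w ∈ [[]] ↔ _
    rw [List.mem_singleton, List.length_eq_zero_iff]
    exact ⟨fun h => by simp [h], fun h => h.1⟩
  | succ n ih =>
    change w ∈ (listsOf xs n).flatMap _ ↔ _
    simp only [List.mem_flatMap, List.mem_map, ih]
    constructor
    · rintro ⟨w, ⟨hl, hw⟩, a, ha, rfl⟩
      exact ⟨by simp [hl], by simpa [ha] using hw⟩
    · rintro ⟨hl, hw⟩
      cases w with
      | nil => simp at hl
      | cons a w =>
        exact ⟨w, ⟨by simpa using hl, fun b hb => hw b (by simp [hb])⟩, a, hw a (by simp), rfl⟩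

/-- All words of length at most `m` over the letters `0, …, k - 1`. -/
def words (k m : ℕ) : List (List ℕ) :=
  (List.range (m + 1)).flatMap fun i => listsOf (List.range k) i

theorem mem_words {k m : ℕ} {w : List ℕ} : w ∈ words k m ↔ w.length ≤ m ∧ ∀ a ∈ w, a < k := by
  simp only [words, List.mem_flatMap, List.mem_range, mem_listsOf]
  exact ⟨fun ⟨i, hi, hl, hw⟩ => ⟨by omega, hw⟩, fun ⟨hl, hw⟩ => ⟨_, by omega, rfl, hw⟩⟩

theorem wordCode_eq_map {k : ℕ} (w : List (Fin k)) : wordCode w = w.map Fin.val := by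
  induction w with
  | nil => rfl
  | cons a w ih => simpa [wordCode] using ih

theorem wordCode_cons {k : ℕ} (a : Fin k) (w : List (Fin k)) :
    wordCode (a :: w) = (a : ℕ) :: wordCode w := by
  simp [wordCode_eq_map]

theorem wordCode_injective {k : ℕ} : Function.Injective (wordCode (k := k)) := by
  rw [show wordCode (k := k) = List.map Fin.val from funext wordCode_eq_map]
  exact List.map_injective_iff.2 Fin.val_injective

theorem wordCode_append {k : ℕ} (u v : List (Fin k)) :
    wordCode (u ++ v) = wordCode u ++ wordCode v := by
  simp [wordCode_eq_map]

theorem wordCode_length {k : ℕ} (u : List (Fin k)) : (wordCode u).length = u.length := by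
  simp [wordCode_eq_map]

theorem mem_words_iff {k m : ℕ} {w : List ℕ} :
    w ∈ words k m ↔ ∃ u : List (Fin k), u.length ≤ m ∧ wordCode u = w := by
  rw [mem_words]
  constructor
  · rintro ⟨hl, hw⟩
    refine ⟨w.pmap (fun a ha => ⟨a, ha⟩) hw, by simpa using hl, ?_⟩
    simp [wordCode_eq_map, List.map_pmap]
  · rintro ⟨u, hu, rfl⟩
    simpa [wordCode_eq_map] using hu

theorem forall_mem_words {k m : ℕ} {p : List ℕ → Prop} :
    (∀ w ∈ words k m, p w) ↔ ∀ u : List (Fin k), u.length ≤ m → p (wordCode u) := by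
  simp only [mem_words_iff]
  exact ⟨fun h u hu => h _ ⟨u, hu, rfl⟩, fun h _ ⟨u, hu, e⟩ => e ▸ h u hu⟩

theorem card_le_length_words (k m : ℕ) :
    Nat.card {w : List (Fin k) // w.length ≤ m} ≤ (words k m).length := by
  classical
  let φ : {w : List (Fin k) // w.length ≤ m} → (words k m).toFinset := fun w =>
    ⟨wordCode w.1, List.mem_toFinset.2 (mem_words_iff.2 ⟨w.1, w.2, rfl⟩)⟩
  have hφ : Function.Injective φ := fun v w h =>
    Subtype.ext (wordCode_injective (congrArg Subtype.val h))
  refine (Nat.card_le_card_of_injective φ hφ).trans ?_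
  rw [Nat.card_eq_fintype_card, Fintype.card_coe]
  exact List.toFinset_card_le _

theorem getD_ofFn {α : Type} {n : ℕ} (g : Fin n → α) (i : Fin n) (d : α) :
    (List.ofFn g).getD i d = g i := by
  simp [List.getD_eq_getElem?_getD]

theorem mem_filterMap_range {α : Type} {n : ℕ} {g : ℕ → Option α} {x : α} :
    x ∈ (List.range n).filterMap g ↔ ∃ i : Fin n, g i = some x := by
  simp only [List.mem_filterMap, List.mem_range]
  exact ⟨fun ⟨i, hi, h⟩ => ⟨⟨i, hi⟩, h⟩, fun ⟨i, h⟩ => ⟨i, i.2, h⟩⟩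

theorem ofFn_mem_listsOf {α : Type} {xs : List α} {n : ℕ} {g : Fin n → α} (h : ∀ i, g i ∈ xs) :
    List.ofFn g ∈ listsOf xs n := by
  rw [mem_listsOf]
  refine ⟨List.length_ofFn, fun a ha => ?_⟩
  obtain ⟨i, rfl⟩ := List.mem_ofFn.1 ha
  exact h i

theorem exists_ofFn_of_mem_listsOf {α β : Type} {xs : List α} {n : ℕ} {w : List α} (g : β → α)
    (hw : w ∈ listsOf xs n) (h : ∀ a ∈ xs, ∃ b, g b = a) :
    ∃ φ : Fin n → β, w = List.ofFn fun i => g (φ i) := by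
  obtain ⟨rfl, hw'⟩ := mem_listsOf.1 hw
  choose φ hφ using fun i : Fin w.length => h w[i] (hw' _ (List.getElem_mem _))
  exact ⟨φ, by simp [hφ]⟩

end Lists

/-! ### Evaluating the table of a transducer -/

/-- The states that a transducer can reach over `u`, with the outputs. -/
def TransducerCode.runs (c : TransducerCode) (u : List ℕ) : List (ℕ × List ℕ) :=
  u.foldl (fun cfg a => cfg.flatMap fun s => (List.range c.2.1).filterMap fun q =>
      (((c.2.2.1.getD s.1 []).getD a []).getD q none).map fun x => (q, s.2 ++ x))
    ((List.range c.2.1).filterMap fun q => (c.2.2.2.1.getD q none).map fun x => (q, x))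

/-- The images of `u` under a transducer. -/
def TransducerCode.images (c : TransducerCode) (u : List ℕ) : List (List ℕ) :=
  (c.runs u).filterMap fun s => (c.2.2.2.2.getD s.1 none).map fun x => s.2 ++ x

namespace Transducer

variable {k n : ℕ} (T : Transducer (Fin k) (Fin n))

theorem mem_code_runs {u : List (Fin k)} {s : ℕ × List ℕ} :
    s ∈ TransducerCode.runs T.code (wordCode u) ↔
      ∃ (q : Fin n) (w : List (Fin k)), T.Reach u q w ∧ s = ((q : ℕ), wordCode w) := by
  induction u using List.reverseRecOn generalizing s with
  | nil =>
    change s ∈ (List.range n).filterMap (fun q => ((T.code.2.2.2.1).getD q none).map _) ↔ _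
    rw [mem_filterMap_range]
    refine exists_congr fun q => ?_
    rw [show T.code.2.2.2.1.getD (q : ℕ) none = _ from getD_ofFn _ _ _, Option.map_map,
      Option.map_eq_some_iff]
    constructor
    · rintro ⟨x, hx, rfl⟩
      exact ⟨x, ⟨q, x, [], hx, .nil q, by simp⟩, rfl⟩
    · rintro ⟨w, ⟨p, x, v, hx, hr, rfl⟩, rfl⟩
      obtain ⟨rfl, rfl⟩ := run_nil_iff.1 hr
      exact ⟨x, hx, by simp⟩
  | append_singleton u a ih =>
    rw [wordCode_append, TransducerCode.runs, List.foldl_append]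
    change s ∈ (TransducerCode.runs T.code (wordCode u)).flatMap _ ↔ _
    simp only [List.mem_flatMap, ih]
    constructor
    · rintro ⟨_, ⟨p, w, hw, rfl⟩, hs⟩
      obtain ⟨(q : Fin n), hq⟩ := mem_filterMap_range.1 hs
      have e : ((T.code.2.2.1.getD (p : ℕ) []).getD (a : ℕ) []).getD (q : ℕ) none =
          (T.trans p a q).map wordCode := by
        simp only [Transducer.code, getD_ofFn]
      rw [e, Option.map_map, Option.map_eq_some_iff] at hq
      obtain ⟨x, hx, rfl⟩ := hq
      exact ⟨q, w ++ x, hw.append (run_singleton hx), by simp [wordCode_append]⟩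
    · rintro ⟨q, w, hw, rfl⟩
      obtain ⟨p, w', x, hw', hx, rfl⟩ := hw.exists_of_append
      refine ⟨_, ⟨p, w', hw', rfl⟩, mem_filterMap_range.2 ⟨q, ?_⟩⟩
      have e : ((T.code.2.2.1.getD (p : ℕ) []).getD (a : ℕ) []).getD (q : ℕ) none =
          (T.trans p a q).map wordCode := by
        simp only [Transducer.code, getD_ofFn]
      rw [e, run_singleton_iff.1 hx]
      simp [wordCode_append]

theorem mem_code_images {u : List (Fin k)} {v : List ℕ} :
    v ∈ TransducerCode.images T.code (wordCode u) ↔ ∃ w, T.Realizes u w ∧ v = wordCode w := by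
  simp only [TransducerCode.images, List.mem_filterMap, mem_code_runs]
  constructor
  · rintro ⟨_, ⟨q, w, hw, rfl⟩, hs⟩
    rw [show T.code.2.2.2.2.getD (q : ℕ) none = _ from getD_ofFn _ _ _, Option.map_map,
      Option.map_eq_some_iff] at hs
    obtain ⟨y, hy, rfl⟩ := hs
    refine ⟨w ++ y, ?_, (wordCode_append _ _).symm⟩
    simpa using hw.realizes ⟨q, [], y, .nil q, hy, rfl⟩
  · rintro ⟨w, hw, rfl⟩
    rw [← List.append_nil u] at hw
    obtain ⟨q, a, b, ha, ⟨s, v, y, hr, hy, rfl⟩, rfl⟩ := hw.exists_reach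
    obtain ⟨rfl, rfl⟩ := run_nil_iff.1 hr
    refine ⟨_, ⟨q, a, ha, rfl⟩, ?_⟩
    rw [show T.code.2.2.2.2.getD (q : ℕ) none = _ from getD_ofFn _ _ _, hy]
    simp [wordCode_append]

end Transducer

/-! ### Evaluating the table of a bimachine -/

/-- The state reached by a deterministic automaton that is given by its transition table. -/
def runTable (tab : List (List ℕ)) (s : ℕ) (u : List ℕ) : ℕ :=
  u.foldl (fun s a => (tab.getD s []).getD a 0) s

theorem runTable_ofFn {k n : ℕ} (step : Fin n → Fin k → Fin n) (s : Fin n) (u : List (Fin k)) :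
    runTable (List.ofFn fun p => List.ofFn fun a => (step p a : ℕ)) s (wordCode u) =
      (u.foldl step s).val := by
  induction u generalizing s with
  | nil => rfl
  | cons a u ih =>
    rw [List.foldl_cons, ← ih]
    simp [runTable, wordCode_cons]

namespace BimachineCode

/-- The state of the left automaton after reading `u`. -/
def leftEval (b : BimachineCode) (u : List ℕ) : ℕ := runTable b.2.1.1 b.2.1.2 u

/-- The state of the right automaton after reading `u`. -/
def rightEval (b : BimachineCode) (u : List ℕ) : ℕ := runTable b.2.2.1.1 b.2.2.1.2 u.reverse

/-- The left final output on `u`. -/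
def leftFinal (b : BimachineCode) (u : List ℕ) : Option (List ℕ) :=
  b.2.2.2.2.1.getD (b.rightEval u) none

/-- The right final output on `u`. -/
def rightFinal (b : BimachineCode) (u : List ℕ) : Option (List ℕ) :=
  b.2.2.2.2.2.getD (b.leftEval u) none

/-- The output on `u`, without the final outputs. -/
def output (b : BimachineCode) (u : List ℕ) : List ℕ :=
  (List.range u.length).flatMap fun i =>
    ((b.2.2.2.1.getD (b.leftEval (u.take i)) []).getD (u.getD i 0) []).getD
      (b.rightEval (u.drop (i + 1))) []

/-- The image of `u`. -/
def image (b : BimachineCode) (u : List ℕ) : Option (List ℕ) :=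
  (b.leftFinal u).bind fun x => (b.rightFinal u).map fun y => x ++ b.output u ++ y

end BimachineCode

namespace Bimachine

variable {k l r : ℕ} (B : Bimachine (Fin k) (Fin l) (Fin r)) (u : List (Fin k))

theorem code_leftEval : BimachineCode.leftEval B.code (wordCode u) = (B.leftEval u : ℕ) :=
  runTable_ofFn B.lstep B.lstart u

theorem code_rightEval : BimachineCode.rightEval B.code (wordCode u) = (B.rightEval u : ℕ) := by
  rw [BimachineCode.rightEval, wordCode_eq_map, ← List.map_reverse, ← wordCode_eq_map]
  exact runTable_ofFn B.rstep B.rstart u.reverse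

theorem code_leftFinal : BimachineCode.leftFinal B.code (wordCode u) =
    (B.lfinal (B.rightEval u)).map wordCode := by
  rw [BimachineCode.leftFinal, code_rightEval]
  exact getD_ofFn _ _ _

theorem code_rightFinal : BimachineCode.rightFinal B.code (wordCode u) =
    (B.rfinal (B.leftEval u)).map wordCode := by
  rw [BimachineCode.rightFinal, code_leftEval]
  exact getD_ofFn _ _ _

theorem wordCode_outWord (x : List (Fin k)) :
    wordCode (B.outWord (B.leftEval x) u B.rstart) =
      (List.range (wordCode u).length).flatMap fun i =>
        ((B.code.2.2.2.1.getD (BimachineCode.leftEval B.code (wordCode x ++ (wordCode u).take i))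
          []).getD ((wordCode u).getD i 0) []).getD
            (BimachineCode.rightEval B.code ((wordCode u).drop (i + 1))) [] := by
  induction u generalizing x with
  | nil => simp [wordCode_eq_map, outWord]
  | cons a u ih =>
    have e := wordCode_cons a u
    have e' : wordCode (x ++ [a]) = wordCode x ++ [(a : ℕ)] := by simp [wordCode_eq_map]
    rw [outWord, wordCode_append, ← leftEval_append_singleton, ih, e, List.length_cons,
      List.range_succ_eq_map, List.flatMap_cons, List.flatMap_map]
    congr 1
    · simp only [List.take_zero, List.append_nil, List.getD_cons_zero, List.drop_succ_cons,
        List.drop_zero, code_leftEval, code_rightEval]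
      simp only [Bimachine.code, getD_ofFn]
      rfl
    · simp [e', List.append_assoc]

theorem code_output :
    BimachineCode.output B.code (wordCode u) = wordCode (B.outWord B.lstart u B.rstart) :=
  (B.wordCode_outWord u []).symm

theorem code_image_eq_some_iff {v : List ℕ} :
    BimachineCode.image B.code (wordCode u) = some v ↔ ∃ w, B.Realizes u w ∧ v = wordCode w := by
  simp only [BimachineCode.image, code_leftFinal, code_rightFinal, code_output,
    Option.bind_eq_some_iff, Option.map_eq_some_iff]
  constructor
  · rintro ⟨_, ⟨x, hx, rfl⟩, _, ⟨y, hy, rfl⟩, rfl⟩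
    exact ⟨_, ⟨x, y, hx, hy, rfl⟩, by simp [wordCode_append]⟩
  · rintro ⟨_, ⟨x, y, hx, hy, rfl⟩, rfl⟩
    exact ⟨_, ⟨x, hx, rfl⟩, _, ⟨y, hy, rfl⟩, by simp [wordCode_append]⟩

end Bimachine

/-! ### Enumeration of the minimal bimachines -/

namespace TransducerCode

/-- The total length of the words that occur in a transducer. -/
def size (c : TransducerCode) : ℕ :=
  ((c.2.2.1.flatten.flatten ++ c.2.2.2.1 ++ c.2.2.2.2).filterMap fun o => o).flatten.length

/-- A bound on the number of accessible states of the automata of a minimal bimachine, namely on the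
number of profiles of prefixes. -/
def stateBound (c : TransducerCode) : ℕ :=
  2 ^ (c.2.1 * (c.2.1 * ((words c.1 ((c.2.1 * c.2.1 + 1) * c.size)).length *
    (words c.1 ((c.2.1 * c.2.1 + 1) * c.size)).length)))

/-- A bound on the length of the words that occur in a minimal bimachine. -/
def outputBound (c : TransducerCode) : ℕ := (c.stateBound + c.stateBound + 3) * c.size

/-- A length of words that suffices for all tests: the four summands serve to compare the domains, to
compare the images, to test which one of two bimachines is finer, and to test functionality. -/
def wordBound (c : TransducerCode) : ℕ :=
  2 ^ c.2.1 * c.stateBound + (2 * (c.2.1 * (c.stateBound * c.stateBound)) + 1) +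
    c.stateBound * c.stateBound + (2 * (c.2.1 * c.2.1) + 1)

/-- Test whether a transducer is functional. -/
def isFunctional (c : TransducerCode) : Bool :=
  (words c.1 c.wordBound).all fun u => (c.images u).all fun w => (c.images u).all fun w' => w == w'

end TransducerCode

/-- All tables of bimachines with `k` letters, at most `N` states in both automata and words of length
at most `m`. -/
def bimachineCandidates (k N m : ℕ) : List BimachineCode :=
  (List.range (N + 1)).flatMap fun l => (List.range (N + 1)).flatMap fun r =>
  (listsOf (listsOf (List.range l) k) l).flatMap fun ltab => (List.range l).flatMap fun l₀ =>
  (listsOf (listsOf (List.range r) k) r).flatMap fun rtab => (List.range r).flatMap fun r₀ =>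
  (listsOf (listsOf (listsOf (words k m) r) k) l).flatMap fun out =>
  (listsOf (none :: (words k m).map some) r).flatMap fun lf =>
  (listsOf (none :: (words k m).map some) l).map fun rf =>
    ((k, l, r), (ltab, l₀), (rtab, r₀), out, lf, rf)

namespace TransducerCode

/-- Test whether a table is that of an accessible bimachine that is equivalent to the transducer. -/
def isGood (c : TransducerCode) (b : BimachineCode) : Bool :=
  ((words c.1 c.wordBound).all fun u => ((b.leftFinal u).isSome == (b.rightFinal u).isSome) &&
    ((b.rightFinal u).isSome == !(c.images u).isEmpty) &&
    (c.images u).all fun w => b.image u == some w) &&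
  ((List.range b.1.2.1).all fun s => (words c.1 c.wordBound).any fun u => b.leftEval u == s) &&
  (List.range b.1.2.2).all fun s => (words c.1 c.wordBound).any fun u => b.rightEval u == s

/-- Test whether a bimachine is finer than another one. -/
def isFiner (c : TransducerCode) (b b' : BimachineCode) : Bool :=
  (words c.1 c.wordBound).all fun u => (words c.1 c.wordBound).all fun v =>
    (!(b.leftEval u == b.leftEval v) || b'.leftEval u == b'.leftEval v) &&
    (!(b.rightEval u == b.rightEval v) || b'.rightEval u == b'.rightEval v)

/-- The accessible bimachines of bounded size that are equivalent to the transducer. -/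
def bimachines (c : TransducerCode) : List BimachineCode :=
  (bimachineCandidates c.1 c.stateBound c.outputBound).filter fun b => c.isGood b

/-- The minimal ones among the accessible bimachines of bounded size. -/
def minimalBimachines (c : TransducerCode) : List BimachineCode :=
  c.bimachines.filter fun b => c.bimachines.all fun b' => !(c.isFiner b b') || c.isFiner b' b

end TransducerCode

theorem mem_optionWords_iff {k m : ℕ} {o : Option (List ℕ)} :
    o ∈ none :: (words k m).map some ↔
      ∃ p : Option (List (Fin k)), (∀ x, p = some x → x.length ≤ m) ∧ p.map wordCode = o := by
  simp only [List.mem_cons, List.mem_map, mem_words_iff]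
  constructor
  · rintro (rfl | ⟨_, ⟨u, hu, rfl⟩, rfl⟩)
    · exact ⟨none, by simp, rfl⟩
    · exact ⟨some u, by simpa using hu, rfl⟩
  · rintro ⟨_ | u, hu, rfl⟩
    · exact Or.inl rfl
    · exact Or.inr ⟨_, ⟨u, hu u rfl, rfl⟩, rfl⟩

theorem Bimachine.code_mem_bimachineCandidates {k l r N m : ℕ}
    {B : Bimachine (Fin k) (Fin l) (Fin r)} (hl : l ≤ N) (hr : r ≤ N) (hm : B.OutputsLE m) :
    B.code ∈ bimachineCandidates k N m := by
  simp only [bimachineCandidates, List.mem_flatMap, List.mem_map, List.mem_range]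
  refine ⟨l, by omega, r, by omega, _, ?_, _, B.lstart.2, _, ?_, _, B.rstart.2, _, ?_, _, ?_, _, ?_,
    rfl⟩
  · exact ofFn_mem_listsOf fun p => ofFn_mem_listsOf fun a => List.mem_range.2 (B.lstep p a).2
  · exact ofFn_mem_listsOf fun p => ofFn_mem_listsOf fun a => List.mem_range.2 (B.rstep p a).2
  · exact ofFn_mem_listsOf fun p => ofFn_mem_listsOf fun a => ofFn_mem_listsOf fun q =>
      mem_words_iff.2 ⟨_, hm.out p a q, rfl⟩
  · exact ofFn_mem_listsOf fun q => mem_optionWords_iff.2 ⟨_, hm.lfinal q, rfl⟩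
  · exact ofFn_mem_listsOf fun q => mem_optionWords_iff.2 ⟨_, hm.rfinal q, rfl⟩

/-- A candidate is the table of a bimachine, except that the two automata need not recognize the same
language. -/
theorem exists_of_mem_bimachineCandidates {k N m : ℕ} {b : BimachineCode}
    (hb : b ∈ bimachineCandidates k N m) : ∃ l r : ℕ, l ≤ N ∧ r ≤ N ∧
      ∃ (lstep : Fin l → Fin k → Fin l) (lstart : Fin l) (rstep : Fin r → Fin k → Fin r)
        (rstart : Fin r) (out : Fin l → Fin k → Fin r → List (Fin k))
        (lfinal : Fin r → Option (List (Fin k))) (rfinal : Fin l → Option (List (Fin k))),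
        b = ((k, l, r),
          (List.ofFn fun p => List.ofFn fun a => (lstep p a : ℕ), (lstart : ℕ)),
          (List.ofFn fun q => List.ofFn fun a => (rstep q a : ℕ), (rstart : ℕ)),
          List.ofFn (fun p => List.ofFn fun a => List.ofFn fun q => wordCode (out p a q)),
          List.ofFn (fun q => (lfinal q).map wordCode),
          List.ofFn fun p => (rfinal p).map wordCode) := by
  simp only [bimachineCandidates, List.mem_flatMap, List.mem_map, List.mem_range] at hb
  obtain ⟨l, hl, r, hr, ltab, hltab, l₀, hl₀, rtab, hrtab, r₀, hr₀, out, hout, lf, hlf, rf, hrf,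
    rfl⟩ := hb
  have hrange : ∀ n, ∀ a ∈ List.range n, ∃ i : Fin n, (i : ℕ) = a := fun n a ha =>
    ⟨⟨a, List.mem_range.1 ha⟩, rfl⟩
  have htab : ∀ n, ∀ w ∈ listsOf (List.range n) k, ∃ g : Fin k → Fin n,
      (List.ofFn fun a => (g a : ℕ)) = w := fun n w hw => by
    obtain ⟨g, hg⟩ := exists_ofFn_of_mem_listsOf (fun i : Fin n => (i : ℕ)) hw (hrange n)
    exact ⟨g, hg.symm⟩
  obtain ⟨lstep, rfl⟩ := exists_ofFn_of_mem_listsOf _ hltab (htab l)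
  obtain ⟨rstep, rfl⟩ := exists_ofFn_of_mem_listsOf _ hrtab (htab r)
  have hwords : ∀ w ∈ words k m, ∃ u : List (Fin k), wordCode u = w := fun w hw =>
    (mem_words_iff.1 hw).imp fun _ h => h.2
  have hout₁ : ∀ w ∈ listsOf (words k m) r, ∃ g : Fin r → List (Fin k),
      (List.ofFn fun q => wordCode (g q)) = w := fun w hw => by
    obtain ⟨g, hg⟩ := exists_ofFn_of_mem_listsOf _ hw hwords
    exact ⟨g, hg.symm⟩
  have hout₂ : ∀ w ∈ listsOf (listsOf (words k m) r) k, ∃ g : Fin k → Fin r → List (Fin k),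
      (List.ofFn fun a => List.ofFn fun q => wordCode (g a q)) = w := fun w hw => by
    obtain ⟨g, hg⟩ := exists_ofFn_of_mem_listsOf _ hw hout₁
    exact ⟨g, hg.symm⟩
  obtain ⟨out, rfl⟩ := exists_ofFn_of_mem_listsOf _ hout hout₂
  have hopt : ∀ o ∈ none :: (words k m).map some, ∃ p : Option (List (Fin k)),
      p.map wordCode = o := fun o ho => (mem_optionWords_iff.1 ho).imp fun _ h => h.2
  obtain ⟨lf, rfl⟩ := exists_ofFn_of_mem_listsOf _ hlf hopt
  obtain ⟨rf, rfl⟩ := exists_ofFn_of_mem_listsOf _ hrf hopt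
  exact ⟨l, r, by omega, by omega, lstep, ⟨l₀, hl₀⟩, rstep, ⟨r₀, hr₀⟩, out, lf, rf, rfl⟩

/-! ### Correctness of the enumeration -/

namespace Transducer

variable {k n : ℕ} {T : Transducer (Fin k) (Fin n)} {f : List (Fin k) →. List (Fin k)}

theorem outputsLE_size (T : Transducer (Fin k) (Fin n)) :
    T.OutputsLE (TransducerCode.size T.code) := by
  have key : ∀ x : List (Fin k), some (wordCode x) ∈ T.code.2.2.1.flatten.flatten ++
      T.code.2.2.2.1 ++ T.code.2.2.2.2 → x.length ≤ TransducerCode.size T.code := by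
    intro x hx
    rw [← wordCode_length]
    exact (List.sublist_flatten_of_mem (List.mem_filterMap.2 ⟨_, hx, rfl⟩)).length_le
  refine ⟨fun p a q x hx => key x ?_, fun q x hx => key x ?_, fun q x hx => key x ?_⟩
  · refine List.mem_append_left _ (List.mem_append_left _ ?_)
    simp only [Transducer.code, List.mem_flatten, List.mem_ofFn]
    exact ⟨_, ⟨_, ⟨p, rfl⟩, List.mem_ofFn.2 ⟨a, rfl⟩⟩, List.mem_ofFn.2 ⟨q, by rw [hx]; rfl⟩⟩
  · exact List.mem_append_left _ (List.mem_append_right _ (List.mem_ofFn.2 ⟨q, by rw [hx]; rfl⟩))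
  · exact List.mem_append_right _ (List.mem_ofFn.2 ⟨q, by rw [hx]; rfl⟩)

theorem isFunctional_code_iff :
    TransducerCode.isFunctional T.code = true ↔ T.IsFunctional := by
  simp only [TransducerCode.isFunctional, List.all_eq_true, beq_iff_eq]
  rw [show T.code.1 = k from rfl, forall_mem_words]
  simp only [mem_code_images, forall_exists_index, and_imp]
  constructor
  · intro h
    rw [isFunctional_iff_of_short]
    intro u hu w w' hw hw'
    refine wordCode_injective (h u (hu.trans ?_) _ w hw rfl _ w' hw' rfl)
    rw [Nat.card_fin, TransducerCode.wordBound, show T.code.2.1 = n from rfl]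
    omega
  · rintro ⟨f, hf⟩ u - _ w hw rfl _ w' hw' rfl
    rw [Part.mem_unique ((hf u w).1 hw) ((hf u w').1 hw')]

theorem code_images_isEmpty (hT : T.RealizesFun f) {u : List (Fin k)} :
    (TransducerCode.images T.code (wordCode u)).isEmpty = false ↔ (f u).Dom := by
  rw [← Bool.not_eq_true, List.isEmpty_iff, List.eq_nil_iff_forall_not_mem, not_forall_not,
    Part.dom_iff_mem]
  simp only [mem_code_images, hT u _]
  exact ⟨fun ⟨_, w, hw, _⟩ => ⟨w, hw⟩, fun ⟨w, hw⟩ => ⟨_, w, hw, rfl⟩⟩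

theorem exists_of_mem_bimachines (hT : T.RealizesFun f) {b : BimachineCode}
    (hb : b ∈ TransducerCode.bimachines T.code) :
    ∃ B : FinBimachine k, b = B.toBimachine.code ∧ B.l ≤ TransducerCode.stateBound T.code ∧
      B.r ≤ TransducerCode.stateBound T.code ∧ B.toBimachine.Accessible ∧
      B.toBimachine.RealizesFun f := by
  obtain ⟨hc, hg⟩ := List.mem_filter.1 hb
  obtain ⟨l, r, hl, hr, lstep, lstart, rstep, rstart, out, lfinal, rfinal, rfl⟩ :=
    exists_of_mem_bimachineCandidates (k := k) hc
  simp only [TransducerCode.isGood, Bool.and_eq_true, List.all_eq_true, List.any_eq_true,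
    beq_iff_eq] at hg
  obtain ⟨⟨hg, hgl⟩, hgr⟩ := hg
  rw [show T.code.1 = k from rfl] at hg hgl hgr
  rw [forall_mem_words] at hg
  have hll := Nat.mul_le_mul_left (2 ^ n) hl
  have hrr := Nat.mul_le_mul_left (2 ^ n) hr
  have hlr := Nat.mul_le_mul_left n (Nat.mul_le_mul hl hr)
  have hwb : TransducerCode.wordBound T.code = 2 ^ n * TransducerCode.stateBound T.code +
    (2 * (n * (TransducerCode.stateBound T.code * TransducerCode.stateBound T.code)) + 1) +
    TransducerCode.stateBound T.code * TransducerCode.stateBound T.code +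
    (2 * (n * n) + 1) := rfl
  -- the two automata recognize the domain, which is checked on short words
  have hleft := hT.dom_iff_foldl_of_short lstep lstart (fun p => (rfinal p).isSome) (by
    intro u hu
    obtain ⟨⟨-, h2⟩, -⟩ := hg u (hu.trans (by rw [Nat.card_fin, Nat.card_fin]; omega))
    rw [BimachineCode.rightFinal, BimachineCode.leftEval, runTable_ofFn, getD_ofFn,
      Option.isSome_map] at h2
    rw [← code_images_isEmpty hT, h2, Bool.not_eq_true'])
  have hright := hT.dom_iff_foldl_reverse_of_short rstep rstart (fun p => (lfinal p).isSome) (by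
    intro u hu
    obtain ⟨⟨h1, h2⟩, -⟩ := hg u (hu.trans (by rw [Nat.card_fin, Nat.card_fin]; omega))
    rw [← h1, BimachineCode.leftFinal, BimachineCode.rightEval, wordCode_eq_map,
      ← List.map_reverse, ← wordCode_eq_map, runTable_ofFn, getD_ofFn,
      Option.isSome_map] at h2
    rw [← code_images_isEmpty hT, h2, Bool.not_eq_true', wordCode_eq_map])
  let B : Bimachine (Fin k) (Fin l) (Fin r) :=
    { lstep, lstart, rstep, rstart, out, lfinal, rfinal
      same_language := fun u => (hleft u).symm.trans (hright u) }
  refine ⟨⟨l, r, B⟩, rfl, hl, hr, ⟨fun s => ?_, fun s => ?_⟩,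
    Bimachine.realizesFun_of_short hT hleft fun u hu w w' hw hw' => ?_⟩
  · obtain ⟨_, hw, hu⟩ := hgl s (List.mem_range.2 s.2)
    obtain ⟨u, -, rfl⟩ := mem_words_iff.1 hw
    exact ⟨u, Fin.ext ((B.code_leftEval u).symm.trans hu)⟩
  · obtain ⟨_, hw, hu⟩ := hgr s (List.mem_range.2 s.2)
    obtain ⟨u, -, rfl⟩ := mem_words_iff.1 hw
    exact ⟨u, Fin.ext ((B.code_rightEval u).symm.trans hu)⟩
  · simp only [Nat.card_fin] at hu
    obtain ⟨-, h3⟩ := hg u (by omega)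
    obtain ⟨w'', hw'', e⟩ := (B.code_image_eq_some_iff u).1
      (h3 _ (T.mem_code_images.2 ⟨w, hw, rfl⟩))
    obtain ⟨x, y, hx, hy, rfl⟩ := hw'
    obtain ⟨x', y', hx', hy', rfl⟩ := hw''
    obtain rfl := Option.some.inj (hx.symm.trans hx')
    obtain rfl := Option.some.inj (hy.symm.trans hy')
    exact wordCode_injective e

theorem code_mem_bimachines (hT : T.RealizesFun f) {l r : ℕ}
    {B : Bimachine (Fin k) (Fin l) (Fin r)} (hl : l ≤ TransducerCode.stateBound T.code)
    (hr : r ≤ TransducerCode.stateBound T.code)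
    (hm : B.OutputsLE (TransducerCode.outputBound T.code)) (hacc : B.Accessible)
    (hB : B.RealizesFun f) : B.code ∈ TransducerCode.bimachines T.code := by
  refine List.mem_filter.2 ⟨Bimachine.code_mem_bimachineCandidates hl hr hm, ?_⟩
  have hle : TransducerCode.stateBound T.code ≤ TransducerCode.wordBound T.code := by
    have : TransducerCode.stateBound T.code ≤
      TransducerCode.stateBound T.code * TransducerCode.stateBound T.code := Nat.le_mul_self _
    rw [TransducerCode.wordBound]
    omega
  simp only [TransducerCode.isGood, Bool.and_eq_true, List.all_eq_true, List.any_eq_true,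
    beq_iff_eq]
  rw [show T.code.1 = k from rfl, forall_mem_words]
  refine ⟨⟨fun u _ => ⟨⟨?_, ?_⟩, ?_⟩, fun s hs => ?_⟩, fun s hs => ?_⟩
  · rw [B.code_leftFinal, B.code_rightFinal, Option.isSome_map, Option.isSome_map, Bool.eq_iff_iff]
    exact (B.rfinal_isSome_iff u).symm
  · rw [B.code_rightFinal, Option.isSome_map, Bool.eq_iff_iff, ← hB.dom_iff_left,
      ← code_images_isEmpty hT]
    simp
  · intro v hv
    obtain ⟨w, hw, rfl⟩ := T.mem_code_images.1 hv
    exact (B.code_image_eq_some_iff u).2 ⟨w, (hB u w).2 ((hT u w).1 hw), rfl⟩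
  · obtain ⟨u, hu⟩ := hacc.left ⟨s, List.mem_range.1 hs⟩
    obtain ⟨v, hv, e⟩ := B.exists_short_leftEval u
    rw [Nat.card_fin] at hv
    exact ⟨_, mem_words_iff.2 ⟨v, by omega, rfl⟩, by rw [B.code_leftEval, e, hu]⟩
  · obtain ⟨u, hu⟩ := hacc.right ⟨s, List.mem_range.1 hs⟩
    obtain ⟨v, hv, e⟩ := B.exists_short_rightEval u
    rw [Nat.card_fin] at hv
    exact ⟨_, mem_words_iff.2 ⟨v, by omega, rfl⟩, by rw [B.code_rightEval, e, hu]⟩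

theorem isFiner_code_iff (T : Transducer (Fin k) (Fin n)) {l r l' r' : ℕ}
    {B : Bimachine (Fin k) (Fin l) (Fin r)} {B' : Bimachine (Fin k) (Fin l') (Fin r')}
    (hl : l ≤ TransducerCode.stateBound T.code) (hr : r ≤ TransducerCode.stateBound T.code)
    (hl' : l' ≤ TransducerCode.stateBound T.code) (hr' : r' ≤ TransducerCode.stateBound T.code) :
    TransducerCode.isFiner T.code B.code B'.code = true ↔ B.Finer B' := by
  simp only [TransducerCode.isFiner, List.all_eq_true]
  rw [show T.code.1 = k from rfl, forall_mem_words]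
  simp only [forall_mem_words, Bool.and_eq_true, Bool.or_eq_true, Bool.not_eq_true', beq_iff_eq,
    beq_eq_false_iff_ne, Bimachine.code_leftEval, Bimachine.code_rightEval, Fin.val_inj,
    ← imp_iff_not_or, ne_eq]
  constructor
  · intro h
    have h1 := Nat.mul_le_mul hl hl'
    have h2 := Nat.mul_le_mul hr hr'
    have hwb : TransducerCode.stateBound T.code * TransducerCode.stateBound T.code ≤
        TransducerCode.wordBound T.code := by
      rw [TransducerCode.wordBound]; omega
    exact Bimachine.finer_of_short
      (fun u v hu hv => by
        rw [Nat.card_fin, Nat.card_fin] at hu hv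
        exact (h u (by omega) v (by omega)).1)
      (fun u v hu hv => by
        rw [Nat.card_fin, Nat.card_fin] at hu hv
        exact (h u (by omega) v (by omega)).2)
  · exact fun h u _ v _ => ⟨h.1 u v, h.2 u v⟩

/-- Every bimachine with few accessible states is equivalent to one in the list. -/
theorem exists_code_mem_bimachines (hT : T.RealizesFun f) {L R : Type} [Finite L] [Finite R]
    {B : Bimachine (Fin k) L R} (hB : B.RealizesFun f)
    (hl : Nat.card (Set.range B.leftEval) ≤ TransducerCode.stateBound T.code)
    (hr : Nat.card (Set.range B.rightEval) ≤ TransducerCode.stateBound T.code) :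
    ∃ B' : FinBimachine k, B'.l ≤ TransducerCode.stateBound T.code ∧
      B'.r ≤ TransducerCode.stateBound T.code ∧
      B'.toBimachine.code ∈ TransducerCode.bimachines T.code ∧ B'.toBimachine.RealizesFun f ∧
      B.Finer B'.toBimachine ∧ B'.toBimachine.Finer B := by
  obtain ⟨B', hB', hacc, h1, h2, hm⟩ := hB.exists_normal hT T.outputsLE_size
  refine ⟨⟨_, _, B'⟩, hl, hr, code_mem_bimachines hT hl hr ?_ hacc hB', hB', h1, h2⟩
  have hle : (Nat.card (Set.range B.leftEval) + Nat.card (Set.range B.rightEval) + 3) *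
      TransducerCode.size T.code ≤ TransducerCode.outputBound T.code :=
    Nat.mul_le_mul_right _ (by omega)
  exact ⟨fun p a q => (hm.out p a q).trans hle, fun q x hx => (hm.lfinal q x hx).trans hle,
    fun q x hx => (hm.rfinal q x hx).trans hle⟩

/-- It suffices to test minimality within the list, because a bimachine that is coarser than one in
the list has few accessible states. -/
theorem exists_of_mem_minimalBimachines (hT : T.RealizesFun f) {b : BimachineCode}
    (hb : b ∈ TransducerCode.minimalBimachines T.code) :
    ∃ B : FinBimachine k, b = B.toBimachine.code ∧ B.toBimachine.Accessible ∧
      B.toBimachine.IsMinimalFor f := by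
  obtain ⟨hb, hmin⟩ := List.mem_filter.1 hb
  obtain ⟨B, rfl, hl, hr, hacc, hB⟩ := exists_of_mem_bimachines hT hb
  refine ⟨B, rfl, hacc, hB, fun L' R' _ _ B' hB' hfin => ?_⟩
  have h1 : Nat.card (Set.range B'.leftEval) ≤ B.l := by
    refine (Nat.card_range_le_of_ker_le hfin.1).1.trans ?_
    exact (Finite.card_subtype_le _).trans_eq (Nat.card_fin _)
  have h2 : Nat.card (Set.range B'.rightEval) ≤ B.r := by
    refine (Nat.card_range_le_of_ker_le hfin.2).1.trans ?_
    exact (Finite.card_subtype_le _).trans_eq (Nat.card_fin _)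
  obtain ⟨B'', hl'', hr'', hmem, -, h3, h4⟩ :=
    exists_code_mem_bimachines hT hB' (h1.trans hl) (h2.trans hr)
  have := List.all_eq_true.1 hmin _ hmem
  rw [Bool.or_eq_true, Bool.not_eq_true', ← Bool.not_eq_true, isFiner_code_iff T hl hr hl'' hr'',
    isFiner_code_iff T hl'' hr'' hl hr, ← imp_iff_not_or] at this
  exact h3.trans (this (hfin.trans h3))

theorem exists_code_mem_minimalBimachines (hT : T.RealizesFun f) {L R : Type} [Finite L] [Finite R]
    {B : Bimachine (Fin k) L R} (hB : B.IsMinimalFor f) :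
    ∃ B' : FinBimachine k, B'.toBimachine.code ∈ TransducerCode.minimalBimachines T.code ∧
      B.Finer B'.toBimachine ∧ B'.toBimachine.Finer B := by
  have hbound : 2 ^ (Nat.card (Fin n) * (Nat.card (Fin n) *
      (Nat.card {w : List (Fin k) // w.length ≤ (n * n + 1) * TransducerCode.size T.code} *
        Nat.card {w : List (Fin k) // w.length ≤ (n * n + 1) * TransducerCode.size T.code}))) ≤
      TransducerCode.stateBound T.code := by
    have := card_le_length_words k ((n * n + 1) * TransducerCode.size T.code)
    rw [Nat.card_fin]
    exact Nat.pow_le_pow_right (by norm_num) (Nat.mul_le_mul_left _ (Nat.mul_le_mul_left _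
      (Nat.mul_le_mul this this)))
  have hK : (Nat.card (Fin n) * Nat.card (Fin n) + 1) * TransducerCode.size T.code ≤
      (n * n + 1) * TransducerCode.size T.code := by simp
  obtain ⟨B', hl, hr, hmem, hB', h1, h2⟩ := exists_code_mem_bimachines hT hB.1
    ((hB.card_left_le hT T.outputsLE_size hK).trans hbound)
    ((hB.card_right_le hT T.outputsLE_size hK).trans hbound)
  refine ⟨B', List.mem_filter.2 ⟨hmem, List.all_eq_true.2 fun b'' hb'' => ?_⟩, h1, h2⟩
  obtain ⟨B'', rfl, hl'', hr'', -, hB''⟩ := exists_of_mem_bimachines hT hb''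
  rw [Bool.or_eq_true, Bool.not_eq_true', ← Bool.not_eq_true, isFiner_code_iff T hl hr hl'' hr'',
    isFiner_code_iff T hl'' hr'' hl hr, ← imp_iff_not_or]
  exact fun h => (hB.2 _ _ _ hB'' (h1.trans h)).trans h1

/-- Bimachines with the same table are equivalent. -/
theorem _root_.Bimachine.finer_of_code_eq {l r l' r' : ℕ} {B : Bimachine (Fin k) (Fin l) (Fin r)}
    {B' : Bimachine (Fin k) (Fin l') (Fin r')} (h : B.code = B'.code) : B.Finer B' := by
  refine ⟨fun u v e => Fin.ext ?_, fun u v e => Fin.ext ?_⟩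
  · rw [← B'.code_leftEval, ← B'.code_leftEval, ← h, B.code_leftEval, B.code_leftEval, e]
  · rw [← B'.code_rightEval, ← B'.code_rightEval, ← h, B.code_rightEval, B.code_rightEval, e]

/-- The list of minimal bimachines, as mathematical objects. -/
theorem minimalBimachines_eq_map (hT : T.RealizesFun f) : ∃ Bs : List (FinBimachine k),
    TransducerCode.minimalBimachines T.code = Bs.map (fun B => B.toBimachine.code) ∧
    (∀ B ∈ Bs, B.toBimachine.Accessible ∧ B.toBimachine.IsMinimalFor f) ∧
    ∀ (L R : Type) [Finite L] [Finite R] (B : Bimachine (Fin k) L R), B.IsMinimalFor f →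
      ∃ B' ∈ Bs, B.Finer B'.toBimachine ∧ B'.toBimachine.Finer B := by
  have key : ∀ bs : List BimachineCode, (∀ b ∈ bs, ∃ B : FinBimachine k,
      b = B.toBimachine.code ∧ B.toBimachine.Accessible ∧ B.toBimachine.IsMinimalFor f) →
      ∃ Bs : List (FinBimachine k), bs = Bs.map (fun B => B.toBimachine.code) ∧
        ∀ B ∈ Bs, B.toBimachine.Accessible ∧ B.toBimachine.IsMinimalFor f := by
    intro bs
    induction bs with
    | nil => exact fun _ => ⟨[], rfl, by simp⟩
    | cons b bs ih =>
      intro h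
      obtain ⟨B, rfl, hB⟩ := h b (by simp)
      obtain ⟨Bs, rfl, hBs⟩ := ih fun b' hb' => h b' (by simp [hb'])
      exact ⟨B :: Bs, rfl, by simpa using ⟨hB, hBs⟩⟩
  obtain ⟨Bs, hBs, hmin⟩ := key _ fun b hb => exists_of_mem_minimalBimachines hT hb
  refine ⟨Bs, hBs, hmin, fun L R _ _ B hB => ?_⟩
  obtain ⟨B', hmem, h1, h2⟩ := exists_code_mem_minimalBimachines hT hB
  rw [hBs, List.mem_map] at hmem
  obtain ⟨B'', hB'', e⟩ := hmem
  exact ⟨B'', hB'', h1.trans (Bimachine.finer_of_code_eq e.symm),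
    (Bimachine.finer_of_code_eq e).trans h2⟩

end Transducer

/-! ### Primitive recursion -/

attribute [fun_prop] Primrec

namespace Primrec

section Compositional

/-! The closure properties of primitive recursive functions, in the form in which `fun_prop` can use
them. -/

variable {α β γ σ : Type} [Primcodable α] [Primcodable β] [Primcodable γ] [Primcodable σ]

@[fun_prop]
theorem id_fun : Primrec fun x : α => x := Primrec.id

@[fun_prop]
theorem const_fun (b : β) : Primrec fun _ : α => b := Primrec.const b

@[fun_prop]
theorem comp_fun {f : β → γ} {g : α → β} (hf : Primrec f) (hg : Primrec g) :
    Primrec fun x => f (g x) := hf.comp hg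

@[fun_prop]
theorem fst_fun {f : α → β × γ} (hf : Primrec f) : Primrec fun x => (f x).1 := Primrec.fst.comp hf

@[fun_prop]
theorem snd_fun {f : α → β × γ} (hf : Primrec f) : Primrec fun x => (f x).2 := Primrec.snd.comp hf

@[fun_prop]
theorem prodMk_fun {f : α → β} {g : α → γ} (hf : Primrec f) (hg : Primrec g) :
    Primrec fun x => (f x, g x) := hf.pair hg

@[fun_prop]
theorem add_fun {f g : α → ℕ} (hf : Primrec f) (hg : Primrec g) : Primrec fun x => f x + g x :=
  Primrec.nat_add.comp hf hg

@[fun_prop]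
theorem mul_fun {f g : α → ℕ} (hf : Primrec f) (hg : Primrec g) : Primrec fun x => f x * g x :=
  Primrec.nat_mul.comp hf hg

@[fun_prop]
theorem pow_fun {f g : α → ℕ} (hf : Primrec f) (hg : Primrec g) : Primrec fun x => f x ^ g x :=
  (Primrec₂.unpaired'.1 Nat.Primrec.pow).comp hf hg

@[fun_prop]
theorem not_fun {f : α → Bool} (hf : Primrec f) : Primrec fun x => !f x := Primrec.not.comp hf

@[fun_prop]
theorem and_fun {f g : α → Bool} (hf : Primrec f) (hg : Primrec g) : Primrec fun x => f x && g x :=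
  Primrec.and.comp hf hg

@[fun_prop]
theorem or_fun {f g : α → Bool} (hf : Primrec f) (hg : Primrec g) : Primrec fun x => f x || g x :=
  Primrec.or.comp hf hg

@[fun_prop]
theorem beq_fun [DecidableEq β] [BEq β] [LawfulBEq β] {f g : α → β} (hf : Primrec f)
    (hg : Primrec g) : Primrec fun x => f x == g x :=
  ((Primrec.eq (α := β)).decide.comp hf hg).of_eq fun x => by
    rw [Bool.eq_iff_iff]; simp

@[fun_prop]
theorem cond_fun {c : α → Bool} {f g : α → β} (hc : Primrec c) (hf : Primrec f) (hg : Primrec g) :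
    Primrec fun x => bif c x then f x else g x := Primrec.cond hc hf hg

@[fun_prop]
theorem optionSome_fun {f : α → β} (hf : Primrec f) : Primrec fun x => some (f x) :=
  Primrec.option_some.comp hf

@[fun_prop]
theorem optionIsSome_fun {f : α → Option β} (hf : Primrec f) : Primrec fun x => (f x).isSome :=
  Primrec.option_isSome.comp hf

@[fun_prop]
theorem optionMap_fun {f : α → Option β} {g : α → β → γ} (hf : Primrec f)
    (hg : Primrec fun p : α × β => g p.1 p.2) : Primrec fun x => (f x).map (g x) :=
  Primrec.option_map hf hg.to₂

@[fun_prop]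
theorem optionBind_fun {f : α → Option β} {g : α → β → Option γ} (hf : Primrec f)
    (hg : Primrec fun p : α × β => g p.1 p.2) : Primrec fun x => (f x).bind (g x) :=
  Primrec.option_bind hf hg.to₂

@[fun_prop]
theorem listCons_fun {f : α → β} {g : α → List β} (hf : Primrec f) (hg : Primrec g) :
    Primrec fun x => f x :: g x := Primrec.list_cons.comp hf hg

@[fun_prop]
theorem listAppend_fun {f g : α → List β} (hf : Primrec f) (hg : Primrec g) :
    Primrec fun x => f x ++ g x := Primrec.list_append.comp hf hg

@[fun_prop]
theorem listRange_fun {f : α → ℕ} (hf : Primrec f) : Primrec fun x => List.range (f x) :=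
  Primrec.list_range.comp hf

@[fun_prop]
theorem listLength_fun {f : α → List β} (hf : Primrec f) : Primrec fun x => (f x).length :=
  Primrec.list_length.comp hf

@[fun_prop]
theorem listReverse_fun {f : α → List β} (hf : Primrec f) : Primrec fun x => (f x).reverse :=
  Primrec.list_reverse.comp hf

@[fun_prop]
theorem listFlatten_fun {f : α → List (List β)} (hf : Primrec f) :
    Primrec fun x => (f x).flatten := Primrec.list_flatten.comp hf

@[fun_prop]
theorem listTake_fun {f : α → ℕ} {g : α → List β} (hf : Primrec f) (hg : Primrec g) :
    Primrec fun x => (g x).take (f x) := Primrec.list_take.comp hf hg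

@[fun_prop]
theorem listDrop_fun {f : α → ℕ} {g : α → List β} (hf : Primrec f) (hg : Primrec g) :
    Primrec fun x => (g x).drop (f x) := Primrec.list_drop.comp hf hg

@[fun_prop]
theorem listGetD_fun {f : α → ℕ} {g : α → List β} (d : β) (hf : Primrec f) (hg : Primrec g) :
    Primrec fun x => (g x).getD (f x) d := (Primrec.list_getD d).comp hg hf

@[fun_prop]
theorem listIdxOf_fun [DecidableEq β] [i : BEq β] [LawfulBEq β] {f : α → β} {g : α → List β}
    (hf : Primrec f) (hg : Primrec g) : Primrec fun x => (g x).idxOf (f x) := by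
  obtain rfl : i = instBEqOfDecidableEq := lawful_beq_subsingleton _ _
  exact Primrec.list_idxOf.comp hf hg

@[fun_prop]
theorem listMap_fun {f : α → List β} {g : α → β → γ} (hf : Primrec f)
    (hg : Primrec fun p : α × β => g p.1 p.2) : Primrec fun x => (f x).map (g x) :=
  Primrec.list_map hf hg.to₂

@[fun_prop]
theorem listFlatMap_fun {f : α → List β} {g : α → β → List γ} (hf : Primrec f)
    (hg : Primrec fun p : α × β => g p.1 p.2) : Primrec fun x => (f x).flatMap (g x) :=
  Primrec.list_flatMap hf hg.to₂

@[fun_prop]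
theorem listFilterMap_fun {f : α → List β} {g : α → β → Option γ} (hf : Primrec f)
    (hg : Primrec fun p : α × β => g p.1 p.2) : Primrec fun x => (f x).filterMap (g x) :=
  Primrec.listFilterMap hf hg.to₂

@[fun_prop]
theorem listFoldl_fun {f : α → List β} {g : α → σ} {h : α → σ → β → σ} (hf : Primrec f)
    (hg : Primrec g) (hh : Primrec fun p : α × σ × β => h p.1 p.2.1 p.2.2) :
    Primrec fun x => (f x).foldl (h x) (g x) := Primrec.list_foldl hf hg hh.to₂

@[fun_prop]
theorem listFilter_fun {f : α → List β} {p : α → β → Bool} (hf : Primrec f)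
    (hp : Primrec fun q : α × β => p q.1 q.2) : Primrec fun x => (f x).filter (p x) := by
  have : Primrec fun x => (f x).filterMap fun b => bif p x b then some b else none := by fun_prop
  refine this.of_eq fun x => ?_
  rw [← List.filterMap_eq_filter]
  congr 1
  funext b
  cases h : p x b <;> simp [Option.guard, h]

@[fun_prop]
theorem listIsEmpty_fun {f : α → List β} (hf : Primrec f) : Primrec fun x => (f x).isEmpty := by
  have : Primrec fun x => (f x).length == 0 := by fun_prop
  refine this.of_eq fun x => ?_
  cases f x <;> rfl

@[fun_prop]
theorem listAll_fun {f : α → List β} {p : α → β → Bool} (hf : Primrec f)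
    (hp : Primrec fun q : α × β => p q.1 q.2) : Primrec fun x => (f x).all (p x) := by
  have : Primrec fun x => ((f x).filter fun b => !(p x b)).isEmpty := by fun_prop
  refine this.of_eq fun x => ?_
  rw [Bool.eq_iff_iff]
  simp [List.isEmpty_iff, List.filter_eq_nil_iff]

@[fun_prop]
theorem listAny_fun {f : α → List β} {p : α → β → Bool} (hf : Primrec f)
    (hp : Primrec fun q : α × β => p q.1 q.2) : Primrec fun x => (f x).any (p x) := by
  have : Primrec fun x => !((f x).all fun b => !(p x b)) := by fun_prop
  exact this.of_eq fun x => by rw [List.any_eq_not_all_not]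

@[fun_prop]
theorem listsOf_fun {f : α → List β} {g : α → ℕ} (hf : Primrec f) (hg : Primrec g) :
    Primrec fun x => listsOf (f x) (g x) := by
  have h : Primrec fun p : α × ℕ × List (List β) =>
      p.2.2.flatMap fun w => (f p.1).map fun a => a :: w := by fun_prop
  exact Primrec.nat_rec' hg (Primrec.const [[]]) h.to₂

@[fun_prop]
theorem words_fun {f g : α → ℕ} (hf : Primrec f) (hg : Primrec g) :
    Primrec fun x => words (f x) (g x) := by
  unfold words; fun_prop

@[fun_prop]
theorem runTable_fun {t : α → List (List ℕ)} {s : α → ℕ} {u : α → List ℕ} (ht : Primrec t)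
    (hs : Primrec s) (hu : Primrec u) : Primrec fun x => runTable (t x) (s x) (u x) := by
  unfold runTable; fun_prop

end Compositional

section Codes

variable {α : Type} [Primcodable α] {c : α → TransducerCode} {b b' : α → BimachineCode}
  {u : α → List ℕ}

@[fun_prop]
theorem transducerCode_images (hc : Primrec c) (hu : Primrec u) :
    Primrec fun x => (c x).images (u x) := by
  unfold TransducerCode.images TransducerCode.runs; fun_prop

@[fun_prop]
theorem bimachineCode_leftEval (hb : Primrec b) (hu : Primrec u) :
    Primrec fun x => (b x).leftEval (u x) := by
  unfold BimachineCode.leftEval; fun_prop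

@[fun_prop]
theorem bimachineCode_rightEval (hb : Primrec b) (hu : Primrec u) :
    Primrec fun x => (b x).rightEval (u x) := by
  unfold BimachineCode.rightEval; fun_prop

@[fun_prop]
theorem bimachineCode_leftFinal (hb : Primrec b) (hu : Primrec u) :
    Primrec fun x => (b x).leftFinal (u x) := by
  unfold BimachineCode.leftFinal; fun_prop

@[fun_prop]
theorem bimachineCode_rightFinal (hb : Primrec b) (hu : Primrec u) :
    Primrec fun x => (b x).rightFinal (u x) := by
  unfold BimachineCode.rightFinal; fun_prop

@[fun_prop]
theorem bimachineCode_image (hb : Primrec b) (hu : Primrec u) :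
    Primrec fun x => (b x).image (u x) := by
  unfold BimachineCode.image BimachineCode.output; fun_prop

@[fun_prop]
theorem transducerCode_size (hc : Primrec c) : Primrec fun x => (c x).size := by
  unfold TransducerCode.size; fun_prop

@[fun_prop]
theorem transducerCode_stateBound (hc : Primrec c) : Primrec fun x => (c x).stateBound := by
  unfold TransducerCode.stateBound; fun_prop

@[fun_prop]
theorem transducerCode_outputBound (hc : Primrec c) : Primrec fun x => (c x).outputBound := by
  unfold TransducerCode.outputBound; fun_prop

@[fun_prop]
theorem transducerCode_wordBound (hc : Primrec c) : Primrec fun x => (c x).wordBound := by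
  unfold TransducerCode.wordBound; fun_prop

@[fun_prop]
theorem transducerCode_isFunctional (hc : Primrec c) : Primrec fun x => (c x).isFunctional := by
  unfold TransducerCode.isFunctional; fun_prop

@[fun_prop]
theorem bimachineCandidates_fun {k N m : α → ℕ} (hk : Primrec k) (hN : Primrec N)
    (hm : Primrec m) : Primrec fun x => bimachineCandidates (k x) (N x) (m x) := by
  unfold bimachineCandidates; fun_prop

@[fun_prop]
theorem transducerCode_isGood (hc : Primrec c) (hb : Primrec b) :
    Primrec fun x => (c x).isGood (b x) := by
  unfold TransducerCode.isGood; fun_prop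

@[fun_prop]
theorem transducerCode_isFiner (hc : Primrec c) (hb : Primrec b) (hb' : Primrec b') :
    Primrec fun x => (c x).isFiner (b x) (b' x) := by
  unfold TransducerCode.isFiner; fun_prop

@[fun_prop]
theorem transducerCode_minimalBimachines (hc : Primrec c) :
    Primrec fun x => (c x).minimalBimachines := by
  unfold TransducerCode.minimalBimachines TransducerCode.bimachines; fun_prop

end Codes

end Primrec

/-! ### The transition congruence of a bimachine as the kernel of a morphism -/

theorem nodup_listsOf {α : Type} {xs : List α} (h : xs.Nodup) (n : ℕ) : (listsOf xs n).Nodup := by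
  induction n with
  | zero => exact List.nodup_singleton _
  | succ n ih =>
    change ((listsOf xs n).flatMap fun w => xs.map fun a => a :: w).Nodup
    rw [List.nodup_flatMap]
    refine ⟨fun w _ => h.map fun a b e => by simpa using e, ih.imp ?_⟩
    intro v w hvw x hx hx'
    obtain ⟨a, -, rfl⟩ := List.mem_map.1 hx
    obtain ⟨b, -, e⟩ := List.mem_map.1 hx'
    exact hvw (List.cons.inj e).2.symm

/-- The pairs of a transformation of the left states and one of the right states, as lists of
values. -/
def transformations (l r : ℕ) : List (List ℕ × List ℕ) :=
  (listsOf (List.range l) l).flatMap fun s => (listsOf (List.range r) r).map fun t => (s, t)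

theorem nodup_transformations (l r : ℕ) : (transformations l r).Nodup := by
  rw [transformations, List.nodup_flatMap]
  refine ⟨fun s _ => (nodup_listsOf List.nodup_range r).map fun a b e => by simpa using e,
    (nodup_listsOf List.nodup_range l).imp ?_⟩
  intro v w hvw x hx hx'
  obtain ⟨a, -, rfl⟩ := List.mem_map.1 hx
  obtain ⟨b, -, e⟩ := List.mem_map.1 hx'
  exact hvw (Prod.mk.inj e).1.symm

/-- The composition of pairs of transformations: the left states are transformed by the first factor
and then by the second one, the right states the other way round. -/
def mulTransformation (x y : List ℕ × List ℕ) : List ℕ × List ℕ :=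
  (x.1.map fun i => y.1.getD i 0, y.2.map fun i => x.2.getD i 0)

/-- The table of the morphism that maps a word to the transformations of the left and right states of
a bimachine. -/
def BimachineCode.morphismCode (b : BimachineCode) : MorphismCode :=
  (b.1.1, (transformations b.1.2.1 b.1.2.2).length,
    (transformations b.1.2.1 b.1.2.2).idxOf (List.range b.1.2.1, List.range b.1.2.2),
    ((transformations b.1.2.1 b.1.2.2).map fun x => (transformations b.1.2.1 b.1.2.2).map fun y =>
      (transformations b.1.2.1 b.1.2.2).idxOf (mulTransformation x y)),
    (List.range b.1.1).map fun a => (transformations b.1.2.1 b.1.2.2).idxOf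
      (b.2.1.1.map fun t => t.getD a 0, b.2.2.1.1.map fun t => t.getD a 0))

@[fun_prop]
theorem Primrec.bimachineCode_morphismCode {α : Type} [Primcodable α] {b : α → BimachineCode}
    (hb : Primrec b) : Primrec fun x => (b x).morphismCode := by
  unfold BimachineCode.morphismCode transformations mulTransformation; fun_prop

namespace Bimachine

/-- The monoid of pairs of a transformation of the left states, acting from the right, and of a
transformation of the right states, acting from the left. -/
abbrev TransformationMonoid (l r : ℕ) : Type :=
  (Function.End (Fin l))ᵐᵒᵖ × Function.End (Fin r)

/-- A pair of transformations as a pair of lists of values. -/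
def transformationCode {l r : ℕ} (x : TransformationMonoid l r) : List ℕ × List ℕ :=
  (List.ofFn fun i => (x.1.unop i : ℕ), List.ofFn fun i => (x.2 i : ℕ))

theorem transformationCode_injective {l r : ℕ} :
    Function.Injective (transformationCode (l := l) (r := r)) := by
  intro x y h
  obtain ⟨h1, h2⟩ := Prod.mk.inj h
  refine Prod.ext (MulOpposite.unop_injective (funext fun i => Fin.ext ?_))
    (funext fun i => Fin.ext ?_)
  · exact congrFun (List.ofFn_injective h1) i
  · exact congrFun (List.ofFn_injective h2) i

theorem transformationCode_mul {l r : ℕ} (x y : TransformationMonoid l r) :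
    transformationCode (x * y) = mulTransformation (transformationCode x) (transformationCode y) := by
  simp only [transformationCode, mulTransformation, List.map_ofFn, Function.comp_def, getD_ofFn]
  rfl

theorem mem_transformations {l r : ℕ} {p : List ℕ × List ℕ} :
    p ∈ transformations l r ↔ ∃ x : TransformationMonoid l r, transformationCode x = p := by
  simp only [transformations, List.mem_flatMap, List.mem_map]
  constructor
  · rintro ⟨s, hs, t, ht, rfl⟩
    have hrange : ∀ n, ∀ a ∈ List.range n, ∃ i : Fin n, (i : ℕ) = a := fun n a ha =>
      ⟨⟨a, List.mem_range.1 ha⟩, rfl⟩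
    obtain ⟨φ, rfl⟩ := exists_ofFn_of_mem_listsOf (fun i : Fin l => (i : ℕ)) hs (hrange l)
    obtain ⟨ψ, rfl⟩ := exists_ofFn_of_mem_listsOf (fun i : Fin r => (i : ℕ)) ht (hrange r)
    exact ⟨(MulOpposite.op φ, ψ), rfl⟩
  · rintro ⟨x, rfl⟩
    exact ⟨_, ofFn_mem_listsOf fun i => List.mem_range.2 (x.1.unop i).2, _,
      ofFn_mem_listsOf fun i => List.mem_range.2 (x.2 i).2, rfl⟩

/-- The numbering of the pairs of transformations. -/
noncomputable def transformationEquiv (l r : ℕ) :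
    TransformationMonoid l r ≃ Fin (transformations l r).length :=
  Equiv.ofBijective (fun x => ⟨(transformations l r).idxOf (transformationCode x),
      List.idxOf_lt_length_iff.2 (mem_transformations.2 ⟨x, rfl⟩)⟩) (by
    constructor
    · intro x y h
      exact transformationCode_injective ((List.idxOf_inj (mem_transformations.2 ⟨x, rfl⟩)).1
        (Fin.mk.inj h))
    · intro i
      obtain ⟨x, hx⟩ := mem_transformations.1 (List.getElem_mem i.2)
      exact ⟨x, Fin.ext (by
        change (transformations l r).idxOf (transformationCode x) = i
        rw [hx, (nodup_transformations l r).idxOf_getElem])⟩)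

theorem transformationEquiv_apply {l r : ℕ} (x : TransformationMonoid l r) :
    (transformationEquiv l r x : ℕ) = (transformations l r).idxOf (transformationCode x) := rfl

theorem map_transformations {l r : ℕ} {α : Type} (h : List ℕ × List ℕ → α) :
    (transformations l r).map h =
      List.ofFn fun i => h (transformationCode ((transformationEquiv l r).symm i)) := by
  refine List.ext_getElem (by simp) fun i h1 h2 => ?_
  rw [List.getElem_map, List.getElem_ofFn]
  congr 1
  have hi : i < (transformations l r).length := by simpa using h1
  have e : (transformations l r).idxOf (transformationCode ((transformationEquiv l r).symm ⟨i, hi⟩))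
      = i := by
    rw [← transformationEquiv_apply, Equiv.apply_symm_apply]
  have := List.getElem_idxOf (List.idxOf_lt_length_iff.2 (mem_transformations.2
    ⟨(transformationEquiv l r).symm ⟨i, hi⟩, rfl⟩))
  rw [← this]
  congr 1
  exact e.symm

variable {k l r : ℕ} (B : Bimachine (Fin k) (Fin l) (Fin r))

/-- The transformations of the states by a letter. -/
def letterTransformation (a : Fin k) : TransformationMonoid l r :=
  (MulOpposite.op fun p => B.lstep p a, fun q => B.rstep q a)

/-- The computed table is that of the morphism which extends `letterTransformation`. -/
theorem code_morphismCode : BimachineCode.morphismCode B.code =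
    morphismCode (transformationEquiv l r) B.letterTransformation := by
  have e1 : transformationCode (1 : TransformationMonoid l r) = (List.range l, List.range r) := by
    have h : ∀ n, (List.ofFn fun i : Fin n => (i : ℕ)) = List.range n := fun n =>
      List.ext_getElem (by simp) (by simp)
    exact Prod.ext (h l) (h r)
  simp only [BimachineCode.morphismCode, morphismCode, map_transformations,
    transformationEquiv_apply, transformationCode_mul, e1]
  refine Prod.ext rfl (Prod.ext rfl (Prod.ext rfl (Prod.ext rfl ?_)))
  change (List.range k).map _ = _
  refine List.ext_getElem (by simp) fun i h1 h2 => ?_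
  have hi : i < k := by simpa using h1
  simp only [List.getElem_map, List.getElem_range, List.getElem_ofFn]
  congr 1
  simp only [Bimachine.code, transformationCode, letterTransformation, List.map_ofFn]
  refine Prod.ext (congrArg List.ofFn (funext fun p => ?_)) (congrArg List.ofFn (funext fun p => ?_))
  · exact getD_ofFn (fun a => (B.lstep p a : ℕ)) ⟨i, hi⟩ 0
  · exact getD_ofFn (fun a => (B.rstep p a : ℕ)) ⟨i, hi⟩ 0

theorem lift_letterTransformation (u : FreeMonoid (Fin k)) :
    (∀ p, (FreeMonoid.lift B.letterTransformation u).1.unop p = B.left.evalFrom p u.toList) ∧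
      ∀ q, (FreeMonoid.lift B.letterTransformation u).2 q =
        B.right.evalFrom q u.toList.reverse := by
  induction u using FreeMonoid.inductionOn' with
  | one => exact ⟨fun _ => rfl, fun _ => rfl⟩
  | of_mul a u ih =>
    rw [map_mul, FreeMonoid.lift_eval_of, FreeMonoid.toList_of_mul]
    refine ⟨fun p => ih.1 (B.lstep p a), fun q => ?_⟩
    rw [List.reverse_cons, DFA.evalFrom_append_singleton, ← ih.2]
    rfl

/-- The transformation monoid is finite, so a decidable class can be tested on this kernel. -/
theorem ker_lift_letterTransformation :
    Con.ker (FreeMonoid.lift B.letterTransformation) = B.transitionCon := by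
  ext u v
  rw [Con.ker_rel, transitionCon_iff, Prod.ext_iff, ← MulOpposite.unop_inj]
  simp only [← (B.lift_letterTransformation _).1, ← (B.lift_letterTransformation _).2]
  exact and_congr funext_iff funext_iff

end Bimachine

/-! ### The decision procedures -/

/-- Whether a computable test holds for some entry of a list is computable. -/
theorem Computable.list_any {α : Type} [Primcodable α] {p : α → Bool} (hp : Computable p) :
    Computable fun l : List α => l.any p := by
  have hstep : Computable₂ fun (l : List α) (x : ℕ × Bool) =>
      x.2 || (Option.casesOn l[x.1]? false p : Bool) :=
    Primrec.or.to_comp.comp (snd.comp snd) (option_casesOn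
      (list_getElem?.comp fst (fst.comp snd)) (const false) (hp.comp snd).to₂)
  refine (nat_rec (f := fun l : List α => l.length) (g := fun _ => false)
    list_length (const false) hstep).of_eq fun l => ?_
  suffices h : ∀ n, (Nat.rec false (fun i b => b || (Option.casesOn l[i]? false p : Bool)) n : Bool)
      = (l.take n).any p by
    rw [h, List.take_length]
  intro n
  induction n with
  | zero => rfl
  | succ n ih =>
    rw [List.take_add_one, List.any_append, ← ih]
    refine congrArg (or _) ?_
    generalize l[n]? = o
    cases o <;> simp

theorem mainTheorem1 :
    -- for a decidable class, being a transducer that realizes a `V`-transduction is decidable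
    (∀ V : CongruenceClass, V.IsDecidable →
      ∃ d : TransducerCode → Bool, Computable d ∧
        ∀ (k n : ℕ) (T : Transducer (Fin k) (Fin n)),
          d T.code = true ↔
            ∃ f : List (Fin k) →. List (Fin k), T.RealizesFun f ∧ V.IsTransduction f) ∧
    -- representatives of all minimal bimachines are computable, and it suffices to test them
    (∃ reps : TransducerCode → List BimachineCode, Computable reps ∧
      ∀ (k n : ℕ) (T : Transducer (Fin k) (Fin n)) (f : List (Fin k) →. List (Fin k)),
        T.RealizesFun f →
          ∃ Bs : List (FinBimachine k),
            reps T.code = Bs.map (fun B => B.toBimachine.code) ∧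
            (∀ B ∈ Bs, B.toBimachine.IsMinimalFor f) ∧
            (∀ (L R : Type) [Finite L] [Finite R] (B : Bimachine (Fin k) L R),
              B.IsMinimalFor f →
                ∃ B' ∈ Bs, B.Finer B'.toBimachine ∧ B'.toBimachine.Finer B) ∧
            (∀ V : CongruenceClass,
              V.IsTransduction f ↔ ∃ B ∈ Bs, B.toBimachine.transitionCon ∈ V.mem (Fin k))) := by
  have key : ∀ (k n : ℕ) (T : Transducer (Fin k) (Fin n)) (f : List (Fin k) →. List (Fin k)),
      T.RealizesFun f → ∃ Bs : List (FinBimachine k),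
        TransducerCode.minimalBimachines T.code = Bs.map (fun B => B.toBimachine.code) ∧
        (∀ B ∈ Bs, B.toBimachine.IsMinimalFor f) ∧
        (∀ (L R : Type) [Finite L] [Finite R] (B : Bimachine (Fin k) L R), B.IsMinimalFor f →
          ∃ B' ∈ Bs, B.Finer B'.toBimachine ∧ B'.toBimachine.Finer B) ∧
        ∀ V : CongruenceClass,
          V.IsTransduction f ↔ ∃ B ∈ Bs, B.toBimachine.transitionCon ∈ V.mem (Fin k) := by
    intro k n T f hT
    obtain ⟨Bs, hBs, hmin, hall⟩ := T.minimalBimachines_eq_map hT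
    refine ⟨Bs, hBs, fun B hB => (hmin B hB).2, hall, fun V => ⟨?_, ?_⟩⟩
    · -- `V` need not contain the congruence of `T`, so a transducer `T'` that witnesses the
      -- membership is taken: below its bimachine there is a minimal one, which is in the list
      rintro ⟨Q, _, T', hT', hV⟩
      obtain ⟨B, hB, hcoarse⟩ := hT'.exists_bimachine
      obtain ⟨L, R, _, _, B', hB', hf⟩ := hB.exists_minimal
      obtain ⟨B'', hmem, h1, -⟩ := hall L R B' hB'
      exact ⟨B'', hmem, V.mem_of_le _ _ _ hV (hcoarse _ _ _ (hmin _ hmem).1 (hf.trans h1))⟩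
    · rintro ⟨B, hB, hV⟩
      exact (hmin B hB).2.1.isTransduction hV
  have hreps : Primrec fun c : TransducerCode => c.minimalBimachines := by fun_prop
  refine ⟨fun V ⟨d, hd, hdV⟩ => ?_, fun c => c.minimalBimachines, hreps.to_comp, key⟩
  refine ⟨fun c => c.isFunctional && c.minimalBimachines.any fun b => d b.morphismCode,
    Primrec.and.to_comp.comp (Primrec.to_comp (by fun_prop)) ((Computable.list_any
      (hd.comp (Primrec.bimachineCode_morphismCode Primrec.id).to_comp)).comp hreps.to_comp),
    fun k n T => ?_⟩
  -- the bimachines in the list are tested by the kernels of their morphisms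
  have htest : ∀ f, T.RealizesFun f → ((TransducerCode.minimalBimachines T.code).any
      (fun b => d b.morphismCode) = true ↔ V.IsTransduction f) := by
    intro f hT
    obtain ⟨Bs, hBs, -, -, hV⟩ := key k n T f hT
    rw [hV, hBs, List.any_map, List.any_eq_true]
    refine exists_congr fun B => and_congr_right fun _ => ?_
    rw [Function.comp_apply, Bimachine.code_morphismCode, hdV,
      Bimachine.ker_lift_letterTransformation]
  rw [Bool.and_eq_true, Transducer.isFunctional_code_iff]
  constructor
  · rintro ⟨⟨f, hT⟩, h⟩
    exact ⟨f, hT, (htest f hT).1 h⟩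
  · rintro ⟨f, hT, h⟩
    exact ⟨⟨f, hT⟩, (htest f hT).2 h⟩
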